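/- We work in homotopy type theory: Martin-Löf type theory with univalent universes, function extensionality and higher inductive types. For a type $A$, let $\mathbf{F}A$ be the free $\infty$-group on $A$, i.e. the higher inductive type with constructors $\mathsf{unit}:\mathbf{F}A$, $\mathsf{cons},\mathsf{icons}:A\to\mathbf{F}A\to\mathbf{F}A$, $\mu_1(a,x):\mathsf{icons}_a(\mathsf{cons}_a(x))=x$, $\mu_2(a,x):\mathsf{cons}_a(\mathsf{icons}_a(x))=x$ and $\mu(a,x):\mathsf{ap}_{\mathsf{cons}_a}(\mu_1(a,x))=\mu_2(a,\mathsf{cons}_a(x))$. Equivalently, $(\mathbf{F}A,\mathsf{unit},\mathsf{cons})$ is the homotopy-initial type $X$ equipped with a point $u:X$ and a map $f:A\to X\to X$ such that each $f(a)$ is an equivalence: for every such $(X,u,f)$ the type of triples consisting of $h:\mathbf{F}A\to X$, $r:h(\mathsf{unit})=u$ and $s:h\circ\mathsf{cons}=f\circ h$ is contractible. Let $G(A)$ be the set-based free group on $A$: the set-quotient of $\mathsf{List}(A+A)$ by the mere relation that relates $x\,s\,s^{-1}\,y$ to $x\,y$ for all lists $x,y$ and all $s:A+A$, where $\mathsf{inl}(a)^{-1}=\mathsf{inr}(a)$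 and $\mathsf{inr}(a)^{-1}=\mathsf{inl}(a)$. For a list $w$ over $A+A$ let $[w]:G(A)$ be its class, and let $\langle w\rangle:\mathbf{F}A$ be the element given by $\langle\mathsf{nil}\rangle=\mathsf{unit}$, $\langle\mathsf{inl}(a)\,w\rangle=\mathsf{cons}_a\langle w\rangle$ and $\langle\mathsf{inr}(a)\,w\rangle=\mathsf{icons}_a\langle w\rangle$. **Theorem.** The following are theorems of homotopy type theory, for $A$ in any universe $\mathcal{U}_i$. 1. If $A$ is a set, then there is an equivalence $e:\|\mathbf{F}A\|_1\simeq G(A)$ with $e(|\langle w\rangle|)=[w]$ for all lists $w$ over $A+A$. 2. If $A$ is a set and $\mathbf{F}A$ is a set, then there is an equivalence $e:\mathbf{F}A\simeq G(A)$ with $e(\langle w\rangle)=[w]$ for all lists $w$ over $A+A$. -/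

import Mathlib

/-!
Homotopy type theory as a formal system: Martin-Löf type theory with a cumulative hierarchy of
universes, `Π`, `Σ`, `+`, `0`, `1`, `ℕ`, `List`, identity types, function extensionality,
univalence, truncations, set-quotients, and the higher inductive type `F A` (the free `∞`-group).
-/

namespace HoTT

/-! ### Raw syntax -/

/-- The constants of the theory. The arguments `i`, `k` are universe levels (`k` is the level of the
motive of an eliminator); in `tr n`, `n` is the truncation level plus one. -/
inductive Cst where
  | sig (i : ℕ) | pair (i : ℕ) | sigElim (i k : ℕ)
  | sum (i : ℕ) | inl (i : ℕ) | inr (i : ℕ) | sumElim (i k : ℕ)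
  | empty | emptyElim (k : ℕ)
  | one | star | oneElim (k : ℕ)
  | nat | zero | succ | natElim (k : ℕ)
  | list (i : ℕ) | nil (i : ℕ) | cons (i : ℕ) | listElim (i k : ℕ)
  | eq (i : ℕ) | refl (i : ℕ) | eqElim (i k : ℕ)
  | funext (i : ℕ)
  | ua (i : ℕ)
  | tr (n i : ℕ) | trIn (n i : ℕ) | trLevel (n i : ℕ) | trElim (n i k : ℕ)
  | quo (i : ℕ) | quoIn (i : ℕ) | quoEq (i : ℕ) | quoSet (i : ℕ) | quoElim (i k : ℕ)
  | free (i : ℕ) | fUnit (i : ℕ) | fCons (i : ℕ) | fIcons (i : ℕ)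
  | fMu1 (i : ℕ) | fMu2 (i : ℕ) | fMu (i : ℕ) | fInit (i j : ℕ)
  deriving DecidableEq

/-- Raw terms, with de Bruijn indices; types are terms (universes à la Russell). -/
inductive Tm where
  | var (n : ℕ)
  | univ (i : ℕ)
  | pi (A B : Tm)
  | lam (A b : Tm)
  | app (f a : Tm)
  | cst (c : Cst)
  deriving DecidableEq

namespace Tm

/-- Extend a renaming under a binder. -/
def liftRen (ρ : ℕ → ℕ) : ℕ → ℕ
  | 0 => 0
  | n + 1 => ρ n + 1

def rename : (ℕ → ℕ) → Tm → Tm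
  | ρ, var n => var (ρ n)
  | _, univ i => univ i
  | ρ, pi A B => pi (rename ρ A) (rename (liftRen ρ) B)
  | ρ, lam A b => lam (rename ρ A) (rename (liftRen ρ) b)
  | ρ, app f a => app (rename ρ f) (rename ρ a)
  | _, cst c => cst c

/-- Extend a substitution under a binder. -/
def liftSub (σ : ℕ → Tm) : ℕ → Tm
  | 0 => var 0
  | n + 1 => rename Nat.succ (σ n)

def subst : (ℕ → Tm) → Tm → Tm
  | σ, var n => σ n
  | _, univ i => univ i
  | σ, pi A B => pi (subst σ A) (subst (liftSub σ) B)
  | σ, lam A b => lam (subst σ A) (subst (liftSub σ) b)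
  | σ, app f a => app (subst σ f) (subst σ a)
  | _, cst c => cst c

/-- The substitution sending the innermost variable to `a`. -/
def single (a : Tm) : ℕ → Tm
  | 0 => a
  | n + 1 => var n

/-- `b[a/x]` for the innermost variable `x`. -/
def inst (b a : Tm) : Tm := subst (single a) b

/-- Iterated application. -/
def apps (f : Tm) (as : List Tm) : Tm := as.foldl app f

end Tm

/-! ### Notation for writing terms -/

/-- An expression that can be placed under any number `n` of binders; `e.build n` is the raw term
that stands for it there. This lets terms be written with Lean variables for bound variables. -/
structure Exp where
  build : ℕ → Tm

namespace Exp

/-- Application is written as juxtaposition. -/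
instance : CoeFun Exp (fun _ => Exp → Exp) := ⟨fun f a => ⟨fun n => .app (f.build n) (a.build n)⟩⟩

def U (i : ℕ) : Exp := ⟨fun _ => .univ i⟩

def c (k : Cst) : Exp := ⟨fun _ => .cst k⟩

/-- The variable bound by the binder number `n` (counted from the outside). -/
def bound (n : ℕ) : Exp := ⟨fun m => .var (m - n - 1)⟩

/-- `(x : A) → B x` -/
def Pi (A : Exp) (B : Exp → Exp) : Exp :=
  ⟨fun n => .pi (A.build n) ((B (bound n)).build (n + 1))⟩

/-- `λ (x : A). b x` -/
def Lam (A : Exp) (b : Exp → Exp) : Exp :=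
  ⟨fun n => .lam (A.build n) ((b (bound n)).build (n + 1))⟩

def arr (A B : Exp) : Exp := Pi A fun _ => B

infixr:25 " ⇾ " => arr

/-! ### Basic type formers and defined notions

The first argument `i` of each of these is a universe level in which all the types involved lie. -/

/-- `Σ (x : A), B x` -/
def Sig (i : ℕ) (A : Exp) (B : Exp → Exp) : Exp := c (.sig i) A (Lam A B)

def Pair (i : ℕ) (A : Exp) (B : Exp → Exp) (a b : Exp) : Exp := c (.pair i) A (Lam A B) a b

/-- The first projection of `p : Σ (x : A), B x`. -/
def Fst (i : ℕ) (A : Exp) (B : Exp → Exp) (p : Exp) : Exp :=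
  c (.sigElim i i) A (Lam A B) (Lam (Sig i A B) fun _ => A)
    (Lam A fun a => Lam (B a) fun _ => a) p

def Prod (i : ℕ) (A B : Exp) : Exp := Sig i A fun _ => B

/-- The identity type `x =_A y`. -/
def Eq (i : ℕ) (A x y : Exp) : Exp := c (.eq i) A x y

def Refl (i : ℕ) (A x : Exp) : Exp := c (.refl i) A x

/-- Transport of `u : P x` along `p : x =_A y`, with `A : U i` and `P : A → U k`. -/
def Transport (i k : ℕ) (A P x y p u : Exp) : Exp :=
  c (.eqElim i k) A x (Lam A fun y' => Lam (Eq i A x y') fun _ => P y') u y p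

/-- `ap f p : f x =_B f y` for `f : A → B` and `p : x =_A y`. -/
def Ap (i : ℕ) (A B f x y p : Exp) : Exp :=
  c (.eqElim i i) A x (Lam A fun y' => Lam (Eq i A x y') fun _ => Eq i B (f x) (f y'))
    (Refl i B (f x)) y p

def isContr (i : ℕ) (A : Exp) : Exp := Sig i A fun x => Pi A fun y => Eq i A x y

/-- `isTrunc n i A` says that `A` is an `(n-1)`-type: a mere proposition for `n = 0`, a set for
`n = 1`, a `1`-type for `n = 2`. -/
def isTrunc : ℕ → ℕ → Exp → Exp
  | 0, i, A => Pi A fun x => Pi A fun y => Eq i A x y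
  | n + 1, i, A => Pi A fun x => Pi A fun y => isTrunc n i (Eq i A x y)

def isSet (i : ℕ) (A : Exp) : Exp := isTrunc 1 i A

/-- The coherence `(x : A) → ap f (η x) = ε (f x)` of a half-adjoint equivalence. -/
def haeCoh (i : ℕ) (A B f g η ε : Exp) : Exp :=
  Pi A fun x => Eq i (Eq i B (f (g (f x))) (f x)) (Ap i A B f (g (f x)) x (η x)) (ε (f x))

def haeEps (i : ℕ) (A B f g η : Exp) : Exp :=
  Sig i (Pi B fun y => Eq i B (f (g y)) y) fun ε => haeCoh i A B f g η ε

def haeEta (i : ℕ) (A B f g : Exp) : Exp :=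
  Sig i (Pi A fun x => Eq i A (g (f x)) x) fun η => haeEps i A B f g η

/-- `f : A → B` is an equivalence: there are `g : B → A`, `η : (x : A) → g (f x) = x`,
`ε : (y : B) → f (g y) = y` and `τ : (x : A) → ap f (η x) = ε (f x)`. -/
def isEquiv (i : ℕ) (A B f : Exp) : Exp := Sig i (B ⇾ A) fun g => haeEta i A B f g

/-- The type `A ≃ B` of equivalences. -/
def Equiv (i : ℕ) (A B : Exp) : Exp := Sig i (A ⇾ B) fun f => isEquiv i A B f

/-- The function underlying an equivalence. -/
def EquivFun (i : ℕ) (A B e : Exp) : Exp := Fst i (A ⇾ B) (fun f => isEquiv i A B f) e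

/-- The identity equivalence of `A`. -/
def IdEquiv (i : ℕ) (A : Exp) : Exp :=
  let f := Lam A fun x => x
  let h := Lam A fun x => Refl i A x
  let τ := Lam A fun x => Refl i (Eq i A x x) (Refl i A x)
  Pair i (A ⇾ A) (fun f => isEquiv i A A f) f <|
    Pair i (A ⇾ A) (fun g => haeEta i A A f g) f <|
      Pair i (Pi A fun x => Eq i A (f (f x)) x) (fun η => haeEps i A A f f η) h <|
        Pair i (Pi A fun y => Eq i A (f (f y)) y) (fun ε => haeCoh i A A f f h ε) h τ

/-- `happly : f = g → ((x : A) → f x = g x)` for dependent functions `f g : (x : A) → B x`. -/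
def Happly (i : ℕ) (A B f g : Exp) : Exp :=
  let T := Pi A fun x => B x
  Lam (Eq i T f g) fun p =>
    c (.eqElim i i) T f
      (Lam T fun g' => Lam (Eq i T f g') fun _ => Pi A fun x => Eq i (B x) (f x) (g' x))
      (Lam A fun x => Refl i (B x) (f x)) g p

/-- `idtoeqv : A = B → A ≃ B` for types `A B : U i`. -/
def IdToEquiv (i : ℕ) (A B : Exp) : Exp :=
  Lam (Eq (i + 1) (U i) A B) fun p =>
    c (.eqElim (i + 1) i) (U i) A
      (Lam (U i) fun B' => Lam (Eq (i + 1) (U i) A B') fun _ => Equiv i A B')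
      (IdEquiv i A) B p

/-- The `(n-1)`-truncation of `A`. -/
def Trunc (n i : ℕ) (A : Exp) : Exp := c (.tr n i) A

/-- The set-quotient of `A` by `R : A → A → U i`. -/
def Quo (i : ℕ) (A R : Exp) : Exp := c (.quo i) A R

/-- The free `∞`-group on `A`. -/
def Free (i : ℕ) (A : Exp) : Exp := c (.free i) A

/-- The type of morphisms from `(F A, unit, cons)` to an algebra `(X, u, f)`: triples consisting of
`h : F A → X`, `r : h unit = u` and `s : h ∘ cons = f ∘ h`. Here `A : U i` and `X : U j`. -/
def FreeHom (i j : ℕ) (A X u f : Exp) : Exp :=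
  let m := max i j
  Sig m (Free i A ⇾ X) fun h =>
    Prod m (Eq m X (h (c (.fUnit i) A)) u)
      (Eq m (A ⇾ Free i A ⇾ X)
        (Lam A fun a => Lam (Free i A) fun x => h (c (.fCons i) A a x))
        (Lam A fun a => Lam (Free i A) fun x => f a (h x)))

end Exp

open Exp

/-! ### The rules -/

/-- The (closed) types of the constants. -/
def Cst.type : Cst → Exp
  -- dependent pairs
  | sig i => Pi (U i) fun A => (A ⇾ U i) ⇾ U i
  | pair i => Pi (U i) fun A => Pi (A ⇾ U i) fun B => Pi A fun a => B a ⇾ c (.sig i) A B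
  | sigElim i k => Pi (U i) fun A => Pi (A ⇾ U i) fun B => Pi (c (.sig i) A B ⇾ U k) fun P =>
      (Pi A fun a => Pi (B a) fun b => P (c (.pair i) A B a b)) ⇾
      Pi (c (.sig i) A B) fun p => P p
  -- coproducts
  | sum i => U i ⇾ U i ⇾ U i
  | inl i => Pi (U i) fun A => Pi (U i) fun B => A ⇾ c (.sum i) A B
  | inr i => Pi (U i) fun A => Pi (U i) fun B => B ⇾ c (.sum i) A B
  | sumElim i k => Pi (U i) fun A => Pi (U i) fun B => Pi (c (.sum i) A B ⇾ U k) fun P =>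
      (Pi A fun a => P (c (.inl i) A B a)) ⇾ (Pi B fun b => P (c (.inr i) A B b)) ⇾
      Pi (c (.sum i) A B) fun s => P s
  -- the empty type, the unit type, the natural numbers
  | empty => U 0
  | emptyElim k => Pi (c .empty ⇾ U k) fun P => Pi (c .empty) fun x => P x
  | one => U 0
  | star => c .one
  | oneElim k => Pi (c .one ⇾ U k) fun P => P (c .star) ⇾ Pi (c .one) fun x => P x
  | nat => U 0
  | zero => c .nat
  | succ => c .nat ⇾ c .nat
  | natElim k => Pi (c .nat ⇾ U k) fun P => P (c .zero) ⇾
      (Pi (c .nat) fun n => P n ⇾ P (c .succ n)) ⇾ Pi (c .nat) fun n => P n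
  -- lists
  | list i => U i ⇾ U i
  | nil i => Pi (U i) fun A => c (.list i) A
  | cons i => Pi (U i) fun A => A ⇾ c (.list i) A ⇾ c (.list i) A
  | listElim i k => Pi (U i) fun A => Pi (c (.list i) A ⇾ U k) fun P => P (c (.nil i) A) ⇾
      (Pi A fun a => Pi (c (.list i) A) fun l => P l ⇾ P (c (.cons i) A a l)) ⇾
      Pi (c (.list i) A) fun l => P l
  -- identity types
  | eq i => Pi (U i) fun A => A ⇾ A ⇾ U i
  | refl i => Pi (U i) fun A => Pi A fun x => Eq i A x x
  | eqElim i k => Pi (U i) fun A => Pi A fun x => Pi (Pi A fun y => Eq i A x y ⇾ U k) fun P =>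
      P x (Refl i A x) ⇾ Pi A fun y => Pi (Eq i A x y) fun p => P y p
  -- function extensionality and univalence
  | funext i => Pi (U i) fun A => Pi (A ⇾ U i) fun B =>
      Pi (Pi A fun x => B x) fun f => Pi (Pi A fun x => B x) fun g =>
      isEquiv i (Eq i (Pi A fun x => B x) f g) (Pi A fun x => Eq i (B x) (f x) (g x))
        (Happly i A B f g)
  | ua i => Pi (U i) fun A => Pi (U i) fun B =>
      isEquiv (i + 1) (Eq (i + 1) (U i) A B) (Equiv i A B) (IdToEquiv i A B)
  -- truncations
  | tr _ i => U i ⇾ U i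
  | trIn n i => Pi (U i) fun A => A ⇾ Trunc n i A
  | trLevel n i => Pi (U i) fun A => isTrunc n i (Trunc n i A)
  | trElim n i k => Pi (U i) fun A => Pi (Trunc n i A ⇾ U k) fun P =>
      (Pi (Trunc n i A) fun x => isTrunc n k (P x)) ⇾ (Pi A fun a => P (c (.trIn n i) A a)) ⇾
      Pi (Trunc n i A) fun x => P x
  -- set-quotients
  | quo i => Pi (U i) fun A => (A ⇾ A ⇾ U i) ⇾ U i
  | quoIn i => Pi (U i) fun A => Pi (A ⇾ A ⇾ U i) fun R => A ⇾ Quo i A R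
  | quoEq i => Pi (U i) fun A => Pi (A ⇾ A ⇾ U i) fun R => Pi A fun a => Pi A fun b =>
      R a b ⇾ Eq i (Quo i A R) (c (.quoIn i) A R a) (c (.quoIn i) A R b)
  | quoSet i => Pi (U i) fun A => Pi (A ⇾ A ⇾ U i) fun R => isSet i (Quo i A R)
  | quoElim i k => Pi (U i) fun A => Pi (A ⇾ A ⇾ U i) fun R => Pi (Quo i A R ⇾ U k) fun P =>
      (Pi (Quo i A R) fun x => isSet k (P x)) ⇾
      Pi (Pi A fun a => P (c (.quoIn i) A R a)) fun f =>
      (Pi A fun a => Pi A fun b => Pi (R a b) fun r =>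
        Eq k (P (c (.quoIn i) A R b))
          (Transport i k (Quo i A R) P (c (.quoIn i) A R a) (c (.quoIn i) A R b)
            (c (.quoEq i) A R a b r) (f a))
          (f b)) ⇾
      Pi (Quo i A R) fun x => P x
  -- the free ∞-group: constructors
  | free i => U i ⇾ U i
  | fUnit i => Pi (U i) fun A => Free i A
  | fCons i => Pi (U i) fun A => A ⇾ Free i A ⇾ Free i A
  | fIcons i => Pi (U i) fun A => A ⇾ Free i A ⇾ Free i A
  | fMu1 i => Pi (U i) fun A => Pi A fun a => Pi (Free i A) fun x =>
      Eq i (Free i A) (c (.fIcons i) A a (c (.fCons i) A a x)) x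
  | fMu2 i => Pi (U i) fun A => Pi A fun a => Pi (Free i A) fun x =>
      Eq i (Free i A) (c (.fCons i) A a (c (.fIcons i) A a x)) x
  | fMu i => Pi (U i) fun A => Pi A fun a =>
      haeCoh i (Free i A) (Free i A) (c (.fCons i) A a) (c (.fIcons i) A a)
        (c (.fMu1 i) A a) (c (.fMu2 i) A a)
  -- the free ∞-group: homotopy initiality among all types `X` with a point `u : X` and a family
  -- `f : A → X → X` of equivalences
  | fInit i j => Pi (U i) fun A => Pi (U j) fun X => Pi X fun u => Pi (A ⇾ X ⇾ X) fun f =>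
      (Pi A fun a => isEquiv j X X (f a)) ⇾ isContr (max i j) (FreeHom i j A X u f)

/-- Computation rules of the eliminators on point constructors. -/
inductive Iota : Tm → Tm → Prop
  | sig (i k : ℕ) (A B P d A' B' a b : Tm) :
      Iota ((Tm.cst (.sigElim i k)).apps [A, B, P, d, (Tm.cst (.pair i)).apps [A', B', a, b]])
        (d.apps [a, b])
  | inl (i k : ℕ) (A B P d e A' B' a : Tm) :
      Iota ((Tm.cst (.sumElim i k)).apps [A, B, P, d, e, (Tm.cst (.inl i)).apps [A', B', a]])
        (d.app a)
  | inr (i k : ℕ) (A B P d e A' B' b : Tm) :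
      Iota ((Tm.cst (.sumElim i k)).apps [A, B, P, d, e, (Tm.cst (.inr i)).apps [A', B', b]])
        (e.app b)
  | star (k : ℕ) (P d : Tm) : Iota ((Tm.cst (.oneElim k)).apps [P, d, Tm.cst .star]) d
  | zero (k : ℕ) (P d e : Tm) : Iota ((Tm.cst (.natElim k)).apps [P, d, e, Tm.cst .zero]) d
  | succ (k : ℕ) (P d e n : Tm) :
      Iota ((Tm.cst (.natElim k)).apps [P, d, e, (Tm.cst .succ).app n])
        (e.apps [n, (Tm.cst (.natElim k)).apps [P, d, e, n]])
  | nil (i k : ℕ) (A P d e A' : Tm) :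
      Iota ((Tm.cst (.listElim i k)).apps [A, P, d, e, (Tm.cst (.nil i)).app A']) d
  | cons (i k : ℕ) (A P d e A' a l : Tm) :
      Iota ((Tm.cst (.listElim i k)).apps [A, P, d, e, (Tm.cst (.cons i)).apps [A', a, l]])
        (e.apps [a, l, (Tm.cst (.listElim i k)).apps [A, P, d, e, l]])
  | refl (i k : ℕ) (A x P d y A' x' : Tm) :
      Iota ((Tm.cst (.eqElim i k)).apps [A, x, P, d, y, (Tm.cst (.refl i)).apps [A', x']]) d
  | trIn (n i k : ℕ) (A P h f A' a : Tm) :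
      Iota ((Tm.cst (.trElim n i k)).apps [A, P, h, f, (Tm.cst (.trIn n i)).apps [A', a]])
        (f.app a)
  | quoIn (i k : ℕ) (A R P h f e A' R' a : Tm) :
      Iota ((Tm.cst (.quoElim i k)).apps [A, R, P, h, f, e,
        (Tm.cst (.quoIn i)).apps [A', R', a]]) (f.app a)

/-- Conversion: the congruence generated by `β`, `η` for functions, and the computation rules. It is
defined on raw terms, as usual for pure type systems, and applied to well-formed types only. -/
inductive Conv : Tm → Tm → Prop
  | refl (t : Tm) : Conv t t
  | symm {t u : Tm} : Conv t u → Conv u t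
  | trans {t u v : Tm} : Conv t u → Conv u v → Conv t v
  | pi {A A' B B' : Tm} : Conv A A' → Conv B B' → Conv (.pi A B) (.pi A' B')
  | lam {A A' b b' : Tm} : Conv A A' → Conv b b' → Conv (.lam A b) (.lam A' b')
  | app {f f' a a' : Tm} : Conv f f' → Conv a a' → Conv (.app f a) (.app f' a')
  | beta (A b a : Tm) : Conv (.app (.lam A b) a) (b.inst a)
  | eta (A f : Tm) : Conv (.lam A (.app (f.rename Nat.succ) (.var 0))) f
  | iota {t u : Tm} : Iota t u → Conv t u

/-- The typing judgement `Γ ⊢ t : T`. The head of the list `Γ` is the type of the innermost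
variable. A derivation that ends in the empty context only passes through well-formed contexts,
since contexts are extended in `pi` and `lam` only, by well-formed types. -/
inductive HasType : List Tm → Tm → Tm → Prop
  | var {Γ : List Tm} {n : ℕ} {A : Tm} (h : Γ[n]? = some A) :
      HasType Γ (.var n) (A.rename (· + (n + 1)))
  | univ (Γ : List Tm) (i : ℕ) : HasType Γ (.univ i) (.univ (i + 1))
  | cumul {Γ : List Tm} {A : Tm} {i : ℕ} :
      HasType Γ A (.univ i) → HasType Γ A (.univ (i + 1))
  | pi {Γ : List Tm} {A B : Tm} {i : ℕ} :
      HasType Γ A (.univ i) → HasType (A :: Γ) B (.univ i) → HasType Γ (.pi A B) (.univ i)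
  | lam {Γ : List Tm} {A B b : Tm} {i : ℕ} :
      HasType Γ A (.univ i) → HasType (A :: Γ) b B → HasType Γ (.lam A b) (.pi A B)
  | app {Γ : List Tm} {A B f a : Tm} :
      HasType Γ f (.pi A B) → HasType Γ a A → HasType Γ (.app f a) (B.inst a)
  | cst (Γ : List Tm) (k : Cst) : HasType Γ (.cst k) (k.type.build 0)
  | conv {Γ : List Tm} {t A B : Tm} {i : ℕ} :
      HasType Γ t A → Conv A B → HasType Γ B (.univ i) → HasType Γ t B

/-- A closed type `T` is a theorem of homotopy type theory if it has a closed element. -/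
def Provable (T : Exp) : Prop := ∃ t : Tm, HasType [] t (T.build 0)

/-! ### The set-based free group -/

/-- `A + A`, the elements of `A` with a sign: `inl a` stands for `a` and `inr a` for `a⁻¹`. -/
def Signed (i : ℕ) (A : Exp) : Exp := c (.sum i) A A

/-- Change of sign. -/
def Invert (i : ℕ) (A s : Exp) : Exp :=
  c (.sumElim i i) A A (Lam (Signed i A) fun _ => Signed i A)
    (Lam A fun a => c (.inr i) A A a) (Lam A fun a => c (.inl i) A A a) s

/-- Lists over `A + A`. -/
def Word (i : ℕ) (A : Exp) : Exp := c (.list i) (Signed i A)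

def WCons (i : ℕ) (A s w : Exp) : Exp := c (.cons i) (Signed i A) s w

/-- Concatenation of lists over `A + A`. -/
def Append (i : ℕ) (A v w : Exp) : Exp :=
  c (.listElim i i) (Signed i A) (Lam (Word i A) fun _ => Word i A) w
    (Lam (Signed i A) fun s => Lam (Word i A) fun _ => Lam (Word i A) fun r => WCons i A s r) v

/-- Redex removal, as a mere relation: `v ~ w` if there merely are lists `x`, `y` and an element
`s : A + A` with `v = x ++ s :: s⁻¹ :: y` and `w = x ++ y`. -/
def RedexRel (i : ℕ) (A : Exp) : Exp :=
  Lam (Word i A) fun v => Lam (Word i A) fun w =>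
    Trunc 0 i <| Sig i (Word i A) fun x => Sig i (Signed i A) fun s => Sig i (Word i A) fun y =>
      Prod i
        (Eq i (Word i A) v (Append i A x (WCons i A s (WCons i A (Invert i A s) y))))
        (Eq i (Word i A) w (Append i A x y))

/-- The set-based free group: the set-quotient of lists over `A + A` by redex removal. -/
def SetFreeGroup (i : ℕ) (A : Exp) : Exp := Quo i (Word i A) (RedexRel i A)

/-- The class of a list in the set-based free group. -/
def WordClass (i : ℕ) (A w : Exp) : Exp := c (.quoIn i) (Word i A) (RedexRel i A) w

/-- The element of `F A` represented by a list over `A + A`: the empty list goes to `unit`,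
`inl a :: w` to `cons a` and `inr a :: w` to `icons a` of the element represented by `w`. -/
def WordVal (i : ℕ) (A w : Exp) : Exp :=
  c (.listElim i i) (Signed i A) (Lam (Word i A) fun _ => Free i A) (c (.fUnit i) A)
    (Lam (Signed i A) fun s => Lam (Word i A) fun _ =>
      c (.sumElim i i) A A (Lam (Signed i A) fun _ => Free i A ⇾ Free i A)
        (c (.fCons i) A) (c (.fIcons i) A) s) w

/-- There is an equivalence between the `1`-truncation of `F A` and the set-based free group on `A`
that takes the element represented by a list to the class of that list. -/
def TruncComparison (i : ℕ) (A : Exp) : Exp :=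
  Sig i (Equiv i (Trunc 2 i (Free i A)) (SetFreeGroup i A)) fun e =>
    Pi (Word i A) fun w => Eq i (SetFreeGroup i A)
      (EquivFun i (Trunc 2 i (Free i A)) (SetFreeGroup i A) e
        (c (.trIn 2 i) (Free i A) (WordVal i A w)))
      (WordClass i A w)

/-- There is an equivalence between `F A` itself and the set-based free group on `A` that takes the
element represented by a list to the class of that list. -/
def Comparison (i : ℕ) (A : Exp) : Exp :=
  Sig i (Equiv i (Free i A) (SetFreeGroup i A)) fun e =>
    Pi (Word i A) fun w => Eq i (SetFreeGroup i A)
      (EquivFun i (Free i A) (SetFreeGroup i A) e (WordVal i A w))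
      (WordClass i A w)

end HoTT

/-! The claim is derivability in a formal system, and the proof has two layers: an argument inside
homotopy type theory, and a verified type checker that turns this argument into a derivation.

Inside the theory, let X be an algebra: a type with a point and a family of self-equivalences
indexed by a set A. A word over A + A has a value in X, and removing a redex s s⁻¹ gives a path
between values. These paths are locally confluent (`diamond`): for disjoint redexes by naturality,
for the overlap s s⁻¹ s by the half-adjoint coherence, and for two redexes at the same place because
A is a set. It follows that all reductions of a word to the empty word give the same path
(`trivialUnique`). A proof of [nil] = [w] in the set-based free group only shows that w merely
reduces to nil (`encode`); but if X is a 1-type, the uniqueness makes the data to be constructed a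
proposition, so the truncation can be removed, and a canonical path from the unit to the value of w
results (`unitPath`).

To pass from the unit to arbitrary elements, call a decoding of x at g a choice of paths from x to
the value of w, for all words w of class g, compatible with redex removal. The triples (g, x,
decoding) form an algebra again (`totalAlg`), so initiality gives a map from F A to it. Its first
component labels elements of F A by classes; by uniqueness, its second component is any prescribed
morphism F A → X (`initDecoding`). Take X to be the 1-truncation of F A, or F A itself if that is a
set. The label then gives a map on X, every element of X has a decoding at its label, and so the
label determines the element. A Hedberg argument shows that X is a set (`labelSet`), and the label
map is inverse to evaluation of words (`labelEquiv`).

For the outer layer, a type checker with definitions, fuel and an unverified elaborator is written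
in Lean, and everything it accepts is shown to be derivable (`typeOf_sound`,
`Table.Meaningful.extend`). Since only soundness is needed, neither confluence nor normalization nor
subject reduction of the formal system plays a role. The kernel evaluates the checker on the
internal proof, which is carried out at universe level 0; raising all levels of a derivation
(`HasType.shift`) gives every other level. -/

namespace HoTT

/-! ### A type checker and an elaborator for the formal theory -/

noncomputable section

/-! ### Terms over a table of constants and definitions

The functions that follow are evaluated by the kernel, which is why the frequent ones are given by
recursors. -/

/-- `if b then x else y` -/
def test {α : Type} (b : Bool) (x y : α) : α := b.rec y x

notation:10 "when " b " then " x " else " y => test b x y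

def both (b c : Bool) : Bool := b.rec false c

def either (b c : Bool) : Bool := b.rec c true

/-- The computation `f`, if its input is defined. -/
def _root_.Option.andThen {α β : Type} (o : Option α) (f : α → Option β) : Option β :=
  o.rec none f

/-- Raw terms in which closed terms are abbreviated: `ref n` stands for the entry number `n` of a
table of constants, definitions and lemmas. -/
inductive Term where
  | var (n : ℕ)
  | univ (i : ℕ)
  | pi (A B : Term)
  | lam (A b : Term)
  | app (f a : Term)
  | ref (n : ℕ)

namespace Term

/-- Add `k` to the variables from `c` on. -/
def lift (k : ℕ) (t : Term) : ℕ → Term :=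
  t.rec (fun n c => var (when Nat.ble c n then n.add k else n)) (fun i _ => univ i)
    (fun _ _ A B c => pi (A c) (B c.succ)) (fun _ _ A b c => lam (A c) (b c.succ))
    (fun _ _ f a c => app (f c) (a c)) (fun n _ => ref n)

def liftBy (k : ℕ) (t : Term) : Term := when Nat.beq k 0 then t else t.lift k 0

/-- The variable number `m` after the first `d`, under the substitution `σ`. -/
def instVar (d : ℕ) (σ : List Term) : ℕ → Term :=
  σ.rec (fun m => var (m.add d)) fun a _ ih m => m.rec (liftBy d a) fun m _ => ih m

/-- Replace the variables from `d` on by the terms `σ`. -/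
def inst (σ : List Term) (t : Term) : ℕ → Term :=
  t.rec (fun n d => when Nat.ble d n then instVar d σ (n.sub d) else var n) (fun i _ => univ i)
    (fun _ _ A B d => pi (A d) (B d.succ)) (fun _ _ A b d => lam (A d) (b d.succ))
    (fun _ _ f a d => app (f d) (a d)) (fun n _ => ref n)

def instBy (σ : List Term) (t : Term) : Term := σ.rec t fun a σ _ => inst (a :: σ) t 0

def isVar (n : ℕ) (t : Term) : Bool :=
  t.rec (fun m => Nat.beq n m) (fun _ => false) (fun _ _ _ _ => false) (fun _ _ _ _ => false)
    (fun _ _ _ _ => false) (fun _ => false)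

def isUniv (n : ℕ) (t : Term) : Bool :=
  t.rec (fun _ => false) (fun m => Nat.beq n m) (fun _ _ _ _ => false) (fun _ _ _ _ => false)
    (fun _ _ _ _ => false) (fun _ => false)

def isRef (n : ℕ) (t : Term) : Bool :=
  t.rec (fun _ => false) (fun _ => false) (fun _ _ _ _ => false) (fun _ _ _ _ => false)
    (fun _ _ _ _ => false) (fun m => Nat.beq n m)

def isPi (p q : Term → Bool) (t : Term) : Bool :=
  t.rec (fun _ => false) (fun _ => false) (fun A B _ _ => both (p A) (q B))
    (fun _ _ _ _ => false) (fun _ _ _ _ => false) (fun _ => false)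

def isLam (p q : Term → Bool) (t : Term) : Bool :=
  t.rec (fun _ => false) (fun _ => false) (fun _ _ _ _ => false)
    (fun A b _ _ => both (p A) (q b)) (fun _ _ _ _ => false) (fun _ => false)

def isApp (p q : Term → Bool) (t : Term) : Bool :=
  t.rec (fun _ => false) (fun _ => false) (fun _ _ _ _ => false) (fun _ _ _ _ => false)
    (fun f a _ _ => both (p f) (q a)) (fun _ => false)

/-- Equality of terms. -/
def beq (t : Term) : Term → Bool :=
  t.rec isVar isUniv (fun _ _ => isPi) (fun _ _ => isLam) (fun _ _ => isApp) isRef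

def apps (t : Term) (as : List Term) : Term :=
  as.rec (fun t => t) (fun a _ ih t => ih (app t a)) t

/-- Split an application into its head and its arguments. -/
def spine (t : Term) : List Term → Term × List Term :=
  t.rec (fun n as => (var n, as)) (fun i as => (univ i, as)) (fun A B _ _ as => (pi A B, as))
    (fun A b _ _ as => (lam A b, as)) (fun _ a ih _ as => ih (a :: as)) fun n as => (ref n, as)

/-- All references are below `n` and all variables below `k`. -/
def bounded (n : ℕ) (t : Term) : ℕ → Bool :=
  t.rec (fun m k => Nat.ble m.succ k) (fun _ _ => true) (fun _ _ A B k => both (A k) (B k.succ))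
    (fun _ _ A b k => both (A k) (b k.succ)) (fun _ _ f a k => both (f k) (a k))
    (fun m _ => Nat.ble m.succ n)

end Term

/-- What an entry of the table is: a constant of the theory, a definition that may be unfolded, or
a lemma. -/
inductive Kind where
  | const (c : Cst)
  | defn (v : Term)
  | lemma

/-- An entry of the table: a closed term with its type. The list `imp` says which arguments are
implicit in source terms. -/
structure Entry where
  ty : Term
  kind : Kind
  imp : List Bool

/-- A binary tree instead of a list, so that evaluation reaches an entry in logarithmically many
steps. -/
inductive Tree where
  | leaf
  | node (e : Option Entry) (l r : Tree)

namespace Tree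

/-- The entry number `n`: the entries with odd numbers are on the left. -/
def get (t : Tree) : ℕ → Option Entry :=
  t.rec (fun _ => none) fun e _ _ l r n =>
    when Nat.beq n 0 then e
    else when Nat.beq (n.mod 2) 1 then l (n.div 2) else r (n.div 2).pred

/-- Add the entry number `n`, if all smaller numbers have entries. -/
def add (e : Entry) : Tree → ℕ → Tree
  | leaf, n => when Nat.beq n 0 then node (some e) leaf leaf else leaf
  | node e' l r, n =>
    when Nat.beq n 0 then node (some e) l r
    else when Nat.beq (n.mod 2) 1 then node e' (add e l (n.div 2)) r
    else node e' l (add e r (n.div 2).pred)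

end Tree

/-- A table with `size` entries. -/
structure Table where
  tree : Tree
  size : ℕ

namespace Table

def get (E : Table) (n : ℕ) : Option Entry := E.tree.get n

def add (E : Table) (e : Entry) : Table := ⟨E.tree.add e E.size, E.size.succ⟩

end Table

def getAt {α : Type} (es : List α) : ℕ → Option α :=
  es.rec (fun _ => none) fun e _ ih n => n.rec (some e) fun n _ => ih n

/-! ### Evaluation and conversion -/

/-- The types with a computation rule. -/
inductive Rule where
  | sig (i : ℕ) | sum (i : ℕ) | one | nat | list (i : ℕ) | eq (i : ℕ) | tr (n i : ℕ) | quo (i : ℕ)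

/-- The empty type has no constructor to compute on, and the free ∞-group has no eliminator with
computation rules, only initiality up to paths. -/
def Cst.rule : Cst → Option Rule
  | sigElim i _ => some (.sig i)
  | sumElim i _ => some (.sum i)
  | oneElim _ => some .one
  | natElim _ => some .nat
  | listElim i _ => some (.list i)
  | eqElim i _ => some (.eq i)
  | trElim n i _ => some (.tr n i)
  | quoElim i _ => some (.quo i)
  | _ => none

def Cst.beq (c d : Cst) : Bool := decide (c = d)

abbrev Spine := List Term

section Iota

variable (main : Term → Option (Cst × Spine)) (self : Term)

def iotaSig (i : ℕ) : Spine → Option (Term × Spine)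
  | _ :: _ :: _ :: d :: p :: as => (main p).andThen fun q =>
    match q.2 with
    | [_, _, a, b] => when q.1.beq (.pair i) then some (d, a :: b :: as) else none
    | _ => none
  | _ => none

def iotaSum (i : ℕ) : Spine → Option (Term × Spine)
  | _ :: _ :: _ :: d :: e :: s :: as => (main s).andThen fun q =>
    match q.2 with
    | [_, _, a] =>
      when q.1.beq (.inl i) then some (d, a :: as)
      else when q.1.beq (.inr i) then some (e, a :: as) else none
    | _ => none
  | _ => none

def iotaOne : Spine → Option (Term × Spine)
  | _ :: d :: s :: as => (main s).andThen fun q =>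
    match q.2 with
    | [] => when q.1.beq .star then some (d, as) else none
    | _ => none
  | _ => none

def iotaNat : Spine → Option (Term × Spine)
  | P :: d :: e :: n :: as => (main n).andThen fun q =>
    match q.2 with
    | [] => when q.1.beq .zero then some (d, as) else none
    | [m] => when q.1.beq .succ then some (e, m :: self.apps [P, d, e, m] :: as) else none
    | _ => none
  | _ => none

def iotaList (i : ℕ) : Spine → Option (Term × Spine)
  | A :: P :: d :: e :: l :: as => (main l).andThen fun q =>
    match q.2 with
    | [_] => when q.1.beq (.nil i) then some (d, as) else none
    | [_, a, m] =>
      when q.1.beq (.cons i) then some (e, a :: m :: self.apps [A, P, d, e, m] :: as) else none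
    | _ => none
  | _ => none

def iotaEq (i : ℕ) : Spine → Option (Term × Spine)
  | _ :: _ :: _ :: d :: _ :: p :: as => (main p).andThen fun q =>
    match q.2 with
    | [_, _] => when q.1.beq (.refl i) then some (d, as) else none
    | _ => none
  | _ => none

def iotaTr (n i : ℕ) : Spine → Option (Term × Spine)
  | _ :: _ :: _ :: f :: x :: as => (main x).andThen fun q =>
    match q.2 with
    | [_, a] => when q.1.beq (.trIn n i) then some (f, a :: as) else none
    | _ => none
  | _ => none

def iotaQuo (i : ℕ) : Spine → Option (Term × Spine)
  | _ :: _ :: _ :: _ :: f :: _ :: x :: as => (main x).andThen fun q =>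
    match q.2 with
    | [_, _, a] => when q.1.beq (.quoIn i) then some (f, a :: as) else none
    | _ => none
  | _ => none

/-- The computation rules: `self` is an eliminator, and `main` evaluates its main argument to a
constant applied to arguments. -/
def iota : Rule → Spine → Option (Term × Spine)
  | .sig i => iotaSig main i
  | .sum i => iotaSum main i
  | .one => iotaOne main
  | .nat => iotaNat main self
  | .list i => iotaList main self i
  | .eq i => iotaEq main i
  | .tr n i => iotaTr main n i
  | .quo i => iotaQuo main i

end Iota

section Whnf

variable (E : Table) (ev : Bool → Term → Spine → Term × Spine)

def constAt (n : ℕ) : Option Cst :=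
  (E.get n).andThen fun e => e.kind.rec (fun c => some c) (fun _ => none) none

def defnAt (n : ℕ) : Option Term :=
  (E.get n).andThen fun e => e.kind.rec (fun _ => none) (fun v => some v) none

def ruleAt (n : ℕ) : Option Rule := (constAt E n).andThen Cst.rule

def mainOf : Term × Spine → Option (Cst × Spine)
  | (.ref n, as) => (constAt E n).andThen fun c => some (c, as)
  | _ => none

def whnfDelta (δ : Bool) (n : ℕ) (as : Spine) : Bool → Term × Spine
  | true =>
    match defnAt E n with
    | some v => ev δ v as
    | none => (.ref n, as)
  | false => (.ref n, as)

def whnfIota (δ : Bool) (n : ℕ) (as : Spine) : Option (Term × Spine) → Term × Spine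
  | some p => ev δ p.1 p.2
  | none => (.ref n, as)

/-- The main argument of an eliminator is evaluated with unfolding in any case, as its constructor
may be hidden behind a definition; the flag `δ` only governs the head. If no constructor appears,
the application is returned unevaluated. -/
def whnfRef (δ : Bool) (n : ℕ) (as : Spine) : Option Rule → Term × Spine
  | some r => whnfIota ev δ n as (iota (fun p => mainOf E (ev true p [])) (.ref n) r as)
  | none => whnfDelta E ev δ n as δ

/-- Successive β-steps are collected in `σ` and carried out by one simultaneous substitution. -/
def whnfBeta (δ : Bool) : Term → List Term → Spine → Term × Spine
  | .lam _ b, σ, a :: as => whnfBeta δ b (a :: σ) as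
  | t, σ, as => ev δ (Term.inst σ t 0) as

def whnfLam (δ : Bool) (A b : Term) : Spine → Term × Spine
  | [] => (.lam A b, [])
  | a :: as => whnfBeta ev δ b [a] as

def whnfStep (δ : Bool) (t : Term) (as : Spine) : Term × Spine :=
  t.rec (fun n => (.var n, as)) (fun i => (.univ i, as)) (fun A B _ _ => (.pi A B, as))
    (fun A b _ _ => whnfLam ev δ A b as) (fun f a _ _ => ev δ f (a :: as))
    fun n => whnfRef E ev δ n as (ruleAt E n)

/-- Weak head normal form of a term applied to arguments. Definitions in head position are unfolded
if `δ` is true. -/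
def whnf (k : ℕ) : Bool → Term → Spine → Term × Spine :=
  k.rec (fun _ t as => (t, as)) fun _ ih => whnfStep E ih

end Whnf

/-- The bound on the number of nested evaluation steps. -/
def fuel : ℕ := 1000

def unspine (p : Term × Spine) : Term := p.1.apps p.2

/-- Weak head normal form. -/
def Term.eval (E : Table) (t : Term) : Term := unspine (whnf E fuel true t [])

section Conv

variable (E : Table) (cv : Term → Term → Bool)

def allConv : Spine → Spine → Bool
  | [], [] => true
  | a :: as, b :: bs => both (cv a b) (allConv as bs)
  | _, _ => false

def convEta (t : Term) : Spine → Term → Bool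
  | [], b => cv (.app (t.lift 1 0) (.var 0)) b
  | _, _ => false

/-- Compare with an applied definition after unfolding it. -/
def convDelta (t : Term) (m : ℕ) (bs : Spine) : Bool :=
  match defnAt E m with
  | some w => cv t (w.apps bs)
  | none => false

def convBody (b b' : Term) : Spine → Bool
  | [] => cv b b'
  | _ => false

/-- The domains of two abstractions are not compared, which `Conv.lam_of_body` justifies; any other
term is compared with an abstraction by η. -/
def convLam (b : Term) (bs : Spine) (u : Term) : Bool :=
  match u with
  | .lam _ b' => convBody cv b b' bs
  | u => convEta cv (u.apps bs) [] b

def convVar (n : ℕ) (as : Spine) (u : Term) (bs : Spine) : Bool :=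
  match u with
  | .var m => both (Nat.beq n m) (allConv cv as bs)
  | .lam _ b => convEta cv ((Term.var n).apps as) bs b
  | .ref m => convDelta E cv ((Term.var n).apps as) m bs
  | _ => false

def convUniv (i : ℕ) (as : Spine) (u : Term) (bs : Spine) : Bool :=
  match u with
  | .univ j => both (Nat.beq i j) (allConv cv as bs)
  | .ref m => convDelta E cv ((Term.univ i).apps as) m bs
  | _ => false

def convPi (A B : Term) (as : Spine) (u : Term) (bs : Spine) : Bool :=
  match u with
  | .pi A' B' => both (cv A A') (both (cv B B') (allConv cv as bs))
  | .ref m => convDelta E cv ((Term.pi A B).apps as) m bs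
  | _ => false

/-- Of two different definitions the later one is unfolded: it may refer to the earlier one, but not
conversely. -/
def convUnfold (n m : ℕ) (as bs : Spine) : Option Term → Option Term → Bool
  | some v, some w =>
    when Nat.beq n m then cv (v.apps as) (w.apps bs)
    else when Nat.ble n m then cv ((Term.ref n).apps as) (w.apps bs)
    else cv (v.apps as) ((Term.ref m).apps bs)
  | some v, none => cv (v.apps as) ((Term.ref m).apps bs)
  | none, some w => cv ((Term.ref n).apps as) (w.apps bs)
  | none, none => false

def convRef (n : ℕ) (as : Spine) (u : Term) (bs : Spine) : Bool :=
  match u with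
  | .ref m =>
    -- Equal heads are first compared argument by argument; unfolding is the fallback.
    either (both (Nat.beq n m) (allConv cv as bs))
      (convUnfold cv n m as bs (defnAt E n) (defnAt E m))
  | .lam _ b => convEta cv ((Term.ref n).apps as) bs b
  | u =>
    match defnAt E n with
    | some v => cv (v.apps as) (u.apps bs)
    | none => false

/-- Conversion of terms in weak head normal form. -/
def convHead (t : Term) (as : Spine) (u : Term) (bs : Spine) : Bool :=
  match t with
  | .var n => convVar E cv n as u bs
  | .univ i => convUniv E cv i as u bs
  | .pi A B => convPi E cv A B as u bs
  | .lam A b =>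
    match as with
    | [] => convLam cv b bs u
    | _ => false
  | .app _ _ => false
  | .ref n => convRef E cv n as u bs

def convWhnf (p q : Term × Spine) : Bool := convHead E cv p.1 p.2 q.1 q.2

/-- Heads stay folded here, so that large definitions are opened only when the comparison requires
it. -/
def convStep (t u : Term) : Bool :=
  either (t.beq u) (convWhnf E cv (whnf E fuel false t []) (whnf E fuel false u []))

/-- A test for conversion. -/
def conv (k : ℕ) : Term → Term → Bool := k.rec (fun _ _ => false) fun _ ih => convStep E ih

end Conv

/-! ### The type checker -/

section Infer

variable (E : Table)

def univLevel : Term × Spine → Option ℕ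
  | (.univ i, []) => some i
  | _ => none

/-- The level of a universe. -/
def levelOf (T : Term) : Option ℕ := univLevel (whnf E fuel true T [])

def leLevel : Option ℕ → Option ℕ → Bool
  | some i, some j => Nat.ble i j
  | _, _ => false

/-- Conversion up to cumulativity. -/
def sub (T T' : Term) : Bool :=
  either (T.beq T') (either (conv E fuel T T') (leLevel (levelOf E T) (levelOf E T')))

variable (rc : List Term → Term → Option Term → Option Term)

def inferVar (Γ : List Term) (n : ℕ) : Option Term :=
  (getAt Γ n).andThen fun A => some (A.lift n.succ 0)

def inferPi (Γ : List Term) (A B : Term) : Option Term :=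
  (rc Γ A none).andThen fun T => (levelOf E T).andThen fun i =>
    (rc (A :: Γ) B none).andThen fun T' => (levelOf E T').andThen fun j =>
      some (.univ (when Nat.ble i j then j else i))

def inferLam (Γ : List Term) (A b : Term) : Option Term :=
  (rc Γ A none).andThen fun T => (levelOf E T).andThen fun _ =>
    (rc (A :: Γ) b none).andThen fun B => some (.pi A B)

/-- The type of the application of a function of type `T` to an argument `a` and to further arguments,
which `k` takes care of. -/
def inferArg (Γ : List Term) (a : Term) (k : List Term → Term → Option Term) (T : Term) : Option Term :=
  -- The evaluated type is checked anew. It is only known to be convertible to `T`, and this check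
  -- replaces an appeal to subject reduction.
  (rc Γ (T.eval E) none).andThen fun _ =>
    match T.eval E with
    | .pi A B => (rc Γ a (some A)).andThen fun _ => k [a] B
    | _ => none

/-- The type of the application of a function to arguments, where `σ` are the previous arguments. -/
def inferArgs (Γ : List Term) (as : Spine) : List Term → Term → Option Term :=
  as.rec (fun σ T => some (Term.instBy σ T)) fun a _ ih σ T =>
    T.rec (fun n => inferArg E rc Γ a ih (Term.instBy σ (.var n)))
      (fun i => inferArg E rc Γ a ih (Term.instBy σ (.univ i)))
      -- For a visible function type, the argument only joins `σ`; the substitution into `B` is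
      -- postponed until a domain or the result is needed.
      (fun A B _ _ => (rc Γ a (some (Term.instBy σ A))).andThen fun _ => ih (a :: σ) B)
      (fun A b _ _ => inferArg E rc Γ a ih (Term.instBy σ (.lam A b)))
      (fun f x _ _ => inferArg E rc Γ a ih (Term.instBy σ (.app f x)))
      fun n => inferArg E rc Γ a ih (Term.instBy σ (.ref n))

def inferApp (Γ : List Term) (p : Term × Spine) : Option Term :=
  (rc Γ p.1 none).andThen fun T => inferArgs E rc Γ p.2 [] T

def inferStep (Γ : List Term) (t : Term) : Option Term :=
  t.rec (fun n => inferVar Γ n) (fun i => some (.univ i.succ)) (fun A B _ _ => inferPi E rc Γ A B)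
    (fun A b _ _ => inferLam E rc Γ A b) (fun f a _ _ => inferApp E rc Γ (f.spine [a]))
    fun n => (E.get n).andThen fun e => some e.ty

def checkConv (Γ : List Term) (t T : Term) : Option Term :=
  (rc Γ t none).andThen fun T' => when sub E T' T then some T else none

/-- The shortcut by syntactic equality of domains usually applies, because the elaborator copies the
domain of an unannotated abstraction from the expected type. -/
def checkLam (Γ : List Term) (A b T : Term) : Option Term :=
  match T with
  | .pi A' B =>
    when A.beq A' then (rc (A :: Γ) b (some B)).andThen fun _ => some (.pi A' B)
    else checkConv E rc Γ (.lam A b) (.pi A' B)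
  | T => checkConv E rc Γ (.lam A b) T

def checkStep (Γ : List Term) (t T : Term) : Option Term :=
  t.rec (fun n => checkConv E rc Γ (.var n) T) (fun i => checkConv E rc Γ (.univ i) T)
    (fun A B _ _ => checkConv E rc Γ (.pi A B) T) (fun A b _ _ => checkLam E rc Γ A b T)
    (fun f a _ _ => checkConv E rc Γ (.app f a) T) fun n => checkConv E rc Γ (.ref n) T

def typeStep (Γ : List Term) (t : Term) (T : Option Term) : Option Term :=
  T.rec (inferStep E rc Γ t) fun T => checkStep E rc Γ t T

/-- Both modes of the type checker: the type of `t`, or whether `t` has the given type. In the second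
mode the result is that type. -/
def typeOf (k : ℕ) : List Term → Term → Option Term → Option Term :=
  k.rec (fun _ _ _ => none) fun _ ih => typeStep E ih

end Infer

/-! ### Source terms and elaboration -/

/-- Source terms: terms with implicit arguments and unannotated abstractions; `full n` is `ref n` with
all arguments explicit. -/
inductive Raw where
  | var (n : ℕ)
  | univ (i : ℕ)
  | pi (A B : Raw)
  | lam (A b : Raw)
  | fn (b : Raw)
  | app (f a : Raw)
  | ref (n : ℕ)
  | full (n : ℕ)
  | hole

namespace Elaboration

/-- Values of the parameters of a telescope, as far as they are known. -/
abbrev Asg := List (Option Term)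

def lookup (σ : Asg) (n : ℕ) : Option Term := (getAt σ n).andThen fun v => v

def assign (v : Term) (σ : Asg) : ℕ → Asg :=
  σ.rec (fun _ => []) fun x xs ih n => n.rec (some v :: xs) fun n _ => x :: ih n

/-- Assign a value that is found by matching, if there is none yet. -/
def assignNew (σ : Asg) (n : ℕ) (v : Option Term) : Asg :=
  (lookup σ n).rec (v.rec σ fun v => assign v σ n) fun _ => σ

def map₂ (f : Term → Term → Term) (a b : Option Term) : Option Term :=
  a.andThen fun a => b.andThen fun b => some (f a b)

def closeVar (σ : Asg) (j n d : ℕ) : Option Term :=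
  when Nat.ble d n then
    when Nat.ble (d.add j) n then some (.var (n.sub j))
    -- De Bruijn indices count parameters from the innermost one, the list `σ` from the outermost
    -- one.
    else (lookup σ ((j.sub 1).sub (n.sub d))).andThen fun v => some (v.liftBy d)
  else some (.var n)

/-- Instantiate the `j` parameters below `d` local variables. -/
def close (σ : Asg) (j : ℕ) (t : Term) : ℕ → Option Term :=
  t.rec (fun n d => closeVar σ j n d) (fun i _ => some (.univ i))
    (fun _ _ A B d => map₂ .pi (A d) (B d.succ)) (fun _ _ A b d => map₂ .lam (A d) (b d.succ))
    (fun _ _ f a d => map₂ .app (f d) (a d)) fun n _ => some (.ref n)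

def lowerVar (d n c : ℕ) : Option Term :=
  when Nat.ble c n then when Nat.ble (c.add d) n then some (.var (n.sub d)) else none
  else some (.var n)

/-- Remove `d` unused local variables. -/
def lower (d : ℕ) : Term → ℕ → Option Term
  | .var n, c => lowerVar d n c
  | .univ i, _ => some (.univ i)
  | .pi A B, c => map₂ .pi (lower d A c) (lower d B c.succ)
  | .lam A B, c => map₂ .lam (lower d A c) (lower d B c.succ)
  | .app A B, c => map₂ .app (lower d A c) (lower d B c)
  | .ref n, _ => some (.ref n)

def lowerBy (d : ℕ) (t : Term) : Option Term := when Nat.beq d 0 then some t else lower d t 0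

section Match

variable (E : Table) (j : ℕ) (mt : List Term → Term → Term → Asg → Asg) (Δ : List Term)

def matchArgs (as : Spine) : Spine → Asg → Asg :=
  as.rec (fun _ σ => σ) fun a _ ih bs σ => bs.rec σ fun b bs _ => ih bs (mt Δ a b σ)

def matchVar (d n : ℕ) (t : Term) (σ : Asg) : Asg :=
  when Nat.ble d n && Nat.ble n.succ (d.add j) then
    assignNew σ ((j.sub 1).sub (n.sub d)) (lowerBy d t)
  else σ

def matchPi (A B t : Term) (σ : Asg) : Asg :=
  t.rec (fun _ => σ) (fun _ => σ) (fun A' B' _ _ => mt (A' :: Δ) B B' (mt Δ A A' σ))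
    (fun _ _ _ _ => σ) (fun _ _ _ _ => σ) fun _ => σ

def matchLam (A B t : Term) (σ : Asg) : Asg :=
  t.rec (fun _ => σ) (fun _ => σ) (fun _ _ _ _ => σ)
    (fun A' B' _ _ => mt (A' :: Δ) B B' (mt Δ A A' σ)) (fun _ _ _ _ => σ) fun _ => σ

/-- Unfold definitions in head position until the head is `ref n`. -/
def headTo (n : ℕ) : ℕ → Term × Spine → Option Spine
  | 0, _ => none
  | k + 1, p =>
    match p.1 with
    | .ref m =>
      when Nat.beq m n then some p.2
      else (defnAt E m).andThen fun v => headTo n k (whnf E fuel false v p.2)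
    | _ => none

def matchSpine (as : Spine) (σ : Asg) (bs : Option Spine) : Asg :=
  bs.rec σ fun bs => matchArgs mt Δ as bs σ

def matchRef (n : ℕ) (as : Spine) (t : Term) (σ : Asg) (p : Term × Spine) : Asg :=
  when p.1.isRef n then matchArgs mt Δ as p.2 σ
  else matchSpine mt Δ as σ (headTo E n fuel (whnf E fuel false t []))

/-- The parameter `n` applied to the only local variable. -/
def matchFlex (n : ℕ) (t : Term) (σ : Asg) : List Term → Asg
  | [A] =>
    -- Index 0 is the local variable, so the parameter with index `n` has position (j - 1) - (n - 1)
    -- = j - n.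
    when Nat.ble 1 n && Nat.ble n j then
      assignNew σ (j.sub n) (some (.lam A t))
    else σ
  | _ => σ

def matchRigid (n : ℕ) (as : Spine) (σ : Asg) (p : Term × Spine) : Asg :=
  match p.1 with
  | .var m =>
    -- In the pattern, the `j` parameters lie between the local variables and the context, so
    -- context variables are shifted by `j`.
    when Nat.beq n (when Nat.ble Δ.length m then m.add j else m) then matchArgs mt Δ as p.2 σ else σ
  | _ => σ

def matchVarApp (n : ℕ) (t : Term) (σ : Asg) (as : Spine) : Asg :=
  match as with
  | [a] => when a.isVar 0 then matchFlex j n t σ Δ else matchRigid j mt Δ n as σ (t.spine [])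
  | as => matchRigid j mt Δ n as σ (t.spine [])

def matchApp (t : Term) (σ : Asg) (p : Term × Spine) : Asg :=
  p.1.rec (fun n => matchVarApp j mt Δ n t σ p.2) (fun _ => σ) (fun _ _ _ _ => σ) (fun _ _ _ _ => σ)
    (fun _ _ _ _ => σ) fun n => matchRef E mt Δ n p.2 t σ (t.spine [])

def matchStep (P t : Term) (σ : Asg) : Asg :=
  P.rec (fun n => matchVar j Δ.length n t σ) (fun _ => σ)
    (fun A B _ _ => matchPi mt Δ A B (t.eval E) σ) (fun A B _ _ => matchLam mt Δ A B t σ)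
    (fun f a _ _ => matchApp E j mt Δ t σ (f.spine [a])) fun _ => σ

/-- First-order matching of a type `P` over `j` parameters against a term; `Δ` are the types of the
local variables. -/
def matchTerm (k : ℕ) : List Term → Term → Term → Asg → Asg :=
  k.rec (fun _ _ _ σ => σ) fun _ ih => matchStep E j ih

end Match

/-- Insert holes for the implicit arguments. -/
def insertHoles (bs : List Bool) : List Raw → List Raw :=
  bs.rec (fun as => as) fun b _ ih as =>
    when b then .hole :: ih as else as.rec [] fun a as _ => a :: ih as

def unapp (t : Raw) : List Raw → Raw × List Raw :=
  t.rec (fun n as => (.var n, as)) (fun i as => (.univ i, as)) (fun A B _ _ as => (.pi A B, as))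
    (fun A b _ _ as => (.lam A b, as)) (fun b _ as => (.fn b, as)) (fun _ a ih _ as => ih (a :: as))
    (fun n as => (.ref n, as)) (fun n as => (.full n, as)) fun as => (.hole, as)

structure Tele where
  params : List (Term × Raw)
  rest : List Raw
  result : Term

def Tele.cons (A : Term) (a : Raw) (t : Tele) : Tele := ⟨(A, a) :: t.params, t.rest, t.result⟩

/-- Split off the part of a telescope for which there are arguments. -/
def telescope (T : Term) : List Raw → Tele :=
  T.rec (fun n as => ⟨[], as, .var n⟩) (fun i as => ⟨[], as, .univ i⟩)
    (fun A B _ ih as => as.rec ⟨[], [], .pi A B⟩ fun a as _ => .cons A a (ih as))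
    (fun A b _ _ as => ⟨[], as, .lam A b⟩) (fun f a _ _ as => ⟨[], as, .app f a⟩)
    fun n as => ⟨[], as, .ref n⟩

def blank (l : List (Term × Raw)) : Asg := l.rec [] fun _ _ ih => none :: ih

/-- A parameter that is still unknown becomes `univ 0`. This is harmless, as every elaborated term
is type checked afterwards. -/
def fill (t : Term) (σ : Asg) : Term :=
  σ.rec (fun t => t) (fun a _ ih t => ih (.app t (a.rec (.univ 0) fun a => a))) t

def isHole (a : Raw) : Bool :=
  a.rec (fun _ => false) (fun _ => false) (fun _ _ _ _ => false) (fun _ _ _ _ => false)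
    (fun _ _ => false) (fun _ _ _ _ => false) (fun _ => false) (fun _ => false) true

def isFn (a : Raw) : Bool :=
  a.rec (fun _ => false) (fun _ => false) (fun _ _ _ _ => false) (fun _ _ _ _ => false)
    (fun _ _ => true) (fun _ _ _ _ => false) (fun _ => false) (fun _ => false) false

section Elaborate

variable (E : Table) (el : Raw → Option Term → Term × Term)

def argInfer (j : ℕ) (P : Term) (σ : Asg) (p : Term × Term) : Asg :=
  matchTerm E j fuel [] P p.2 (assign p.1 σ j)

def argFirst (j : ℕ) (P : Term) (a : Raw) (σ : Asg) : Asg :=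
  when isFn a then σ else argInfer E j P σ (el a none)

def argStep (first : Bool) (j : ℕ) (P : Term) (a : Raw) (σ : Asg) (X : Option Term) : Asg :=
  X.rec (when first then argFirst E el j P a σ else argInfer E j P σ (el a none)) fun T =>
    assign (el a (some T)).1 σ j

def argNew (first : Bool) (j : ℕ) (P : Term) (a : Raw) (σ : Asg) (v : Option Term) : Asg :=
  v.rec (argStep E el first j P a σ (close σ j P 0)) fun _ => σ

def arg (first : Bool) (j : ℕ) (P : Term) (a : Raw) (σ : Asg) : Asg :=
  when isHole a then σ else argNew E el first j P a σ (lookup σ j)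

/-- Elaborate the arguments of a telescope, from the one numbered `j`. In the first pass, an argument
whose expected type is not known yet is inferred, or skipped if it is an abstraction. -/
def args (first : Bool) (l : List (Term × Raw)) : ℕ → Asg → Asg :=
  l.rec (fun _ σ => σ) fun p _ ih j σ => ih j.succ (arg E el first j p.1 p.2 σ)

def resultAsg (l : List (Term × Raw)) (R : Term) : List Raw → Option Term → Asg
  | [], some X => matchTerm E l.length fuel [] R X (blank l)
  | _, _ => blank l

def evalPi (T : Term) : Term :=
  T.rec (fun n => (Term.var n).eval E) (fun i => (Term.univ i).eval E) (fun A B _ _ => .pi A B)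
    (fun A b _ _ => (Term.lam A b).eval E) (fun f a _ _ => (Term.app f a).eval E)
    fun n => (Term.ref n).eval E

def applyDone (ap : Term → Term → List Raw → Term × Term) (h : Term) (t : Tele) (σ : Asg) :
    Term × Term :=
  (close σ t.params.length t.result 0).rec (fill h σ, .univ 0) fun R => ap (fill h σ) R t.rest

def applyTele (X : Option Term) (ap : Term → Term → List Raw → Term × Term) (h : Term) (t : Tele) :
    Term × Term :=
  applyDone ap h t
    (args E el false t.params 0
      (args E el true t.params 0 (resultAsg E t.params t.result t.rest X)))

def applyStep (X : Option Term) (ap : Term → Term → List Raw → Term × Term) (h T : Term)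
    (as : List Raw) : Term × Term :=
  as.rec (h, T) fun a as _ => applyTele E el X ap h (telescope (evalPi E T) (a :: as))

/-- Elaborate the application of `h : T` to arguments. -/
def apply (X : Option Term) (k : ℕ) : Term → Term → List Raw → Term × Term :=
  k.rec (fun h T _ => (h, T)) fun _ ih => applyStep E el X ih

end Elaborate

section Elaborate

variable (E : Table) (rc : List Term → Raw → Option Term → Term × Term) (Γ : List Term)
  (X : Option Term)

def failed : Term × Term := (.univ 0, .univ 0)

def elabPi (A : Term) (B : Raw) : Term × Term := (.pi A (rc (A :: Γ) B none).1, .univ 0)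

def codomain (X : Option Term) : Option Term :=
  X.andThen fun T =>
    match T with
    | .pi _ B => some B
    | _ => none

def elabLamBody (A : Term) (p : Term × Term) : Term × Term := (.lam A p.1, .pi A p.2)

def elabLam (A : Term) (b : Raw) : Term × Term :=
  elabLamBody A (rc (A :: Γ) b (codomain X))

def elabFn (b : Raw) (T : Term) : Term × Term :=
  match T with
  | .pi A B => (.lam A (rc (A :: Γ) b (some B)).1, T)
  | _ => failed

def elabRef (n : ℕ) (as : Entry → List Raw) : Term × Term :=
  (E.get n).rec failed fun e => apply E (rc Γ) X fuel (.ref n) e.ty (as e)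

def elabVar (n : ℕ) (as : List Raw) : Term × Term :=
  (getAt Γ n).rec failed fun A => apply E (rc Γ) X fuel (.var n) (A.lift n.succ 0) as

def elabApp (as : List Raw) (p : Term × Term) : Term × Term := apply E (rc Γ) X fuel p.1 p.2 as

def elabHead (p : Raw × List Raw) : Term × Term :=
  match p.1 with
  | .ref n => elabRef E rc Γ X n fun e => insertHoles e.imp p.2
  | .full n => elabRef E rc Γ X n fun _ => p.2
  | .var n => elabVar E rc Γ X n p.2
  | h => elabApp E rc Γ X p.2 (rc Γ h none)

def elabStep (s : Raw) : Term × Term :=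
  s.rec (fun n => elabVar E rc Γ X n []) (fun i => (.univ i, .univ i.succ))
    (fun A B _ _ => elabPi rc Γ (rc Γ A none).1 B) (fun A b _ _ => elabLam rc Γ X (rc Γ A none).1 b)
    (fun b _ => X.rec failed fun T => elabFn rc Γ b (evalPi E T))
    (fun f a _ _ => elabHead E rc Γ X (unapp f [a]))
    (fun n => elabRef E rc Γ X n fun e => insertHoles e.imp [])
    (fun n => elabRef E rc Γ X n fun _ => []) failed

/-- Elaboration of a source term to a term and its type, given the expected type if it is known. The
result is not guaranteed to be well-typed. -/
def elaborate (k : ℕ) : List Term → Raw → Option Term → Term × Term :=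
  k.rec (fun _ _ _ => failed) fun _ ih Γ s X => elabStep E ih Γ X s

end Elaborate

end Elaboration

/-! ### Declarations -/

/-- A source term that can be placed under any number of binders. -/
structure Src where
  build : ℕ → Raw

/-- A declaration: a statement, a proof, whether the proof may be unfolded, and the implicit
arguments. -/
structure Decl where
  ty : Src
  val : Src
  unfold : Bool
  imp : List Bool

section Decl

variable (E : Table) (d : Decl)

def Decl.type : Term := (Elaboration.elaborate E fuel [] (d.ty.build 0) none).1

def Decl.value : Term := (Elaboration.elaborate E fuel [] (d.val.build 0) (some (d.type E))).1

def Decl.entry : Entry := ⟨d.type E, when d.unfold then .defn (d.value E) else .lemma, d.imp⟩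

def isType (T : Term) : Bool :=
  ((typeOf E fuel [] T none).andThen (levelOf E)).isSome && T.bounded E.size 0

def hasType (t T : Term) : Bool := (typeOf E fuel [] t (some T)).isSome

/-- Whether the declaration is well-typed. -/
def Decl.check : Bool :=
  isType E (d.type E) && (hasType E (d.value E) (d.type E) &&
    -- The value of a lemma never enters the table, so only unfoldable values have to be bounded.
    (when d.unfold then (d.value E).bounded E.size 0 else true))

end Decl

end

end HoTT

/-! ### The table of constants and a notation for internal proofs -/

namespace HoTT

noncomputable section

/-! ### The table of constants -/

/-- The constants that are used, at the levels at which they are used. -/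
def constants : List Cst :=
  [.sig 0, .pair 0, .sigElim 0 0, .sum 0, .inl 0, .inr 0, .sumElim 0 0, .sumElim 0 1,
    .empty, .emptyElim 0, .one, .star, .nat, .zero, .succ, .natElim 0, .natElim 1,
    .list 0, .nil 0, .cons 0, .listElim 0 0, .listElim 0 1,
    .eq 0, .refl 0, .eqElim 0 0, .eqElim 0 1, .funext 0,
    .tr 0 0, .trIn 0 0, .trLevel 0 0, .trElim 0 0 0,
    .tr 2 0, .trIn 2 0, .trLevel 2 0, .trElim 2 0 0,
    .quo 0, .quoIn 0, .quoEq 0, .quoSet 0, .quoElim 0 0,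
    .free 0, .fUnit 0, .fCons 0, .fIcons 0, .fMu1 0, .fMu2 0, .fMu 0, .fInit 0 0,
    .sig 1, .pair 1, .sigElim 1 1, .eq 1, .refl 1, .eqElim 1 0, .eqElim 1 1, .ua 0, .quoElim 0 1]

/-- A constant outside the list gets the index `constants.length`, which is rejected by the bounds
in `isType` while the constants are being added, and by `checkElem` later. -/
def constIndex (c : Cst) : ℕ := constants.idxOf c

/-- Which arguments of a constant are implicit in source terms. -/
def Cst.implicits : Cst → List Bool
  | .pair _ | .sigElim _ _ | .inl _ | .inr _ | .sumElim _ _ | .quoIn _ | .quoEq _ | .quoElim _ _ =>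
    [true, true]
  | .nil _ | .cons _ | .listElim _ _ | .eq _ | .refl _ | .trIn _ _ | .trElim _ _ _ => [true]
  | .eqElim _ _ => [true, true, false, false, true, false]
  | .funext _ => [true, true, true, true]
  | .fUnit _ | .fCons _ | .fIcons _ | .fMu1 _ | .fMu2 _ | .fMu _ => [true]
  | _ => []

def Tm.toTerm : Tm → Term
  | .var n => .var n
  | .univ i => .univ i
  | .pi A B => .pi A.toTerm B.toTerm
  | .lam A b => .lam A.toTerm b.toTerm
  | .app f a => .app f.toTerm a.toTerm
  | .cst c => .ref (constIndex c)

def Cst.entry (c : Cst) : Entry := ⟨(c.type.build 0).toTerm, .const c, c.implicits⟩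

def checkConsts : Table → List Cst → Bool
  | _, [] => true
  | E, c :: cs => isType E c.entry.ty && checkConsts (E.add c.entry) cs

def checkDecls : Table → List Decl → Bool
  | _, [] => true
  | E, d :: ds => d.check E && checkDecls (E.add (d.entry E)) ds

/-- The entry number `n` is an element of the type `T`. -/
def checkElem (E : Table) (n : ℕ) (T : Exp) : Bool :=
  -- Without this bound, an unlisted constant in `T` would be read as the first declaration.
  (T.build 0).toTerm.bounded constants.length 0 &&
    (isType E (T.build 0).toTerm && hasType E (.ref n) (T.build 0).toTerm)

def addConsts : Table → List Cst → Table
  | E, [] => E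
  | E, c :: cs => addConsts (E.add c.entry) cs

def extend : Table → List Decl → Table
  | E, [] => E
  | E, d :: ds => extend (E.add (d.entry E)) ds

def constTable : Table := addConsts ⟨.leaf, 0⟩ constants

/-! ### Notation for source terms -/

namespace Src

/-- Application is written as juxtaposition. -/
instance : CoeFun Src (fun _ => Src → Src) := ⟨fun f a => ⟨fun n => .app (f.build n) (a.build n)⟩⟩

def U (i : ℕ) : Src := ⟨fun _ => .univ i⟩

/-- A constant, with implicit arguments. -/
def c (k : Cst) : Src := ⟨fun _ => .ref (constIndex k)⟩

/-- The declaration number `n`, with implicit arguments. -/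
def entry (n : ℕ) : Src := ⟨fun _ => .ref (n.add constants.length)⟩

/-- The number of an entry in the table. -/
def index (s : Src) : ℕ :=
  match s.build 0 with
  | .ref n => n
  | _ => 0

/-- The variable bound by the binder number `n`, counted from the outside. -/
def bound (n : ℕ) : Src := ⟨fun m => .var (m.sub n).pred⟩

def Pi (A : Src) (B : Src → Src) : Src :=
  ⟨fun n => .pi (A.build n) ((B (bound n)).build n.succ)⟩

/-- An abstraction without type annotation. -/
def fn (b : Src → Src) : Src := ⟨fun n => .fn ((b (bound n)).build n.succ)⟩

def fn2 (b : Src → Src → Src) : Src := fn fun x => fn fun y => b x y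

def fn3 (b : Src → Src → Src → Src) : Src := fn fun x => fn2 fun y z => b x y z

def fn4 (b : Src → Src → Src → Src → Src) : Src := fn fun x => fn3 fun y z w => b x y z w

def arr (A B : Src) : Src := Pi A fun _ => B

infixr:25 " ⇒ " => arr

/-- The declaration of an element `t : T` that is not unfolded. -/
def thm (T t : Src) : Decl := ⟨T, t, false, []⟩

/-- The declaration of an element `t : T` that may be unfolded. -/
def defn (T t : Src) : Decl := ⟨T, t, true, []⟩

def param (i : Bool) (A : Src) (d : Src → Decl) : Decl where
  ty := Pi A fun x => (d x).ty
  val := fn fun x => (d x).val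
  -- `A` is a dummy argument: the flag and the list of implicit arguments do not depend on the
  -- parameter.
  unfold := (d A).unfold
  imp := i :: (d A).imp

/-- A declaration with a parameter. -/
def all (A : Src) (d : Src → Decl) : Decl := param false A d

/-- A declaration with an implicit parameter. -/
def given (A : Src) (d : Src → Decl) : Decl := param true A d

end Src

end

end HoTT

/-! ### Metatheory: substitution, conversion and typing -/

namespace HoTT

namespace Tm

/-! ### Renaming and substitution -/

theorem liftRen_comp (f g : ℕ → ℕ) : liftRen f ∘ liftRen g = liftRen (f ∘ g) := by
  funext n; cases n <;> rfl

theorem rename_rename (t : Tm) : ∀ f g : ℕ → ℕ, rename f (rename g t) = rename (f ∘ g) t := by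
  induction t with
  | var n => intros; rfl
  | univ i => intros; rfl
  | pi A B hA hB => intro f g; simp only [rename, hA, hB, liftRen_comp]
  | lam A B hA hB => intro f g; simp only [rename, hA, hB, liftRen_comp]
  | app A B hA hB => intro f g; simp only [rename, hA, hB]
  | cst k => intros; rfl

theorem liftSub_comp_liftRen (σ : ℕ → Tm) (f : ℕ → ℕ) : liftSub σ ∘ liftRen f = liftSub (σ ∘ f) := by
  funext n; cases n <;> rfl

theorem subst_rename (t : Tm) : ∀ (σ : ℕ → Tm) (f : ℕ → ℕ), subst σ (rename f t) = subst (σ ∘ f) t := by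
  induction t with
  | var n => intros; rfl
  | univ i => intros; rfl
  | pi A B hA hB => intro σ f; simp only [rename, subst, hA, hB, liftSub_comp_liftRen]
  | lam A B hA hB => intro σ f; simp only [rename, subst, hA, hB, liftSub_comp_liftRen]
  | app A B hA hB => intro σ f; simp only [rename, subst, hA, hB]
  | cst k => intros; rfl

theorem rename_liftSub (f : ℕ → ℕ) (σ : ℕ → Tm) :
    rename (liftRen f) ∘ liftSub σ = liftSub (rename f ∘ σ) := by
  funext n
  cases n with
  | zero => rfl
  | succ n => simp only [Function.comp, liftSub, rename_rename]; rfl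

theorem rename_subst (t : Tm) : ∀ (f : ℕ → ℕ) (σ : ℕ → Tm),
    rename f (subst σ t) = subst (rename f ∘ σ) t := by
  induction t with
  | var n => intros; rfl
  | univ i => intros; rfl
  | pi A B hA hB => intro f σ; simp only [rename, subst, hA, hB, rename_liftSub]
  | lam A B hA hB => intro f σ; simp only [rename, subst, hA, hB, rename_liftSub]
  | app A B hA hB => intro f σ; simp only [rename, subst, hA, hB]
  | cst k => intros; rfl

theorem subst_liftSub (τ σ : ℕ → Tm) : subst (liftSub τ) ∘ liftSub σ = liftSub (subst τ ∘ σ) := by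
  funext n
  cases n with
  | zero => rfl
  | succ n => simp only [Function.comp, liftSub, subst_rename, rename_subst]; rfl

theorem subst_subst (t : Tm) : ∀ τ σ : ℕ → Tm, subst τ (subst σ t) = subst (subst τ ∘ σ) t := by
  induction t with
  | var n => intros; rfl
  | univ i => intros; rfl
  | pi A B hA hB => intro τ σ; simp only [subst, hA, hB, subst_liftSub]
  | lam A B hA hB => intro τ σ; simp only [subst, hA, hB, subst_liftSub]
  | app A B hA hB => intro τ σ; simp only [subst, hA, hB]
  | cst k => intros; rfl

theorem liftSub_var_comp (f : ℕ → ℕ) : liftSub (var ∘ f) = var ∘ liftRen f := by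
  funext n; cases n <;> rfl

theorem rename_eq_subst (t : Tm) : ∀ f : ℕ → ℕ, rename f t = subst (var ∘ f) t := by
  induction t with
  | var n => intros; rfl
  | univ i => intros; rfl
  | pi A B hA hB => intro f; simp only [rename, subst, hA, hB, liftSub_var_comp]
  | lam A B hA hB => intro f; simp only [rename, subst, hA, hB, liftSub_var_comp]
  | app A B hA hB => intro f; simp only [rename, subst, hA, hB]
  | cst k => intros; rfl

theorem subst_var (t : Tm) : subst var t = t := by
  have h : liftSub var = var := by funext n; cases n <;> rfl
  induction t with
  | var n => rfl
  | univ i => rfl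
  | pi A B hA hB => simp only [subst, h, hA, hB]
  | lam A B hA hB => simp only [subst, h, hA, hB]
  | app A B hA hB => simp only [subst, hA, hB]
  | cst k => rfl

theorem subst_inst (σ : ℕ → Tm) (b a : Tm) :
    subst σ (b.inst a) = (subst (liftSub σ) b).inst (subst σ a) := by
  simp only [inst, subst_subst]
  congr 1
  funext n
  cases n with
  | zero => rfl
  | succ n =>
    simp only [Function.comp, single, liftSub, subst, subst_rename]
    exact (subst_var _).symm

theorem inst_rename_succ (t a : Tm) : (rename Nat.succ t).inst a = t := by
  rw [inst, subst_rename]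
  exact subst_var t

theorem inst_liftRen_succ (b : Tm) : (rename (liftRen Nat.succ) b).inst (var 0) = b := by
  rw [inst, subst_rename]
  conv_rhs => rw [← subst_var b]
  congr 1
  funext n
  cases n <;> rfl

theorem apps_append (f : Tm) (as bs : List Tm) : f.apps (as ++ bs) = (f.apps as).apps bs :=
  List.foldl_append ..

theorem subst_apps (σ : ℕ → Tm) (as : List Tm) :
    ∀ f : Tm, subst σ (f.apps as) = (subst σ f).apps (as.map (subst σ)) := by
  induction as with
  | nil => intro f; rfl
  | cons a as ih => intro f; exact ih (f.app a)

/-- Terms without free variables. -/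
def Closed (t : Tm) : Prop := ∀ σ : ℕ → Tm, subst σ t = t

theorem Closed.rename {t : Tm} (h : t.Closed) (f : ℕ → ℕ) : t.rename f = t := by
  rw [rename_eq_subst, h]

end Tm

open Tm

/-! ### Conversion -/

theorem Iota.subst (σ : ℕ → Tm) {t u : Tm} (h : Iota t u) : Iota (t.subst σ) (u.subst σ) := by
  cases h <;> simp only [subst_apps, List.map, Tm.subst]
  · exact .sig ..
  · exact .inl ..
  · exact .inr ..
  · exact .star ..
  · exact .zero ..
  · exact .succ ..
  · exact .nil ..
  · exact .cons ..
  · exact .refl ..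
  · exact .trIn ..
  · exact .quoIn ..

theorem Conv.subst {t u : Tm} (h : Conv t u) : ∀ σ : ℕ → Tm, Conv (t.subst σ) (u.subst σ) := by
  induction h with
  | refl t => exact fun σ => .refl _
  | symm _ ih => exact fun σ => (ih σ).symm
  | trans _ _ ih ih' => exact fun σ => (ih σ).trans (ih' σ)
  | pi _ _ ih ih' => exact fun σ => .pi (ih σ) (ih' _)
  | lam _ _ ih ih' => exact fun σ => .lam (ih σ) (ih' _)
  | app _ _ ih ih' => exact fun σ => .app (ih σ) (ih' σ)
  | beta A b a => intro σ; rw [subst_inst]; exact .beta ..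
  | eta A f =>
    intro σ
    have : (f.rename Nat.succ).subst (liftSub σ) = (f.subst σ).rename Nat.succ := by
      rw [subst_rename, rename_subst]; rfl
    simp only [Tm.subst, this]
    exact .eta ..
  | iota h => exact fun σ => .iota (h.subst σ)

theorem Conv.apps {as bs : List Tm} (h : List.Forall₂ Conv as bs) :
    ∀ {t u : Tm}, Conv t u → Conv (t.apps as) (u.apps bs) := by
  induction h with
  | nil => exact fun h => h
  | cons h _ ih => exact fun h' => ih (.app h' h)

theorem Conv.apps_left {t u : Tm} (h : Conv t u) (as : List Tm) : Conv (t.apps as) (u.apps as) :=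
  .apps (List.forall₂_same.2 fun a _ => .refl a) h

/-- The domains of abstractions are irrelevant. -/
theorem Conv.lam_of_body (A A' : Tm) {b b' : Tm} (h : Conv b b') : Conv (.lam A b) (.lam A' b') := by
  -- η is available with any domain: expand with domain `A'`, then contract the inner β-redex.
  refine (Conv.eta A' (.lam A b)).symm.trans (.lam (.refl A') (.trans ?_ h))
  have := Conv.beta (A.rename Nat.succ) (b.rename (liftRen Nat.succ)) (.var 0)
  rwa [inst_liftRen_succ] at this

theorem Conv.lam_of_app (A : Tm) {t b : Tm} (h : Conv (.app (t.rename Nat.succ) (.var 0)) b) :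
    Conv t (.lam A b) :=
  (Conv.eta A t).symm.trans (.lam (.refl A) h)

/-! ### The types of the constants are closed -/

/-- The substitution `σ` below `n` binders. -/
def liftN (σ : ℕ → Tm) : ℕ → ℕ → Tm
  | 0 => σ
  | n + 1 => liftSub (liftN σ n)

theorem liftN_lt (σ : ℕ → Tm) : ∀ {n m : ℕ}, m < n → liftN σ n m = .var m
  | n + 1, 0, _ => rfl
  | n + 1, m + 1, h => by rw [liftN, liftSub, liftN_lt σ (Nat.lt_of_succ_lt_succ h)]; rfl

/-- The expression only uses the variables bound by the outermost `m` binders. -/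
def Exp.Scoped (m : ℕ) (e : Exp) : Prop :=
  ∀ (σ : ℕ → Tm) (n : ℕ), m ≤ n → (e.build n).subst (liftN σ n) = e.build n

theorem Exp.Scoped.mono {m n : ℕ} {e : Exp} (h : e.Scoped m) (hmn : m ≤ n) : e.Scoped n :=
  fun σ k hk => h σ k (hmn.trans hk)

theorem Exp.scoped_bound {m n : ℕ} (h : n < m) : (Exp.bound n).Scoped m := fun σ k hk => by
  have : k - n - 1 < k := by omega
  exact liftN_lt σ this

theorem Exp.scoped_c (m : ℕ) (k : Cst) : (Exp.c k).Scoped m := fun _ _ _ => rfl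

theorem Exp.Scoped.app {m : ℕ} {f a : Exp} (hf : f.Scoped m) (ha : a.Scoped m) : Exp.Scoped m (f a) :=
  fun σ n h => congrArg₂ Tm.app (hf σ n h) (ha σ n h)

theorem Exp.Scoped.pi {m : ℕ} {A : Exp} {B : Exp → Exp} (hA : A.Scoped m)
    (hB : ∀ n, m ≤ n → (B (Exp.bound n)).Scoped (n + 1)) : (Exp.Pi A B).Scoped m :=
  fun σ n h => congrArg₂ Tm.pi (hA σ n h) (hB n h σ (n + 1) le_rfl)

theorem Exp.scoped_isTrunc (i : ℕ) : ∀ (n m : ℕ) (A : Exp), A.Scoped m → (Exp.isTrunc n i A).Scoped m := by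
  intro n
  induction n with
  | zero =>
    intro m A h
    refine h.pi fun n hn => (h.mono (by omega)).pi fun k hk => ?_
    exact (((scoped_c _ _).app (h.mono (by omega))).app (scoped_bound (by omega))).app
      (scoped_bound (by omega))
  | succ n ih =>
    intro m A h
    refine h.pi fun n hn => (h.mono (by omega)).pi fun k hk => ih _ _ ?_
    exact (((scoped_c _ _).app (h.mono (by omega))).app (scoped_bound (by omega))).app
      (scoped_bound (by omega))

theorem Exp.Scoped.closed {e : Exp} (h : e.Scoped 0) : (e.build 0).Closed := fun σ => h σ 0 le_rfl

/-- Each type is a concrete term on which substitution computes, except where `isTrunc` recurses on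
an unknown truncation level; there the scoping argument by induction is used. -/
theorem Cst.closed_type (k : Cst) : (k.type.build 0).Closed := by
  intro σ
  cases k
  case trLevel n i =>
    have h : (Cst.trLevel n i).type.Scoped 0 := by
      refine Exp.Scoped.pi (B := fun A => Exp.isTrunc n i (Exp.Trunc n i A)) (fun _ _ _ => rfl) fun m _ => ?_
      exact Exp.scoped_isTrunc i n _ _ ((Exp.scoped_c _ _).app (Exp.scoped_bound (by omega)))
    exact h.closed σ
  case trElim n i k =>
    have h (A P : Exp) (m : ℕ) (hA : A.Scoped m) (hP : P.Scoped m) :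
        (Exp.Pi (Exp.Trunc n i A) fun x => Exp.isTrunc n k (P x)).Scoped m :=
      ((Exp.scoped_c _ _).app hA).pi fun x hx =>
        Exp.scoped_isTrunc k n _ _ ((hP.mono (by omega)).app (Exp.scoped_bound (by omega)))
    have h := h (Exp.bound 0) (Exp.bound 1) 2 (Exp.scoped_bound (by omega))
      (Exp.scoped_bound (by omega)) σ 2 le_rfl
    exact congrArg (fun t => Tm.pi _ (.pi _ (.pi t _))) h
  all_goals rfl

/-! ### Typing -/

/-- The condition on `f` compares types after both have been moved to the full context; in this form
it passes under binders. -/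
theorem HasType.rename {Γ : List Tm} {t T : Tm} (h : HasType Γ t T) : ∀ {Δ : List Tm} {f : ℕ → ℕ},
    (∀ n A, Γ[n]? = some A → ∃ B, Δ[f n]? = some B ∧
      B.rename (· + (f n + 1)) = (A.rename (· + (n + 1))).rename f) →
    HasType Δ (t.rename f) (T.rename f) := by
  have lift {Γ Δ : List Tm} {f : ℕ → ℕ} (A : Tm)
      (hf : ∀ n A, Γ[n]? = some A → ∃ B, Δ[f n]? = some B ∧
        B.rename (· + (f n + 1)) = (A.rename (· + (n + 1))).rename f) :
      ∀ n B, (A :: Γ)[n]? = some B → ∃ C, (A.rename f :: Δ)[liftRen f n]? = some C ∧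
        C.rename (· + (liftRen f n + 1)) = (B.rename (· + (n + 1))).rename (liftRen f) := by
    rintro (_ | n) B hB
    · cases hB
      exact ⟨_, rfl, by simp only [rename_rename]; rfl⟩
    · obtain ⟨C, hC, e⟩ := hf n B hB
      refine ⟨C, hC, ?_⟩
      have := congrArg (Tm.rename Nat.succ) e
      simp only [rename_rename] at this ⊢
      exact this
  induction h with
  | @var Γ n A h =>
    intro Δ f hf
    obtain ⟨B, hB, e⟩ := hf n A h
    rw [← e]
    exact .var hB
  | univ Γ i => intros; exact .univ ..
  | cumul _ ih => intro Δ f hf; exact .cumul (ih hf)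
  | pi _ _ ih ih' => intro Δ f hf; exact .pi (ih hf) (ih' (lift _ hf))
  | lam _ _ ih ih' => intro Δ f hf; exact .lam (ih hf) (ih' (lift _ hf))
  | @app Γ A B t a _ _ ih ih' =>
    intro Δ f hf
    have := HasType.app (ih hf) (ih' hf)
    rw [rename_eq_subst _ (liftRen f), ← liftSub_var_comp, rename_eq_subst a, ← subst_inst,
      ← rename_eq_subst, ← rename_eq_subst (B.inst a)] at this
    exact this
  | cst Γ k => intro Δ f _; rw [k.closed_type.rename]; exact .cst ..
  | conv _ h _ ih ih' =>
    intro Δ f hf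
    refine .conv (ih hf) ?_ (ih' hf)
    simp only [rename_eq_subst]
    exact h.subst _

theorem HasType.weaken {Γ : List Tm} {t T : Tm} (A : Tm) (h : HasType Γ t T) :
    HasType (A :: Γ) (t.rename Nat.succ) (T.rename Nat.succ) :=
  h.rename fun n B hB => ⟨B, hB, by rw [rename_rename]; rfl⟩

theorem HasType.subst {Γ : List Tm} {t T : Tm} (h : HasType Γ t T) : ∀ {Δ : List Tm} {σ : ℕ → Tm},
    (∀ n A, Γ[n]? = some A → HasType Δ (σ n) ((A.rename (· + (n + 1))).subst σ)) →
    HasType Δ (t.subst σ) (T.subst σ) := by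
  have lift {Γ Δ : List Tm} {σ : ℕ → Tm} (A : Tm)
      (hσ : ∀ n A, Γ[n]? = some A → HasType Δ (σ n) ((A.rename (· + (n + 1))).subst σ)) :
      ∀ n B, (A :: Γ)[n]? = some B →
        HasType (A.subst σ :: Δ) (liftSub σ n) ((B.rename (· + (n + 1))).subst (liftSub σ)) := by
    rintro (_ | n) B hB
    · cases hB
      have := HasType.var (Γ := A.subst σ :: Δ) (n := 0) rfl
      rw [rename_subst] at this
      rw [subst_rename]
      exact this
    · have := (hσ n B hB).weaken (A.subst σ)
      simp only [rename_subst, subst_rename] at this ⊢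
      exact this
  induction h with
  | @var Γ n A h => intro Δ σ hσ; exact hσ n A h
  | univ Γ i => intros; exact .univ ..
  | cumul _ ih => intro Δ σ hσ; exact .cumul (ih hσ)
  | pi _ _ ih ih' => intro Δ σ hσ; exact .pi (ih hσ) (ih' (lift _ hσ))
  | lam _ _ ih ih' => intro Δ σ hσ; exact .lam (ih hσ) (ih' (lift _ hσ))
  | app _ _ ih ih' => intro Δ σ hσ; rw [subst_inst]; exact .app (ih hσ) (ih' hσ)
  | cst Γ k => intro Δ σ _; rw [k.closed_type]; exact .cst ..
  | conv _ h _ ih ih' => intro Δ σ hσ; exact .conv (ih hσ) (h.subst _) (ih' hσ)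

theorem HasType.inst {Γ : List Tm} {A b B a : Tm} (hb : HasType (A :: Γ) b B) (ha : HasType Γ a A) :
    HasType Γ (b.inst a) (B.inst a) := by
  refine hb.subst ?_
  rintro (_ | n) C hC
  · cases hC
    rw [subst_rename]
    exact (subst_var A).symm ▸ ha
  · rw [subst_rename]
    have := HasType.var (Γ := Γ) (n := n) hC
    rw [rename_eq_subst] at this
    exact this

/-- Generation for dependent function types. -/
theorem HasType.of_pi {Γ : List Tm} {A B T : Tm} (h : HasType Γ (.pi A B) T) :
    ∃ i, HasType Γ A (.univ i) ∧ HasType (A :: Γ) B (.univ i) := by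
  generalize e : Tm.pi A B = t at h
  induction h with
  | pi h h' => cases e; exact ⟨_, h, h'⟩
  | cumul _ ih => exact ih e
  | conv _ _ _ ih => exact ih e
  | _ => cases e

theorem HasType.cumul_le {Γ : List Tm} {A : Tm} {i j : ℕ} (h : HasType Γ A (.univ i)) (hij : i ≤ j) :
    HasType Γ A (.univ j) := by
  induction hij with
  | refl => exact h
  | step _ ih => exact .cumul ih

/-- Free variables are declared in the context. -/
theorem HasType.subst_eq {Γ : List Tm} {t T : Tm} (h : HasType Γ t T) : ∀ {σ : ℕ → Tm},
    (∀ n < Γ.length, σ n = .var n) → t.subst σ = t := by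
  have lift {Γ : List Tm} {σ : ℕ → Tm} (A : Tm) (hσ : ∀ n < Γ.length, σ n = .var n) :
      ∀ n < (A :: Γ).length, liftSub σ n = .var n := by
    rintro (_ | n) hn
    · rfl
    · rw [liftSub, hσ n (Nat.lt_of_succ_lt_succ hn)]; rfl
  induction h with
  | var h => intro σ hσ; exact hσ _ (List.getElem?_eq_some_iff.1 h).1
  | univ Γ i => intros; rfl
  | cumul _ ih => exact ih
  | pi _ _ ih ih' => intro σ hσ; rw [Tm.subst, ih hσ, ih' (lift _ hσ)]
  | lam _ _ ih ih' => intro σ hσ; rw [Tm.subst, ih hσ, ih' (lift _ hσ)]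
  | app _ _ ih ih' => intro σ hσ; rw [Tm.subst, ih hσ, ih' hσ]
  | cst Γ k => intros; rfl
  | conv _ _ _ ih => exact ih

theorem HasType.closed {t T : Tm} (h : HasType [] t T) : t.Closed :=
  fun _ => h.subst_eq fun _ hn => absurd hn (Nat.not_lt_zero _)

theorem HasType.of_nil {t T : Tm} (h : HasType [] t T) (hT : T.Closed) (Γ : List Tm) : HasType Γ t T := by
  have := h.subst (Δ := Γ) (σ := .var) (fun n A h => nomatch h)
  rwa [h.closed, hT] at this

end HoTT

/-! ### Soundness of evaluation, conversion and type checking -/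

namespace HoTT

open Tm

/-! ### The meaning of terms over a table -/

/-- The term of the theory that a term over a table stands for, if `ref n` stands for `ρ n`. -/
def Term.den (ρ : ℕ → Tm) : Term → Tm
  | var n => .var n
  | univ i => .univ i
  | pi A B => .pi (den ρ A) (den ρ B)
  | lam A b => .lam (den ρ A) (den ρ b)
  | app f a => .app (den ρ f) (den ρ a)
  | ref n => ρ n

theorem ble_eq_decide (m n : ℕ) : Nat.ble m n = decide (m ≤ n) := by
  rw [Bool.eq_iff_iff]; simp

theorem both_eq_true {b c : Bool} : both b c = true ↔ b = true ∧ c = true := by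
  cases b <;> cases c <;> decide

theorem either_eq_true {b c : Bool} : either b c = true ↔ b = true ∨ c = true := by
  cases b <;> cases c <;> decide

theorem test_decide {α : Type} (p : Prop) [Decidable p] (x y : α) :
    test (decide p) x y = if p then x else y := by
  by_cases h : p <;> simp only [h, decide_true, decide_false] <;> rfl

theorem Option.exists_of_andThen {α β : Type} {o : Option α} {f : α → Option β} {b : β}
    (h : o.andThen f = some b) : ∃ a, o = some a ∧ f a = some b := by
  cases o with
  | none => cases h
  | some a => exact ⟨a, rfl, h⟩

namespace Term

theorem eq_of_beq {t : Term} : ∀ {u : Term}, t.beq u = true → t = u := by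
  induction t with
  | pi A B hA hB | lam A B hA hB | app A B hA hB =>
    intro u h
    cases u <;> try cases h
    obtain ⟨h, h'⟩ := both_eq_true.1 h
    rw [hA h, hB h']
  | _ => intro u h; cases u <;> first | cases h | rw [Nat.eq_of_beq_eq_true h]

section Den

variable {ρ : ℕ → Tm}

theorem den_apps (as : Spine) : ∀ t : Term, (t.apps as).den ρ = (t.den ρ).apps (as.map (den ρ)) := by
  induction as with
  | nil => intro t; rfl
  | cons a as ih => intro t; exact ih (t.app a)

theorem spine_eq (t : Term) : ∀ as, (t.spine as).1.apps (t.spine as).2 = t.apps as := by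
  induction t with
  | app f a ih => intro as; exact ih (a :: as)
  | _ => intro as; rfl

variable (hρ : ∀ n, (ρ n).Closed)
include hρ

theorem den_lift (k : ℕ) (t : Term) :
    ∀ c, (t.lift k c).den ρ = (t.den ρ).rename fun n => if c ≤ n then n + k else n := by
  have hs (c : ℕ) : liftRen (fun n => if c ≤ n then n + k else n) =
      fun n => if c + 1 ≤ n then n + k else n := by
    funext n
    cases n with
    | zero => rfl
    | succ n => simp only [liftRen]; split_ifs <;> omega
  induction t with
  | var n =>
    intro c
    change Tm.var (test (Nat.ble c n) (n + k) n) = _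
    rw [ble_eq_decide, test_decide]; rfl
  | univ i => intro c; rfl
  | pi A B hA hB =>
    exact fun c => (congrArg₂ Tm.pi (hA c) (hB c.succ)).trans (by simp only [den, Tm.rename, hs])
  | lam A B hA hB =>
    exact fun c => (congrArg₂ Tm.lam (hA c) (hB c.succ)).trans (by simp only [den, Tm.rename, hs])
  | app A B hA hB => exact fun c => congrArg₂ Tm.app (hA c) (hB c)
  | ref n => intro c; exact ((hρ n).rename _).symm

theorem den_lift_zero (k : ℕ) (t : Term) : (t.lift k 0).den ρ = (t.den ρ).rename (· + k) := by
  rw [den_lift hρ]; simp only [Nat.zero_le, if_true]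

theorem den_liftBy (k : ℕ) (t : Term) : (t.liftBy k).den ρ = (t.den ρ).rename (· + k) := by
  cases k with
  | zero => exact (rename_eq_subst _ _).trans (subst_var _) |>.symm
  | succ k => exact den_lift_zero hρ (k + 1) t

theorem den_instVar_succ (d : ℕ) (σ : List Term) :
    ∀ m, (instVar (d + 1) σ m).den ρ = ((instVar d σ m).den ρ).rename Nat.succ := by
  induction σ with
  | nil => intro m; rfl
  | cons a σ ih =>
    rintro (_ | m)
    · refine (den_liftBy hρ (d + 1) a).trans (.trans ?_ (congrArg _ (den_liftBy hρ d a)).symm)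
      rw [rename_rename]; rfl
    · exact ih m

theorem den_inst (σ : List Term) (t : Term) : ∀ d, (t.inst σ d).den ρ =
    (t.den ρ).subst fun n => if d ≤ n then (instVar d σ (n - d)).den ρ else .var n := by
  have hs (d : ℕ) : liftSub (fun n => if d ≤ n then (instVar d σ (n - d)).den ρ else .var n) =
      fun n => if d + 1 ≤ n then (instVar (d + 1) σ (n - (d + 1))).den ρ else .var n := by
    funext n
    cases n with
    | zero => rfl
    | succ n =>
      simp only [liftSub, Nat.add_le_add_iff_right, Nat.add_sub_add_right, den_instVar_succ hρ]
      split_ifs <;> rfl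
  induction t with
  | var n =>
    intro d
    change (test (Nat.ble d n) (instVar d σ (n - d)) (var n)).den ρ = _
    rw [ble_eq_decide, test_decide, apply_ite (den ρ)]; rfl
  | univ i => intro c; rfl
  | pi A B hA hB =>
    exact fun d => (congrArg₂ Tm.pi (hA d) (hB d.succ)).trans (by simp only [den, Tm.subst, hs])
  | lam A B hA hB =>
    exact fun d => (congrArg₂ Tm.lam (hA d) (hB d.succ)).trans (by simp only [den, Tm.subst, hs])
  | app A B hA hB => exact fun d => congrArg₂ Tm.app (hA d) (hB d)
  | ref n => intro c; exact (hρ n _).symm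

/-- A simultaneous substitution is an iterated one. This justifies both the collected β-steps of
`whnfBeta` and the postponed substitutions of `inferArgs`. -/
theorem den_inst_cons (a : Term) (σ : List Term) (t : Term) :
    (t.inst (a :: σ) 0).den ρ = ((t.inst σ 1).den ρ).inst (a.den ρ) := by
  rw [den_inst hρ, den_inst hρ, Tm.inst, subst_subst]
  congr 1
  funext n
  cases n with
  | zero => rfl
  | succ n =>
    simp only [Function.comp, if_true, Nat.sub_zero, Nat.le_add_left, Nat.add_sub_cancel,
      den_instVar_succ hρ 0]
    exact (inst_rename_succ _ _).symm

theorem den_inst_nil (t : Term) (d : ℕ) : (t.inst [] d).den ρ = t.den ρ := by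
  rw [den_inst hρ]
  conv_rhs => rw [← subst_var (t.den ρ)]
  congr 1
  funext n
  split_ifs with h
  · exact congrArg Tm.var (Nat.sub_add_cancel h)
  · rfl

theorem den_instBy_cons (a : Term) (σ : List Term) (t : Term) :
    (instBy (a :: σ) t).den ρ = ((t.inst σ 1).den ρ).inst (a.den ρ) := den_inst_cons hρ a σ t

theorem den_instBy_pi (σ : List Term) (A B : Term) :
    (instBy σ (.pi A B)).den ρ = .pi ((instBy σ A).den ρ) ((B.inst σ 1).den ρ) := by
  cases σ with
  | nil => rw [den_inst_nil hρ]; rfl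
  | cons a σ => rfl

end Den

end Term

open Term

/-- The terms `ρ` are the meanings of the entries of the table. -/
structure Model (E : Table) (ρ : ℕ → Tm) : Prop where
  closed : ∀ n, (ρ n).Closed
  const : ∀ {n c}, constAt E n = some c → ρ n = .cst c
  defn : ∀ {n v}, defnAt E n = some v → ρ n = v.den ρ
  type : ∀ {n e}, E.get n = some e → HasType [] (ρ n) (e.ty.den ρ) ∧
    ∃ i, HasType [] (e.ty.den ρ) (.univ i)

/-! ### Soundness of evaluation -/

/-- The meaning of a term applied to arguments. -/
def denApp (ρ : ℕ → Tm) (t : Term) (as : Spine) : Tm := (t.den ρ).apps (as.map (den ρ))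

theorem Cst.eq_of_beq {c d : Cst} (h : c.beq d = true) : c = d := of_decide_eq_true h

section Iota

variable {ρ : ℕ → Tm} {main : Term → Option (Cst × Spine)}
  (hmain : ∀ {t c as}, main t = some (c, as) → Conv (t.den ρ) ((Tm.cst c).apps (as.map (den ρ))))

/-- Common shape of all computation rules: the main argument `t` is converted to a constructor form
`t'`, the rule fires, and the surplus arguments `bs` are carried along. -/
theorem conv_main {f t t' u v : Tm} (as bs : List Tm) {cs : List Tm} (h : Conv t t')
    (hi : Iota (f.apps (as ++ [t'])) u) (hc : cs = as ++ t :: bs) (hv : v = u.apps bs) :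
    Conv (f.apps cs) v := by
  subst hc hv
  have : as ++ t :: bs = (as ++ [t]) ++ bs := by simp
  rw [this, apps_append]
  refine Conv.apps_left (.trans ?_ (.iota hi)) bs
  rw [apps_append, apps_append]
  exact .app (.refl _) h

include hmain

theorem iota_sound {c : Cst} {r : Rule} (hr : c.rule = some r) {self : Term}
    (hself : self.den ρ = .cst c) {as bs : Spine} {t : Term}
    (h : iota main self r as = some (t, bs)) :
    Conv ((Tm.cst c).apps (as.map (den ρ))) (denApp ρ t bs) := by
  have hb {c d : Cst} {p q : Term × Spine}
      (h : (when c.beq d then some p else none) = some q) : c = d ∧ p = q := by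
    cases hc : c.beq d <;> rw [hc] at h <;> cases h
    exact ⟨Cst.eq_of_beq hc, rfl⟩
  cases c <;> cases hr <;> simp only [iota] at h
  case sigElim i k =>
    unfold iotaSig at h; split at h <;> [skip; cases h]
    obtain ⟨⟨c, cs⟩, hq, h⟩ := Option.exists_of_andThen h
    dsimp only at h; split at h <;> [skip; cases h]
    replace h := hb h; obtain ⟨rfl, h⟩ := h; cases h
    exact conv_main [_, _, _, _] _ (hmain hq) (.sig ..) rfl rfl
  case sumElim i k =>
    unfold iotaSum at h; split at h <;> [skip; cases h]
    obtain ⟨⟨c, cs⟩, hq, h⟩ := Option.exists_of_andThen h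
    dsimp only at h; split at h <;> [skip; cases h]
    cases hc : c.beq (.inl i) <;> rw [hc] at h
    · replace h := hb h; obtain ⟨rfl, h⟩ := h; cases h
      exact conv_main [_, _, _, _, _] _ (hmain hq) (.inr ..) rfl rfl
    · cases Cst.eq_of_beq hc; cases h
      exact conv_main [_, _, _, _, _] _ (hmain hq) (.inl ..) rfl rfl
  case oneElim k =>
    unfold iotaOne at h; split at h <;> [skip; cases h]
    obtain ⟨⟨c, cs⟩, hq, h⟩ := Option.exists_of_andThen h
    dsimp only at h; split at h <;> [skip; cases h]
    replace h := hb h; obtain ⟨rfl, h⟩ := h; cases h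
    exact conv_main [_, _] _ (hmain hq) (.star ..) rfl rfl
  case natElim k =>
    unfold iotaNat at h; split at h <;> [skip; cases h]
    obtain ⟨⟨c, cs⟩, hq, h⟩ := Option.exists_of_andThen h
    dsimp only at h; split at h <;> [skip; skip; cases h]
    · replace h := hb h; obtain ⟨rfl, h⟩ := h; cases h
      exact conv_main [_, _, _] _ (hmain hq) (.zero ..) rfl rfl
    · replace h := hb h; obtain ⟨rfl, h⟩ := h; cases h
      refine conv_main [_, _, _] _ (hmain hq) (.succ ..) rfl ?_
      simp only [denApp, List.map, den_apps, hself]; rfl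
  case listElim i k =>
    unfold iotaList at h; split at h <;> [skip; cases h]
    obtain ⟨⟨c, cs⟩, hq, h⟩ := Option.exists_of_andThen h
    dsimp only at h; split at h <;> [skip; skip; cases h]
    · replace h := hb h; obtain ⟨rfl, h⟩ := h; cases h
      exact conv_main [_, _, _, _] _ (hmain hq) (.nil ..) rfl rfl
    · replace h := hb h; obtain ⟨rfl, h⟩ := h; cases h
      refine conv_main [_, _, _, _] _ (hmain hq) (.cons ..) rfl ?_
      simp only [denApp, List.map, den_apps, hself]; rfl
  case eqElim i k =>
    unfold iotaEq at h; split at h <;> [skip; cases h]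
    obtain ⟨⟨c, cs⟩, hq, h⟩ := Option.exists_of_andThen h
    dsimp only at h; split at h <;> [skip; cases h]
    replace h := hb h; obtain ⟨rfl, h⟩ := h; cases h
    exact conv_main [_, _, _, _, _] _ (hmain hq) (.refl ..) rfl rfl
  case trElim n i k =>
    unfold iotaTr at h; split at h <;> [skip; cases h]
    obtain ⟨⟨c, cs⟩, hq, h⟩ := Option.exists_of_andThen h
    dsimp only at h; split at h <;> [skip; cases h]
    replace h := hb h; obtain ⟨rfl, h⟩ := h; cases h
    exact conv_main [_, _, _, _] _ (hmain hq) (.trIn ..) rfl rfl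
  case quoElim i k =>
    unfold iotaQuo at h; split at h <;> [skip; cases h]
    obtain ⟨⟨c, cs⟩, hq, h⟩ := Option.exists_of_andThen h
    dsimp only at h; split at h <;> [skip; cases h]
    replace h := hb h; obtain ⟨rfl, h⟩ := h; cases h
    exact conv_main [_, _, _, _, _, _] _ (hmain hq) (.quoIn ..) rfl rfl

end Iota

section Eval

variable {E : Table} {ρ : ℕ → Tm} (hE : Model E ρ)
include hE

theorem main_sound {p : Term × Spine} {c : Cst} {as : Spine} (h : mainOf E p = some (c, as)) :
    denApp ρ p.1 p.2 = (Tm.cst c).apps (as.map (den ρ)) := by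
  obtain ⟨t, bs⟩ := p
  unfold mainOf at h
  split at h <;> [skip; cases h]
  obtain ⟨c', hc, h⟩ := Option.exists_of_andThen h
  cases h
  next e =>
    cases e
    exact congrArg (fun t => Tm.apps t _) (hE.const hc)

variable {ev : Bool → Term → Spine → Term × Spine}
  (hev : ∀ δ t as, Conv (denApp ρ t as) (denApp ρ (ev δ t as).1 (ev δ t as).2))
include hev

theorem whnfRef_sound (δ : Bool) (n : ℕ) (as : Spine) : Conv (denApp ρ (.ref n) as)
    (denApp ρ (whnfRef E ev δ n as (ruleAt E n)).1 (whnfRef E ev δ n as (ruleAt E n)).2) := by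
  cases hr : ruleAt E n with
  | none =>
    simp only [whnfRef]
    cases δ with
    | false => exact .refl _
    | true =>
      simp only [whnfDelta]
      split
      next v hv =>
        have := hev true v as
        rwa [denApp, ← hE.defn hv] at this
      next => exact .refl _
  | some r =>
    obtain ⟨c, hc, hr⟩ := Option.exists_of_andThen hr
    simp only [whnfRef]
    cases hi : iota (fun p => mainOf E (ev true p [])) (.ref n) r as with
    | none => exact .refl _
    | some p =>
      refine .trans ?_ (hev δ p.1 p.2)
      have := iota_sound (ρ := ρ) (fun {t c as} h => ?_) hr (self := .ref n) (hE.const hc) hi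
      · rw [← hE.const hc] at this; exact this
      · rw [← main_sound hE h]; exact hev true t []

theorem whnfBeta_sound (δ : Bool) (as : Spine) : ∀ (t : Term) (σ : List Term),
    Conv (denApp ρ (t.inst σ 0) as) (denApp ρ (whnfBeta ev δ t σ as).1 (whnfBeta ev δ t σ as).2) := by
  induction as with
  | nil => intro t σ; cases t <;> exact hev ..
  | cons a as ih =>
    intro t σ
    cases t <;> try exact hev ..
    next A b =>
      refine .trans ?_ (ih b (a :: σ))
      have := Conv.apps_left (.beta ((A.inst σ 0).den ρ) ((b.inst σ 1).den ρ) (a.den ρ))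
        (as.map (den ρ))
      rwa [← den_inst_cons hE.closed] at this

theorem whnfStep_sound (δ : Bool) (t : Term) (as : Spine) :
    Conv (denApp ρ t as) (denApp ρ (whnfStep E ev δ t as).1 (whnfStep E ev δ t as).2) := by
  cases t with
  | app f a => exact hev δ f (a :: as)
  | lam A b =>
    cases as with
    | nil => exact .refl _
    | cons a as =>
      refine .trans ?_ (whnfBeta_sound hE hev δ as b [a])
      have := Conv.apps_left (.beta (A.den ρ) (b.den ρ) (a.den ρ)) (as.map (den ρ))
      rw [← den_inst_nil hE.closed b 1, ← den_inst_cons hE.closed, den_inst_nil hE.closed b 1] at this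
      exact this
  | ref n => exact whnfRef_sound hE hev δ n as
  | _ => exact .refl _

omit hev

theorem whnf_sound (k : ℕ) : ∀ δ t as,
    Conv (denApp ρ t as) (denApp ρ (whnf E k δ t as).1 (whnf E k δ t as).2) := by
  induction k with
  | zero => exact fun _ _ _ => .refl _
  | succ k ih => exact whnfStep_sound hE ih

theorem eval_sound (t : Term) : Conv (t.den ρ) ((t.eval E).den ρ) := by
  rw [Term.eval, unspine, den_apps]
  exact whnf_sound hE fuel true t []

end Eval

/-! ### Soundness of conversion -/

section Conv

variable {E : Table} {ρ : ℕ → Tm} (hE : Model E ρ) {cv : Term → Term → Bool}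
  (hcv : ∀ {t u}, cv t u = true → Conv (t.den ρ) (u.den ρ))

include hcv in
theorem allConv_sound : ∀ {as bs : Spine}, allConv cv as bs = true →
    List.Forall₂ Conv (as.map (den ρ)) (bs.map (den ρ))
  | [], [], _ => .nil
  | a :: as, b :: bs, h => by
    rw [allConv, both_eq_true] at h
    exact .cons (hcv h.1) (allConv_sound h.2)

include hE hcv

theorem convEta_sound {t b : Term} {as : Spine} (A : Term) (h : convEta cv t as b = true) :
    Conv (t.den ρ) (denApp ρ (.lam A b) as) := by
  cases as with
  | cons => cases h
  | nil =>
    have := hcv h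
    rw [Term.den, den_lift_zero hE.closed] at this
    exact .lam_of_app _ this

theorem convDelta_sound {t : Term} {m : ℕ} {bs : Spine} (h : convDelta E cv t m bs = true) :
    Conv (t.den ρ) (denApp ρ (.ref m) bs) := by
  unfold convDelta at h
  split at h <;> [skip; cases h]
  next v hv =>
    have := hcv h
    rw [den_apps, ← hE.defn hv] at this
    exact this

theorem defn_sound {n : ℕ} {v u : Term} {as : Spine} (hv : defnAt E n = some v)
    (h : cv (v.apps as) u = true) : Conv (denApp ρ (.ref n) as) (u.den ρ) := by
  have := hcv h
  rw [den_apps, ← hE.defn hv] at this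
  exact this

theorem convUnfold_sound {n m : ℕ} {as bs : Spine}
    (h : convUnfold cv n m as bs (defnAt E n) (defnAt E m) = true) :
    Conv (denApp ρ (.ref n) as) (denApp ρ (.ref m) bs) := by
  have hl {v w : Term} (hv : defnAt E n = some v) (hw : defnAt E m = some w)
      (h : cv (v.apps as) (w.apps bs) = true) : Conv (denApp ρ (.ref n) as) (denApp ρ (.ref m) bs) := by
    have := defn_sound hE hcv hv h
    rw [den_apps, ← hE.defn hw] at this
    exact this
  have hn {v : Term} (hv : defnAt E n = some v) (h : cv (v.apps as) ((Term.ref m).apps bs) = true) :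
      Conv (denApp ρ (.ref n) as) (denApp ρ (.ref m) bs) := by
    have := defn_sound hE hcv hv h
    rwa [den_apps] at this
  have hm {w : Term} (hw : defnAt E m = some w) (h : cv ((Term.ref n).apps as) (w.apps bs) = true) :
      Conv (denApp ρ (.ref n) as) (denApp ρ (.ref m) bs) := by
    have := hcv h
    rw [den_apps, den_apps, ← hE.defn hw] at this
    exact this
  cases hv : defnAt E n <;> cases hw : defnAt E m <;> rw [hv, hw] at h <;> simp only [convUnfold] at h
  · cases h
  · exact hm hw h
  · exact hn hv h
  · cases h1 : Nat.beq n m <;> rw [h1] at h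
    · cases h2 : Nat.ble n m <;> rw [h2] at h
      · exact hn hv h
      · exact hm hw h
    · exact hl hv hw h

theorem convHead_sound {t u : Term} {as bs : Spine} (h : convHead E cv t as u bs = true) :
    Conv (denApp ρ t as) (denApp ρ u bs) := by
  have delta {t : Term} {as : Spine} {m : ℕ} {bs : Spine}
      (h : convDelta E cv (t.apps as) m bs = true) : Conv (denApp ρ t as) (denApp ρ (.ref m) bs) := by
    have := convDelta_sound hE hcv h
    rwa [den_apps] at this
  have eta {t b : Term} {as bs : Spine} (A : Term)
      (h : convEta cv (t.apps as) bs b = true) : Conv (denApp ρ t as) (denApp ρ (.lam A b) bs) := by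
    have := convEta_sound hE hcv A h
    rwa [den_apps] at this
  cases t with
  | var n =>
    cases u <;> simp only [convHead, convVar, both_eq_true, Nat.beq_eq] at h
    case var m => rw [h.1]; exact .apps (allConv_sound hcv h.2) (.refl _)
    case lam A b => exact eta A h
    case ref m => exact delta h
    all_goals cases h
  | univ i =>
    cases u <;> simp only [convHead, convUniv, both_eq_true, Nat.beq_eq] at h
    case univ j => rw [h.1]; exact .apps (allConv_sound hcv h.2) (.refl _)
    case ref m => exact delta h
    all_goals cases h
  | pi A B =>
    cases u <;> simp only [convHead, convPi, both_eq_true] at h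
    case pi A' B' => exact .apps (allConv_sound hcv h.2.2) (.pi (hcv h.1) (hcv h.2.1))
    case ref m => exact delta h
    all_goals cases h
  | lam A b =>
    cases as with
    | cons => cases h
    | nil =>
      cases u
      case lam A' b' =>
        cases bs with
        | nil => exact .lam_of_body _ _ (hcv h)
        | cons => cases h
      all_goals
        have := convEta_sound hE hcv A (as := []) h
        rw [den_apps] at this
        exact this.symm
  | app => cases h
  | ref n =>
    cases u
    case ref m =>
      simp only [convHead, convRef, either_eq_true, both_eq_true, Nat.beq_eq] at h
      rcases h with ⟨rfl, h⟩ | h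
      · exact .apps (allConv_sound hcv h) (.refl _)
      · exact convUnfold_sound hE hcv h
    case lam A b => exact eta A h
    all_goals
      simp only [convHead, convRef] at h
      split at h <;> [skip; cases h]
      next hv =>
        have := defn_sound hE hcv hv h
        rwa [den_apps] at this

omit hcv

theorem conv_sound (k : ℕ) : ∀ {t u}, conv E k t u = true → Conv (t.den ρ) (u.den ρ) := by
  induction k with
  | zero => exact fun h => nomatch h
  | succ k ih =>
    intro t u h
    simp only [conv, convStep, convWhnf, either_eq_true] at h
    rcases h with h | h
    · rw [eq_of_beq h]; exact .refl _
    · exact ((whnf_sound hE fuel false t []).trans (convHead_sound hE ih h)).trans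
        (whnf_sound hE fuel false u []).symm

end Conv

/-! ### Soundness of the type checker -/

def IsTy (Γ : List Tm) (T : Tm) : Prop := ∃ i, HasType Γ T (.univ i)

theorem HasType.conv_univ {Γ : List Tm} {T T' : Tm} {i : ℕ} (h : HasType Γ T T') (hc : Conv T' (.univ i)) :
    HasType Γ T (.univ i) := .conv h hc (.univ ..)

/-- The types in the context are well-formed. -/
def CtxOk (ρ : ℕ → Tm) (Γ : List Term) : Prop :=
  ∀ n A, getAt Γ n = some A → IsTy (Γ.map (den ρ)) ((A.den ρ).rename (· + (n + 1)))

theorem IsTy.weaken {Γ : List Tm} {T : Tm} (A : Tm) (h : IsTy Γ T) : IsTy (A :: Γ) (T.rename Nat.succ) :=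
  ⟨_, h.choose_spec.weaken A⟩

theorem CtxOk.cons {ρ : ℕ → Tm} {Γ : List Term} (h : CtxOk ρ Γ) {A : Term}
    (hA : IsTy (Γ.map (den ρ)) (A.den ρ)) : CtxOk ρ (A :: Γ) := by
  rintro (_ | n) B hB
  · cases hB
    exact hA.weaken _
  · have := (h n B hB).weaken (A.den ρ)
    rw [rename_rename] at this
    exact this

theorem getElem?_map_den {ρ : ℕ → Tm} {A : Term} : ∀ (Γ : List Term) (n : ℕ), getAt Γ n = some A →
    (Γ.map (den ρ))[n]? = some (A.den ρ)
  | _ :: _, 0, h => by cases h; rfl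
  | _ :: Γ, n + 1, h => getElem?_map_den Γ n h

section Infer

variable {E : Table} {ρ : ℕ → Tm} (hE : Model E ρ)
include hE

theorem levelOf_sound {T : Term} {i : ℕ} (h : levelOf E T = some i) : Conv (T.den ρ) (.univ i) := by
  have := whnf_sound hE fuel true T []
  unfold levelOf univLevel at h
  split at h <;> [skip; cases h]
  next e => cases h; rwa [e] at this

/-- Conversion relates raw terms, so well-formedness of the target type has to be supplied.
Cumulativity enters only when both sides evaluate to universes. -/
theorem sub_sound {Γ : List Tm} {t : Tm} {T T' : Term} (h : sub E T T' = true)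
    (ht : HasType Γ t (T.den ρ)) (hT : IsTy Γ (T'.den ρ)) : HasType Γ t (T'.den ρ) := by
  obtain ⟨k, hk⟩ := hT
  simp only [sub, either_eq_true] at h
  rcases h with h | h | h
  · rwa [← eq_of_beq h]
  · exact .conv ht (conv_sound hE _ h) hk
  · cases hi : levelOf E T <;> cases hj : levelOf E T' <;> rw [hi, hj] at h <;> try cases h
    have hij : _ ≤ _ := Nat.le_of_ble_eq_true h
    exact .conv ((ht.conv_univ (levelOf_sound hE hi)).cumul_le hij) (levelOf_sound hE hj).symm hk

variable {rc : List Term → Term → Option Term → Option Term}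

/-- Soundness of a type checker in both modes. -/
def Sound (ρ : ℕ → Tm) (rc : List Term → Term → Option Term → Option Term) : Prop :=
  ∀ {Γ : List Term}, CtxOk ρ Γ → ∀ {t : Term},
    (∀ {T}, rc Γ t none = some T →
      HasType (Γ.map (den ρ)) (t.den ρ) (T.den ρ) ∧ IsTy (Γ.map (den ρ)) (T.den ρ)) ∧
    ∀ {T T'}, IsTy (Γ.map (den ρ)) (T.den ρ) → rc Γ t (some T) = some T' →
      HasType (Γ.map (den ρ)) (t.den ρ) (T.den ρ)

variable (hrc : Sound ρ rc) {Γ : List Term} (hΓ : CtxOk ρ Γ)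
include hrc hΓ

theorem infer_univ {A T : Term} {i : ℕ} (h : rc Γ A none = some T) (hi : levelOf E T = some i) :
    HasType (Γ.map (den ρ)) (A.den ρ) (.univ i) :=
  ((hrc hΓ).1 h).1.conv_univ (levelOf_sound hE hi)

theorem inferPi_sound {A B T : Term} (h : inferPi E rc Γ A B = some T) :
    HasType (Γ.map (den ρ)) (.pi (A.den ρ) (B.den ρ)) (T.den ρ) ∧ IsTy (Γ.map (den ρ)) (T.den ρ) := by
  obtain ⟨T₁, h₁, h⟩ := Option.exists_of_andThen h
  obtain ⟨i, hi, h⟩ := Option.exists_of_andThen h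
  obtain ⟨T₂, h₂, h⟩ := Option.exists_of_andThen h
  obtain ⟨j, hj, h⟩ := Option.exists_of_andThen h
  cases h
  have hA := infer_univ hE hrc hΓ h₁ hi
  have hB := infer_univ hE hrc (hΓ.cons ⟨i, hA⟩) h₂ hj
  refine ⟨?_, _, .univ ..⟩
  cases hij : Nat.ble i j
  · refine .pi hA (hB.cumul_le ?_)
    rw [ble_eq_decide] at hij
    exact (Nat.le_total i j).resolve_left (of_decide_eq_false hij)
  · exact .pi (hA.cumul_le (Nat.le_of_ble_eq_true hij)) hB

theorem inferLam_sound {A b T : Term} (h : inferLam E rc Γ A b = some T) :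
    HasType (Γ.map (den ρ)) (.lam (A.den ρ) (b.den ρ)) (T.den ρ) ∧ IsTy (Γ.map (den ρ)) (T.den ρ) := by
  obtain ⟨T₁, h₁, h⟩ := Option.exists_of_andThen h
  obtain ⟨i, hi, h⟩ := Option.exists_of_andThen h
  obtain ⟨B, hB, h⟩ := Option.exists_of_andThen h
  cases h
  have hA := infer_univ hE hrc hΓ h₁ hi
  have hB := (hrc (hΓ.cons ⟨i, hA⟩)).1 hB
  obtain ⟨j, hj⟩ := hB.2
  exact ⟨.lam hA hB.1, max i j, .pi (hA.cumul_le (le_max_left ..)) (hj.cumul_le (le_max_right ..))⟩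

omit hE in
theorem app_sound {f a A : Term} {B : Tm}
    (hf : HasType (Γ.map (den ρ)) (f.den ρ) (.pi (A.den ρ) B) ∧
      IsTy (Γ.map (den ρ)) (.pi (A.den ρ) B))
    {T : Term} (h : rc Γ a (some A) = some T) :
    HasType (Γ.map (den ρ)) ((f.app a).den ρ) (B.inst (a.den ρ)) ∧
      IsTy (Γ.map (den ρ)) (B.inst (a.den ρ)) := by
  obtain ⟨i, hA, hB⟩ := hf.2.choose_spec.of_pi
  have ha := (hrc hΓ).2 ⟨i, hA⟩ h
  exact ⟨.app hf.1 ha, i, hB.inst ha⟩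

/-- The invariant is that the function applied so far has the type `T` with `σ` substituted. If this
is no visible function type, its evaluation, just checked again, takes its place and the
substitution restarts with one argument. -/
theorem inferArgs_sound : ∀ {as : Spine} {σ : List Term} {f T R : Term},
    HasType (Γ.map (den ρ)) (f.den ρ) ((instBy σ T).den ρ) ∧
      IsTy (Γ.map (den ρ)) ((instBy σ T).den ρ) →
    inferArgs E rc Γ as σ T = some R →
    HasType (Γ.map (den ρ)) ((f.apps as).den ρ) (R.den ρ) ∧ IsTy (Γ.map (den ρ)) (R.den ρ) := by
  intro as
  induction as with
  | nil => intro σ f T R hf h; cases h; exact hf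
  | cons a as ih =>
    intro σ f T R hf h
    have step {σ : List Term} {T : Term} (hf : HasType (Γ.map (den ρ)) (f.den ρ) ((instBy σ T).den ρ) ∧
        IsTy (Γ.map (den ρ)) ((instBy σ T).den ρ)) :
        inferArg E rc Γ a (inferArgs E rc Γ as) (instBy σ T) = some R →
        HasType (Γ.map (den ρ)) (((f.app a).apps as).den ρ) (R.den ρ) ∧
          IsTy (Γ.map (den ρ)) (R.den ρ) := by
      intro h
      obtain ⟨T', hT', h⟩ := Option.exists_of_andThen h
      have hc := eval_sound hE (instBy σ T)
      split at h <;> [skip; cases h]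
      next A B e =>
      rw [e] at hT' hc
      have ⟨i, hA, hB⟩ := ((hrc hΓ).1 hT').1.of_pi
      obtain ⟨_, ha, h⟩ := Option.exists_of_andThen h
      refine ih (σ := [a]) ?_ h
      rw [den_instBy_cons hE.closed, den_inst_nil hE.closed]
      have hp : HasType _ _ (Tm.univ i) := .pi hA hB
      exact app_sound hrc hΓ ⟨.conv hf.1 hc hp, i, hp⟩ ha
    cases T <;> try exact step hf h
    next =>
      obtain ⟨_, ha, h⟩ := Option.exists_of_andThen h
      refine ih (f := f.app a) ?_ h
      rw [den_instBy_cons hE.closed]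
      rw [den_instBy_pi hE.closed] at hf
      exact app_sound hrc hΓ hf ha

theorem inferStep_sound {t T : Term} (h : inferStep E rc Γ t = some T) :
    HasType (Γ.map (den ρ)) (t.den ρ) (T.den ρ) ∧ IsTy (Γ.map (den ρ)) (T.den ρ) := by
  cases t with
  | var n =>
    obtain ⟨A, hA, h⟩ := Option.exists_of_andThen h
    cases h
    rw [den_lift_zero hE.closed]
    exact ⟨.var (getElem?_map_den Γ n hA), hΓ n A hA⟩
  | univ i => cases h; exact ⟨.univ .., _, .univ ..⟩
  | pi A B => exact inferPi_sound hE hrc hΓ h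
  | lam A b => exact inferLam_sound hE hrc hΓ h
  | app f a =>
    obtain ⟨T', hT', h⟩ := Option.exists_of_andThen h
    have := inferArgs_sound hE hrc hΓ (σ := []) ((hrc hΓ).1 hT') h
    rwa [spine_eq] at this
  | ref n =>
    obtain ⟨e, he, h⟩ := Option.exists_of_andThen h
    cases h
    obtain ⟨h, i, hi⟩ := hE.type he
    exact ⟨h.of_nil hi.closed _, i, hi.of_nil (fun _ => rfl) _⟩

theorem checkConv_sound {t T T' : Term} (hT : IsTy (Γ.map (den ρ)) (T.den ρ))
    (h : checkConv E rc Γ t T = some T') : HasType (Γ.map (den ρ)) (t.den ρ) (T.den ρ) := by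
  obtain ⟨T₁, h₁, h⟩ := Option.exists_of_andThen h
  cases hs : sub E T₁ T <;> rw [hs] at h
  · cases h
  · exact sub_sound hE hs ((hrc hΓ).1 h₁).1 hT

theorem checkStep_sound {t T T' : Term} (hT : IsTy (Γ.map (den ρ)) (T.den ρ))
    (h : checkStep E rc Γ t T = some T') : HasType (Γ.map (den ρ)) (t.den ρ) (T.den ρ) := by
  cases t with
  | lam A b =>
    cases T with
    | pi A' B =>
      cases he : A.beq A' <;> simp only [checkStep, checkLam, he] at h
      · exact checkConv_sound hE hrc hΓ hT h
      · cases eq_of_beq he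
        obtain ⟨_, hb, h⟩ := Option.exists_of_andThen h
        obtain ⟨i, hA, hB⟩ := hT.choose_spec.of_pi
        exact .lam hA ((hrc (hΓ.cons ⟨i, hA⟩)).2 ⟨i, hB⟩ hb)
    | _ => exact checkConv_sound hE hrc hΓ hT h
  | _ => exact checkConv_sound hE hrc hΓ hT h

omit hrc hΓ

/-- Induction on the fuel, each layer using the previous one as its recursive call; exhausted fuel
gives `none`, which asserts nothing. -/
theorem typeOf_sound (k : ℕ) : Sound ρ (typeOf E k) := by
  induction k with
  | zero => exact fun _ _ => ⟨fun h => (nomatch h), fun _ h => (nomatch h)⟩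
  | succ k ih =>
    exact fun hΓ _ => ⟨fun h => inferStep_sound hE ih hΓ h, fun hT h => checkStep_sound hE ih hΓ hT h⟩

theorem isType_sound {T : Term} (h : isType E T = true) : IsTy [] (T.den ρ) := by
  simp only [isType, Bool.and_eq_true, Option.isSome_iff_exists] at h
  obtain ⟨⟨i, h⟩, -⟩ := h
  obtain ⟨T', hT, hi⟩ := Option.exists_of_andThen h
  exact ⟨i, infer_univ hE (typeOf_sound hE _) (Γ := []) (fun _ _ h => (nomatch h)) hT hi⟩

theorem hasType_sound {t T : Term} (hT : IsTy [] (T.den ρ)) (h : hasType E t T = true) :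
    HasType [] (t.den ρ) (T.den ρ) := by
  obtain ⟨T', h⟩ := Option.isSome_iff_exists.1 h
  exact (typeOf_sound hE fuel (Γ := []) (fun _ _ h => (nomatch h))).2 hT h

end Infer

/-! ### Extension of the table -/

theorem Tree.get_node (e : Option Entry) (l r : Tree) (n : ℕ) : (node e l r).get n =
    (when Nat.beq n 0 then e
    else when Nat.beq (n.mod 2) 1 then l.get (n.div 2) else r.get (n.div 2).pred) := rfl

/-- Only this direction matters: nothing but the new entry and old ones can be found. A lost entry
could only make a check fail. -/
theorem Tree.get_add {e e' : Entry} : ∀ {t : Tree} {n m : ℕ}, (t.add e n).get m = some e' →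
    (m = n ∧ e' = e) ∨ t.get m = some e' := by
  have hd (k : ℕ) : k.div 2 = k / 2 := rfl
  have hm' (k : ℕ) : k.mod 2 = k % 2 := rfl
  intro t
  induction t with
  | leaf =>
    intro n m h
    cases hn : Nat.beq n 0 <;> simp only [add, hn, test] at h
    · exact .inr h
    · cases hm : Nat.beq m 0 <;> simp only [get_node, hm, test] at h
      · cases hp : Nat.beq (m.mod 2) 1 <;> simp only [hp] at h <;> cases h
      · cases h
        exact .inl ⟨(Nat.eq_of_beq_eq_true hm).trans (Nat.eq_of_beq_eq_true hn).symm, rfl⟩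
  | node e₀ l r hl hr =>
    intro n m h
    cases hn : Nat.beq n 0 <;> cases hm : Nat.beq m 0 <;>
      cases pn : Nat.beq (n.mod 2) 1 <;> cases pm : Nat.beq (m.mod 2) 1 <;>
      simp only [add, hn, hm, pn, pm, test, get_node] at h ⊢ <;> try exact .inr h
    · refine (hr h).imp_left fun h => ⟨?_, h.2⟩
      simp only [Bool.eq_false_iff, ne_eq, Nat.beq_eq, hd, hm', Nat.pred_eq_sub_one] at *
      omega
    · refine (hl h).imp_left fun h => ⟨?_, h.2⟩
      simp only [Bool.eq_false_iff, ne_eq, Nat.beq_eq, hd, hm'] at *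
      omega
    all_goals
      cases h
      exact .inl ⟨(Nat.eq_of_beq_eq_true hm).trans (Nat.eq_of_beq_eq_true hn).symm, rfl⟩

theorem Table.get_add {E : Table} {e e' : Entry} {n : ℕ} (h : (E.add e).get n = some e') :
    (n = E.size ∧ e' = e) ∨ E.get n = some e' := Tree.get_add h

namespace Term

theorem bounded_pi (n : ℕ) (A B : Term) (k : ℕ) : (pi A B).bounded n k = true ↔
    A.bounded n k = true ∧ B.bounded n (k + 1) = true := both_eq_true

theorem bounded_lam (n : ℕ) (A b : Term) (k : ℕ) : (lam A b).bounded n k = true ↔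
    A.bounded n k = true ∧ b.bounded n (k + 1) = true := both_eq_true

theorem bounded_app (n : ℕ) (f a : Term) (k : ℕ) : (app f a).bounded n k = true ↔
    f.bounded n k = true ∧ a.bounded n k = true := both_eq_true

theorem bounded_mono {m n : ℕ} (hmn : m ≤ n) {t : Term} : ∀ {k : ℕ}, t.bounded m k = true →
    t.bounded n k = true := by
  induction t with
  | pi A B hA hB | lam A B hA hB | app A B hA hB =>
    intro k h
    simp only [bounded_pi, bounded_lam, bounded_app] at h ⊢
    exact ⟨hA h.1, hB h.2⟩
  | ref i =>
    intro k h
    exact Nat.ble_eq_true_of_le ((Nat.le_of_ble_eq_true h).trans hmn)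
  | _ => exact fun h => h

theorem den_congr {ρ ρ' : ℕ → Tm} {n : ℕ} (hρ : ∀ m < n, ρ m = ρ' m) {t : Term} :
    ∀ {k : ℕ}, t.bounded n k = true → t.den ρ = t.den ρ' := by
  induction t with
  | pi A B hA hB | lam A B hA hB | app A B hA hB =>
    intro k h
    simp only [bounded_pi, bounded_lam, bounded_app] at h
    simp only [den, hA h.1, hB h.2]
  | ref i => exact fun h => hρ i (Nat.le_of_ble_eq_true h)
  | _ => exact fun _ => rfl

end Term

/-- Entries of the table only refer to entries of the table. -/
structure Table.Bounded (E : Table) : Prop where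
  lt : ∀ {n e}, E.get n = some e → n < E.size
  type : ∀ {n e}, E.get n = some e → e.ty.bounded E.size 0 = true
  defn : ∀ {n v}, defnAt E n = some v → v.bounded E.size 0 = true

theorem constAt_eq {E : Table} {n : ℕ} {c : Cst} (h : constAt E n = some c) :
    ∃ e, E.get n = some e ∧ e.kind = .const c := by
  obtain ⟨e, he, h⟩ := Option.exists_of_andThen h
  refine ⟨e, he, ?_⟩
  revert h
  cases e.kind <;> intro h <;> cases h
  rfl

theorem defnAt_eq {E : Table} {n : ℕ} {v : Term} (h : defnAt E n = some v) :
    ∃ e, E.get n = some e ∧ e.kind = .defn v := by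
  obtain ⟨e, he, h⟩ := Option.exists_of_andThen h
  refine ⟨e, he, ?_⟩
  revert h
  cases e.kind <;> intro h <;> cases h
  rfl

theorem defnAt_of_get {E : Table} {n : ℕ} {e : Entry} {v : Term} (h : E.get n = some e)
    (hv : e.kind = .defn v) : defnAt E n = some v := by
  obtain ⟨_, _, _⟩ := e
  cases hv
  rw [defnAt, h]; rfl

theorem constAt_of_get {E : Table} {n : ℕ} {e : Entry} {c : Cst} (h : E.get n = some e)
    (hv : e.kind = .const c) : constAt E n = some c := by
  obtain ⟨_, _, _⟩ := e
  cases hv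
  rw [constAt, h]; rfl

section Extend

variable {E : Table} {ρ : ℕ → Tm} (hE : Model E ρ) (hb : E.Bounded) {e : Entry} {u : Tm}
  (ht : e.ty.bounded E.size 0 = true) (hv : ∀ {v}, e.kind = .defn v → v.bounded E.size 0 = true)

include hb ht hv in
theorem Table.Bounded.add : (E.add e).Bounded where
  lt h := (Table.get_add h).elim (fun h => h.1 ▸ Nat.lt_succ_self _) fun h =>
    (hb.lt h).trans (Nat.lt_succ_self _)
  type h := bounded_mono (Nat.le_succ _) <| (Table.get_add h).elim (fun h => h.2 ▸ ht) hb.type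
  defn h := by
    obtain ⟨e', h, hk⟩ := defnAt_eq h
    refine bounded_mono (Nat.le_succ _) ?_
    rcases Table.get_add h with ⟨-, rfl⟩ | h
    · exact hv hk
    · exact hb.defn (defnAt_of_get h hk)

-- All references in the table and in the new entry lie below `E.size`, so changing the
-- interpretation at `E.size` leaves every earlier meaning intact.
include hE hb ht hv in
theorem Model.add (hT : IsTy [] (e.ty.den ρ)) (hu : HasType [] u (e.ty.den ρ))
    (hc : ∀ {c}, e.kind = .const c → u = .cst c) (hd : ∀ {v}, e.kind = .defn v → u = v.den ρ) :
    Model (E.add e) (Function.update ρ E.size u) := by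
  have hρ : ∀ m < E.size, Function.update ρ E.size u m = ρ m :=
    fun m hm => Function.update_of_ne hm.ne _ _
  refine ⟨fun n => ?_, fun h => ?_, fun h => ?_, fun h => ?_⟩
  · by_cases hn : n = E.size
    · subst hn; rw [Function.update_self]; exact hu.closed
    · rw [Function.update_of_ne hn]; exact hE.closed n
  · obtain ⟨e', h, hk⟩ := constAt_eq h
    rcases Table.get_add h with ⟨rfl, rfl⟩ | h
    · rw [Function.update_self]; exact hc hk
    · rw [hρ _ (hb.lt h)]; exact hE.const (constAt_of_get h hk)
  · obtain ⟨e', h, hk⟩ := defnAt_eq h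
    rcases Table.get_add h with ⟨rfl, rfl⟩ | h
    · rw [Function.update_self, den_congr hρ (hv hk)]; exact hd hk
    · have h' := defnAt_of_get h hk
      rw [hρ _ (hb.lt h), den_congr hρ (hb.defn h')]; exact hE.defn h'
  · rcases Table.get_add h with ⟨rfl, rfl⟩ | h
    · rw [Function.update_self, den_congr hρ ht]; exact ⟨hu, hT⟩
    · rw [hρ _ (hb.lt h), den_congr hρ (hb.type h)]; exact hE.type h

end Extend

/-! ### Soundness of the checks -/

/-- The table is well-formed, and the constants in it have their meaning. -/
structure Model.Good (E : Table) (ρ : ℕ → Tm) : Prop where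
  model : Model E ρ
  bounded : E.Bounded
  const : ∀ c, constIndex c < constants.length → constIndex c < E.size → ρ (constIndex c) = .cst c

theorem den_toTerm {ρ : ℕ → Tm} {n : ℕ} (hρ : ∀ c, constIndex c < n → ρ (constIndex c) = .cst c) (t : Tm) :
    ∀ {k}, t.toTerm.bounded n k = true → t.toTerm.den ρ = t := by
  induction t with
  | pi A B hA hB | lam A B hA hB | app A B hA hB =>
    intro k h
    simp only [Tm.toTerm, bounded_pi, bounded_lam, bounded_app] at h
    simp only [Tm.toTerm, den, hA h.1, hB h.2]
  | cst c => exact fun h => hρ c (Nat.le_of_ble_eq_true h)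
  | _ => exact fun _ => rfl

theorem constIndex_inj {c d : Cst} (hc : constIndex c < constants.length)
    (h : constIndex c = constIndex d) : c = d := by
  have hd := h ▸ hc
  rw [← List.getElem_idxOf hc, ← List.getElem_idxOf hd]
  exact getElem_congr_idx h

/-- Here `ds` is the list of constants already added. The type of the next constant mentions only
these, so its meaning in the table is the type prescribed by the theory. -/
theorem Model.Good.checkConsts {cs : List Cst} : ∀ {ds : List Cst} {E : Table} {ρ : ℕ → Tm},
    constants = ds ++ cs → E.size = ds.length → Good E ρ → HoTT.checkConsts E cs = true →
    ∃ ρ', Good (addConsts E cs) ρ' := by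
  induction cs with
  | nil => exact fun _ _ h _ => ⟨_, h⟩
  | cons c cs ih =>
    intro ds E ρ hds hs hE h
    simp only [HoTT.checkConsts, Bool.and_eq_true] at h
    -- Without repetitions, the index of the next constant is exactly the current size of the table.
    have hn : constants.Nodup := by decide
    have hi : constIndex c = E.size := by
      rw [hds] at hn
      have : c ∉ ds := fun h => (List.nodup_append.1 hn).2.2 c h c (by simp) rfl
      rw [constIndex, hds, List.idxOf_append_of_notMem this, hs]
      simp
    have hl : E.size < constants.length := by rw [hds, hs]; simp
    have hT := isType_sound hE.model h.1
    have hb : c.entry.ty.bounded E.size 0 = true := by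
      have := h.1
      simp only [isType, Bool.and_eq_true] at this
      exact this.2
    have hd : c.entry.ty.den ρ = c.type.build 0 :=
      den_toTerm (fun c h => hE.const c (h.trans hl) h) _ hb
    refine ih (ds := ds ++ [c]) (by simp [hds]) (by simp [Table.add, hs])
      ⟨hE.model.add (u := .cst c) hE.bounded hb (fun h => (nomatch h)) hT (hd ▸ .cst [] c) ?_
          (fun h => (nomatch h)),
        hE.bounded.add hb (fun h => (nomatch h)), ?_⟩ h.2
    · intro c' h; cases h; rfl
    · intro c' h h'
      by_cases hc : constIndex c' = E.size
      · rw [hc, Function.update_self, constIndex_inj (hc ▸ hl) (hc.trans hi.symm)]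
      · rw [Function.update_of_ne hc]
        exact hE.const c' h (Nat.lt_of_le_of_ne (Nat.lt_succ_iff.1 h') hc)

theorem Model.Good.snoc {E : Table} {ρ : ℕ → Tm} (hs : constants.length ≤ E.size) (hE : Good E ρ)
    {d : Decl} (h : d.check E = true) : ∃ ρ', Good (E.add (d.entry E)) ρ' := by
  simp only [Decl.check, Bool.and_eq_true] at h
  obtain ⟨hT, ht, hv⟩ := h
  have hb : (d.type E).bounded E.size 0 = true := by
    have := hT
    simp only [isType, Bool.and_eq_true] at this
    exact this.2
  have hT := isType_sound hE.model hT
  have ht := hasType_sound hE.model hT ht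
  have hk {v} (h : (d.entry E).kind = .defn v) : v = d.value E ∧ v.bounded E.size 0 = true := by
    cases hu : d.unfold <;> simp only [Decl.entry, hu] at h <;> cases h
    rw [hu] at hv
    exact ⟨rfl, hv⟩
  refine ⟨_, hE.model.add (u := (d.value E).den ρ) hE.bounded hb (fun h => (hk h).2) hT ht ?_
    fun h => (hk h).1 ▸ rfl, hE.bounded.add hb (fun h => (hk h).2), ?_⟩
  · intro c h
    cases hu : d.unfold <;> simp only [Decl.entry, hu] at h <;> cases h
  · intro c h _
    rw [Function.update_of_ne (h.trans_le hs).ne]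
    exact hE.const c h (h.trans_le hs)

/-- The table has a meaning, and it contains all constants. -/
def Table.Meaningful (E : Table) : Prop := constants.length ≤ E.size ∧ ∃ ρ, Model.Good E ρ

theorem Table.Meaningful.extend {ds : List Decl} : ∀ {E : Table}, E.Meaningful →
    checkDecls E ds = true → (HoTT.extend E ds).Meaningful := by
  induction ds with
  | nil => exact fun hE _ => hE
  | cons d ds ih =>
    intro E hE h
    simp only [checkDecls, Bool.and_eq_true] at h
    obtain ⟨ρ, hρ⟩ := hE.2
    exact ih ⟨hE.1.trans (Nat.le_succ _), hρ.snoc hE.1 h.1⟩ h.2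

theorem Table.Meaningful.provable {E : Table} (hE : E.Meaningful) {n : ℕ} {T : Exp}
    (h : checkElem E n T = true) : Provable T := by
  obtain ⟨hs, ρ, hE⟩ := hE
  simp only [checkElem, Bool.and_eq_true] at h
  obtain ⟨hb, hT, ht⟩ := h
  have := hasType_sound hE.model (isType_sound hE.model hT) ht
  rw [den_toTerm (fun c h => hE.const c h (h.trans_le hs)) _ hb] at this
  exact ⟨_, this⟩

theorem Model.Good.empty : Good ⟨.leaf, 0⟩ fun _ => .univ 0 := by
  have h {n e} : (⟨.leaf, 0⟩ : Table).get n = some e → False := fun h => nomatch h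
  refine ⟨⟨fun _ _ => rfl, fun h' => ?_, fun h' => ?_, fun h' => (h h').elim⟩,
    ⟨fun h' => (h h').elim, fun h' => (h h').elim, fun h' => ?_⟩,
    fun _ _ h => absurd h (Nat.not_lt_zero _)⟩
  · exact (h (constAt_eq h').choose_spec.1).elim
  · exact (h (defnAt_eq h').choose_spec.1).elim
  · exact (h (defnAt_eq h').choose_spec.1).elim

theorem size_addConsts (cs : List Cst) : ∀ E : Table, (addConsts E cs).size = E.size + cs.length := by
  induction cs with
  | nil => exact fun E => rfl
  | cons c cs ih => intro E; rw [addConsts, ih]; simp [Table.add]; omega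

theorem meaningful_constTable (h : checkConsts ⟨.leaf, 0⟩ constants = true) : constTable.Meaningful :=
  ⟨by rw [constTable, size_addConsts]; simp, Model.Good.checkConsts (ds := []) rfl rfl .empty h⟩

end HoTT

/-! ### Raising the universe levels of a derivation -/

namespace HoTT

open Tm

/-! ### Universe levels -/

/-- Raise all universe levels by `s`. -/
def Cst.shift (s : ℕ) : Cst → Cst
  | sig i => sig (i + s) | pair i => pair (i + s) | sigElim i k => sigElim (i + s) (k + s)
  | sum i => sum (i + s) | inl i => inl (i + s) | inr i => inr (i + s)
  | sumElim i k => sumElim (i + s) (k + s)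
  | emptyElim k => emptyElim (k + s) | oneElim k => oneElim (k + s) | natElim k => natElim (k + s)
  | list i => list (i + s) | nil i => nil (i + s) | cons i => cons (i + s)
  | listElim i k => listElim (i + s) (k + s)
  | eq i => eq (i + s) | refl i => refl (i + s) | eqElim i k => eqElim (i + s) (k + s)
  | funext i => funext (i + s) | ua i => ua (i + s)
  | tr n i => tr n (i + s) | trIn n i => trIn n (i + s) | trLevel n i => trLevel n (i + s)
  | trElim n i k => trElim n (i + s) (k + s)
  | quo i => quo (i + s) | quoIn i => quoIn (i + s) | quoEq i => quoEq (i + s)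
  | quoSet i => quoSet (i + s) | quoElim i k => quoElim (i + s) (k + s)
  | free i => free (i + s) | fUnit i => fUnit (i + s) | fCons i => fCons (i + s)
  | fIcons i => fIcons (i + s) | fMu1 i => fMu1 (i + s) | fMu2 i => fMu2 (i + s) | fMu i => fMu (i + s)
  | fInit i j => fInit (i + s) (j + s)
  | k => k

namespace Tm

def shift (s : ℕ) : Tm → Tm
  | var n => var n
  | univ i => univ (i + s)
  | pi A B => pi (shift s A) (shift s B)
  | lam A b => lam (shift s A) (shift s b)
  | app f a => app (shift s f) (shift s a)
  | cst c => cst (c.shift s)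

theorem shift_rename (s : ℕ) (t : Tm) : ∀ f : ℕ → ℕ, (t.rename f).shift s = (t.shift s).rename f := by
  induction t with
  | var n => intros; rfl
  | univ i => intros; rfl
  | pi A B hA hB => intro f; simp only [rename, shift, hA, hB]
  | lam A B hA hB => intro f; simp only [rename, shift, hA, hB]
  | app A B hA hB => intro f; simp only [rename, shift, hA, hB]
  | cst k => intros; rfl

theorem shift_liftSub (s : ℕ) (σ : ℕ → Tm) : shift s ∘ liftSub σ = liftSub (shift s ∘ σ) := by
  funext n
  cases n with
  | zero => rfl
  | succ n => exact shift_rename ..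

theorem shift_subst (s : ℕ) (t : Tm) : ∀ σ : ℕ → Tm, (t.subst σ).shift s = (t.shift s).subst (shift s ∘ σ) := by
  induction t with
  | var n => intros; rfl
  | univ i => intros; rfl
  | pi A B hA hB => intro f; simp only [subst, shift, hA, hB, shift_liftSub]
  | lam A B hA hB => intro f; simp only [subst, shift, hA, hB, shift_liftSub]
  | app A B hA hB => intro f; simp only [subst, shift, hA, hB]
  | cst k => intros; rfl

theorem shift_inst (s : ℕ) (b a : Tm) : (b.inst a).shift s = (b.shift s).inst (a.shift s) := by
  rw [inst, shift_subst]
  congr 1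
  funext n
  cases n <;> rfl

theorem shift_apps (s : ℕ) (as : List Tm) :
    ∀ f : Tm, (f.apps as).shift s = (f.shift s).apps (as.map (shift s)) := by
  induction as with
  | nil => intro f; rfl
  | cons a as ih => intro f; exact ih (f.app a)

end Tm

theorem Iota.shift (s : ℕ) {t u : Tm} (h : Iota t u) : Iota (t.shift s) (u.shift s) := by
  cases h <;> simp only [shift_apps, List.map, Tm.shift]
  · exact .sig ..
  · exact .inl ..
  · exact .inr ..
  · exact .star ..
  · exact .zero ..
  · exact .succ ..
  · exact .nil ..
  · exact .cons ..
  · exact .refl ..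
  · exact .trIn ..
  · exact .quoIn ..

theorem Conv.shift (s : ℕ) {t u : Tm} (h : Conv t u) : Conv (t.shift s) (u.shift s) := by
  induction h with
  | refl t => exact .refl _
  | symm _ ih => exact ih.symm
  | trans _ _ ih ih' => exact ih.trans ih'
  | pi _ _ ih ih' => exact .pi ih ih'
  | lam _ _ ih ih' => exact .lam ih ih'
  | app _ _ ih ih' => exact .app ih ih'
  | beta A b a => rw [shift_inst]; exact .beta ..
  | eta A f => simp only [Tm.shift, shift_rename]; exact .eta ..
  | iota h => exact .iota (h.shift s)

theorem Exp.shift_isTrunc (s i : ℕ) : ∀ (n : ℕ) (A B : Exp),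
    (∀ m, (A.build m).shift s = B.build m) →
    ∀ m, ((Exp.isTrunc n i A).build m).shift s = (Exp.isTrunc n (i + s) B).build m := by
  intro n
  induction n with
  | zero =>
    intro A B h m
    simp only [Exp.isTrunc, Exp.Pi, Exp.Eq, Exp.c, Tm.shift, h]; rfl
  | succ n ih =>
    intro A B h m
    simp only [Exp.isTrunc, Exp.Pi, Tm.shift, h]
    refine congrArg (fun t => Tm.pi _ (.pi _ t)) (ih _ _ (fun m => ?_) _)
    simp only [Exp.Eq, Exp.c, Tm.shift, h]; rfl

/-- The type of a shifted constant is mostly the shifted type by computation. The exceptions are the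
types `empty`, `one` and `nat`, which stay in the lowest universe and are raised by cumulativity;
`ua` and `fInit`, whose levels are rearranged by arithmetic; and the recursion of `isTrunc`. -/
theorem Cst.hasType_shift (s : ℕ) (k : Cst) (Γ : List Tm) :
    HasType Γ (.cst (k.shift s)) ((k.type.build 0).shift s) := by
  have small {c : Cst} (h : HasType Γ (.cst c) (.univ 0)) : HasType Γ (.cst c) (.univ (0 + s)) :=
    h.cumul_le (Nat.zero_le _)
  have of_eq {T : Tm} (h : ((k.shift s).type.build 0) = T) : HasType Γ (.cst (k.shift s)) T :=
    h ▸ .cst Γ _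
  cases k
  case empty => exact small (.cst Γ .empty)
  case one => exact small (.cst Γ .one)
  case nat => exact small (.cst Γ .nat)
  case ua i =>
    apply of_eq
    have : i + s + 1 = i + 1 + s := by omega
    simp only [Cst.shift, Cst.type, this]
    simp only [Exp.isEquiv, Exp.IdToEquiv, Exp.Equiv, Exp.Pi, Exp.U, this]
    rfl
  case fInit i j =>
    apply of_eq
    have : max (i + s) (j + s) = max i j + s := by omega
    simp only [Cst.shift, Cst.type, Exp.FreeHom, this]
    rfl
  case trLevel n i =>
    exact of_eq (congrArg (Tm.pi _) (Exp.shift_isTrunc s i n _ _ (fun _ => rfl) _).symm)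
  case trElim n i k =>
    exact of_eq (congrArg (fun t => Tm.pi _ (.pi _ (.pi (.pi _ t) _)))
      (Exp.shift_isTrunc s k n _ _ (fun _ => rfl) _).symm)
  all_goals exact of_eq rfl

theorem HasType.shift (s : ℕ) {Γ : List Tm} {t T : Tm} (h : HasType Γ t T) :
    HasType (Γ.map (Tm.shift s)) (t.shift s) (T.shift s) := by
  have succ (i : ℕ) : i + 1 + s = i + s + 1 := by omega
  induction h with
  | @var Γ n A h =>
    rw [shift_rename]
    exact .var (by rw [List.getElem?_map, h]; rfl)
  | univ Γ i => simp only [Tm.shift, succ]; exact .univ ..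
  | cumul _ ih => simp only [Tm.shift, succ] at ih ⊢; exact .cumul ih
  | pi _ _ ih ih' => exact .pi ih ih'
  | lam _ _ ih ih' => exact .lam ih ih'
  | app _ _ ih ih' => rw [shift_inst]; exact .app ih ih'
  | cst Γ k => exact k.hasType_shift s _
  | conv _ h _ ih ih' => exact .conv ih (h.shift s) ih'

theorem provable_of_zero (i : ℕ) (T : ℕ → Exp)
    (hT : ∀ j, ((T j).build 0).shift i = (T (j + i)).build 0) (h : Provable (T 0)) : Provable (T i) := by
  obtain ⟨t, ht⟩ := h
  have := ht.shift i
  rw [hT, Nat.zero_add] at this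
  exact ⟨_, this⟩

end HoTT

/-! ### Internal proofs: path algebra and equivalences -/

namespace HoTT

namespace Internal

open Src

noncomputable section

/-! ### Paths -/

def eq (x y : Src) : Src := c (.eq 0) x y

infix:50 " ≐ " => eq

def refl (x : Src) : Src := c (.refl 0) x

/-- Path induction. -/
def J (P d p : Src) : Src := c (.eqElim 0 0) P d p

/-- The number is the position among all internal declarations, through the successive lists
`pathDecls`, `setDecls` and so on. These names are not trusted: the checker looks at the resulting
entries. -/
def sym : Src := entry 0

def symDecl : Decl := given (U 0) fun A => given A fun x => given A fun y => all (x ≐ y) fun p =>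
  defn (y ≐ x) (J (fn2 fun y _ => y ≐ x) (refl x) p)

def trans : Src := entry 1

/-- Induction on the second path makes composition with `refl` on the right compute; only the left
unit law needs a proof. -/
def transDecl : Decl := given (U 0) fun A => given A fun x => given A fun y => given A fun z =>
  all (x ≐ y) fun p => all (y ≐ z) fun q => defn (x ≐ z) (J (fn2 fun z _ => x ≐ z) p q)

infixl:60 " ⬝ " => fun p q : Src => trans p q

def ap : Src := entry 2

def apDecl : Decl := given (U 0) fun A => given (U 0) fun B => all (A ⇒ B) fun f => given A fun x => given A fun y =>
  all (x ≐ y) fun p => defn (f x ≐ f y) (J (fn2 fun y _ => f x ≐ f y) (refl (f x)) p)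

def transport : Src := entry 3

def transportDecl : Decl := given (U 0) fun A => all (A ⇒ U 0) fun P => given A fun x => given A fun y =>
  all (x ≐ y) fun p => all (P x) fun u => defn (P y) (J (fn2 fun y _ => P y) u p)

def assoc : Src := entry 4

def assocDecl : Decl := given (U 0) fun A => given A fun x => given A fun y => given A fun z => given A fun w =>
  all (x ≐ y) fun p => all (y ≐ z) fun q => all (z ≐ w) fun r =>
  thm (p ⬝ q ⬝ r ≐ p ⬝ (q ⬝ r)) (J (fn2 fun _ r => p ⬝ q ⬝ r ≐ p ⬝ (q ⬝ r)) (refl (p ⬝ q)) r)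

def reflTrans : Src := entry 5

def reflTransDecl : Decl := given (U 0) fun A => given A fun x => given A fun y => all (x ≐ y) fun p =>
  thm (refl x ⬝ p ≐ p) (J (fn2 fun _ p => refl x ⬝ p ≐ p) (refl (refl x)) p)

def symTrans : Src := entry 6

def symTransDecl : Decl := given (U 0) fun A => given A fun x => given A fun y => all (x ≐ y) fun p =>
  thm (sym p ⬝ p ≐ refl y) (J (fn2 fun y p => sym p ⬝ p ≐ refl y) (refl (refl x)) p)

def apTrans : Src := entry 7

def apTransDecl : Decl := given (U 0) fun A => given (U 0) fun B => all (A ⇒ B) fun f =>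
  given A fun x => given A fun y => given A fun z => all (x ≐ y) fun p => all (y ≐ z) fun q =>
  thm (ap f (p ⬝ q) ≐ ap f p ⬝ ap f q)
    (J (fn2 fun _ q => ap f (p ⬝ q) ≐ ap f p ⬝ ap f q) (refl (ap f p)) q)

def whiskerL : Src := entry 8

def whiskerLDecl : Decl := given (U 0) fun A => given A fun x => given A fun y => given A fun z =>
  all (x ≐ y) fun p => given (y ≐ z) fun q => given (y ≐ z) fun q' => all (q ≐ q') fun e =>
  thm (p ⬝ q ≐ p ⬝ q') (ap (fn fun q => p ⬝ q) e)

def whiskerR : Src := entry 9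

def whiskerRDecl : Decl := given (U 0) fun A => given A fun x => given A fun y => given A fun z =>
  given (x ≐ y) fun p => given (x ≐ y) fun p' => all (p ≐ p') fun e => all (y ≐ z) fun q =>
  thm (p ⬝ q ≐ p' ⬝ q) (ap (fn fun p => p ⬝ q) e)

def apCong : Src := entry 10

def apCongDecl : Decl := given (U 0) fun A => given (U 0) fun B => all (A ⇒ B) fun f => given A fun x => given A fun y =>
  given (x ≐ y) fun p => given (x ≐ y) fun q => all (p ≐ q) fun e =>
  thm (ap f p ≐ ap f q) (ap (fn fun p => ap f p) e)

/-- Naturality of a homotopy from `g ∘ f` to the identity. -/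
def naturality : Src := entry 11

def naturalityDecl : Decl := given (U 0) fun A => given (U 0) fun B => all (A ⇒ B) fun f => all (B ⇒ A) fun g =>
  all (Pi A fun x => g (f x) ≐ x) fun h => given A fun x => given A fun y => all (x ≐ y) fun p =>
  thm (ap g (ap f p) ⬝ h y ≐ h x ⬝ p)
    (J (fn2 fun y p => ap g (ap f p) ⬝ h y ≐ h x ⬝ p) (reflTrans (h x)) p)

def cancelR : Src := entry 12

def cancelRDecl : Decl := given (U 0) fun A => given A fun x => given A fun y => given A fun z =>
  given (x ≐ y) fun p => given (x ≐ y) fun q => all (y ≐ z) fun r => all (p ⬝ r ≐ q ⬝ r) fun e =>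
  thm (p ≐ q) (J (fn2 fun _ r => p ⬝ r ≐ q ⬝ r ⇒ p ≐ q) (fn fun e => e) r e)

def moveL : Src := entry 13

def moveLDecl : Decl := given (U 0) fun A => given A fun x => given A fun y => given A fun z =>
  all (x ≐ y) fun r => given (y ≐ z) fun p => given (x ≐ z) fun q => all (r ⬝ p ≐ q) fun e =>
  thm (p ≐ sym r ⬝ q)
    (J (fn2 fun y r => Pi (y ≐ z) fun p => r ⬝ p ≐ q ⇒ p ≐ sym r ⬝ q)
      (fn2 fun p e => sym (reflTrans p) ⬝ e ⬝ sym (reflTrans q)) r p e)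

def symMove : Src := entry 14

def symMoveDecl : Decl := given (U 0) fun A => given A fun x => given A fun y => given A fun z =>
  given (x ≐ y) fun p => given (y ≐ z) fun q => given (x ≐ z) fun r => all (r ≐ p ⬝ q) fun e =>
  thm (sym r ⬝ p ≐ sym q)
    (J (fn2 fun r _ => sym r ⬝ p ≐ sym q)
      (J (fn2 fun _ q => sym (p ⬝ q) ⬝ p ≐ sym q) (symTrans p) q) (sym e))

/-! ### Pairs and equivalences -/

def Sig (A : Src) (B : Src → Src) : Src := c (.sig 0) A (fn B)

def pair (a b : Src) : Src := c (.pair 0) a b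

def fst : Src := entry 15

def fstDecl : Decl := given (U 0) fun A => given (A ⇒ U 0) fun B => all (c (.sig 0) A B) fun p =>
  defn A (c (.sigElim 0 0) (fn fun _ => A) (fn2 fun a _ => a) p)

def snd : Src := entry 16

def sndDecl : Decl := given (U 0) fun A => given (A ⇒ U 0) fun B => all (c (.sig 0) A B) fun p =>
  defn (B (fst p)) (c (.sigElim 0 0) (fn fun p => B (fst p)) (fn2 fun _ b => b) p)

def EquivCoh : Src := entry 17

def EquivCohDecl : Decl := given (U 0) fun A => given (U 0) fun B => all (A ⇒ B) fun f => all (B ⇒ A) fun g =>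
  all (Pi A fun x => g (f x) ≐ x) fun η => all (Pi B fun y => f (g y) ≐ y) fun ε =>
  defn (U 0) (Pi A fun x => ap f (η x) ≐ ε (f x))

def EquivEps : Src := entry 18

def EquivEpsDecl : Decl := given (U 0) fun A => given (U 0) fun B => all (A ⇒ B) fun f => all (B ⇒ A) fun g =>
  all (Pi A fun x => g (f x) ≐ x) fun η =>
  defn (U 0) (Sig (Pi B fun y => f (g y) ≐ y) fun ε => EquivCoh f g η ε)

def EquivEta : Src := entry 19

def EquivEtaDecl : Decl := given (U 0) fun A => given (U 0) fun B => all (A ⇒ B) fun f => all (B ⇒ A) fun g =>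
  defn (U 0) (Sig (Pi A fun x => g (f x) ≐ x) fun η => EquivEps f g η)

def isEquiv : Src := entry 20

def isEquivDecl : Decl := all (U 0) fun A => all (U 0) fun B => all (A ⇒ B) fun f =>
  defn (U 0) (Sig (B ⇒ A) fun g => EquivEta f g)

def equivInv : Src := entry 21

def equivInvDecl : Decl := given (U 0) fun A => given (U 0) fun B => given (A ⇒ B) fun f => all (isEquiv A B f) fun e =>
  defn (B ⇒ A) (fst e)

def equivEta : Src := entry 22

def equivEtaDecl : Decl := given (U 0) fun A => given (U 0) fun B => given (A ⇒ B) fun f => all (isEquiv A B f) fun e =>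
  defn (Pi A fun x => equivInv e (f x) ≐ x) (fst (snd e))

def equivEps : Src := entry 23

def equivEpsDecl : Decl := given (U 0) fun A => given (U 0) fun B => given (A ⇒ B) fun f => all (isEquiv A B f) fun e =>
  defn (Pi B fun y => f (equivInv e y) ≐ y) (fst (snd (snd e)))

def equivCoh : Src := entry 24

def equivCohDecl : Decl := given (U 0) fun A => given (U 0) fun B => given (A ⇒ B) fun f => all (isEquiv A B f) fun e =>
  defn (Pi A fun x => ap f (equivEta e x) ≐ equivEps e (f x)) (snd (snd (snd e)))

/-- For a homotopy `η` from `g ∘ f` to the identity. -/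
def etaNat : Src := entry 25

def etaNatDecl : Decl := given (U 0) fun A => given (U 0) fun B => all (A ⇒ B) fun f => all (B ⇒ A) fun g =>
  all (Pi A fun x => g (f x) ≐ x) fun η => all A fun x =>
  thm (ap g (ap f (η x)) ≐ η (g (f x))) (cancelR (η x) (naturality f g η (η x)))

def adjointEps : Src := entry 26

/-- The usual correction of ε, chosen so that its triangle with the unchanged η follows from
naturality. -/
def adjointEpsDecl : Decl := given (U 0) fun A => given (U 0) fun B => all (A ⇒ B) fun f => all (B ⇒ A) fun g =>
  all (Pi A fun x => g (f x) ≐ x) fun η => all (Pi B fun y => f (g y) ≐ y) fun ε => all B fun y =>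
  defn (f (g y) ≐ y) (sym (ε (f (g y))) ⬝ (ap f (η (g y)) ⬝ ε y))

def adjointCoh : Src := entry 27

/-- Naturality of ε along `ap f (η x)`, combined with the fact that η commutes with g ∘ f; then ε is
moved to the other side. -/
def adjointCohDecl : Decl := given (U 0) fun A => given (U 0) fun B => all (A ⇒ B) fun f => all (B ⇒ A) fun g =>
  all (Pi A fun x => g (f x) ≐ x) fun η => all (Pi B fun y => f (g y) ≐ y) fun ε => all A fun x =>
  thm (ap f (η x) ≐ adjointEps f g η ε (f x))
    (moveL (ε (f (g (f x))))
      (sym (naturality g f ε (ap f (η x))) ⬝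
        whiskerR (apCong f (etaNat f g η x)) (ε (f x))))

/-- A map with an inverse is an equivalence. -/
def adjointify : Src := entry 28

def adjointifyDecl : Decl := given (U 0) fun A => given (U 0) fun B => all (A ⇒ B) fun f => all (B ⇒ A) fun g =>
  all (Pi A fun x => g (f x) ≐ x) fun η => all (Pi B fun y => f (g y) ≐ y) fun ε =>
  defn (isEquiv A B f) (pair g (pair η (pair (adjointEps f g η ε) (adjointCoh f g η ε))))

/-- The dual coherence of a half-adjoint equivalence. -/
def dualCoh : Src := entry 29

/-- Transport along ε reduces the claim from y to f (g y), where τ replaces ε by `ap f` of η and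
naturality of η finishes. -/
def dualCohDecl : Decl := given (U 0) fun A => given (U 0) fun B => all (A ⇒ B) fun f => all (B ⇒ A) fun g =>
  all (Pi A fun x => g (f x) ≐ x) fun η => all (Pi B fun y => f (g y) ≐ y) fun ε =>
  all (Pi A fun x => ap f (η x) ≐ ε (f x)) fun τ => all B fun y =>
  thm (ap g (ε y) ≐ η (g y))
    (transport (fn fun y => ap g (ε y) ≐ η (g y)) (ε y)
      (apCong g (sym (τ (g y))) ⬝ etaNat f g η (g y)))

def pathDecls : List Decl :=
  [symDecl, transDecl, apDecl, transportDecl, assocDecl, reflTransDecl, symTransDecl, apTransDecl,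
    whiskerLDecl, whiskerRDecl, apCongDecl, naturalityDecl, cancelRDecl, moveLDecl, symMoveDecl,
    fstDecl, sndDecl, EquivCohDecl, EquivEpsDecl, EquivEtaDecl, isEquivDecl, equivInvDecl,
    equivEtaDecl, equivEpsDecl, equivCohDecl, etaNatDecl, adjointEpsDecl, adjointCohDecl,
    adjointifyDecl, dualCohDecl]

def pathTable : Table := extend constTable pathDecls

end

end Internal
end HoTT

/-! ### Internal proofs: propositions, sets and Hedberg's argument -/

namespace HoTT

namespace Internal

open Src

noncomputable section

/-! ### Propositions and sets -/

/-- A constant with all arguments explicit. -/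
def full (k : Cst) : Src := ⟨fun _ => .full (constIndex k)⟩

def isProp : Src := entry 30

def isPropDecl : Decl := all (U 0) fun A => defn (U 0) (Pi A fun x => Pi A fun y => x ≐ y)

def isSet : Src := entry 31

def isSetDecl : Decl := all (U 0) fun A => defn (U 0) (Pi A fun x => Pi A fun y => isProp (x ≐ y))

/-- `1`-types. -/
def isGpd : Src := entry 32

def isGpdDecl : Decl := all (U 0) fun A => defn (U 0) (Pi A fun x => Pi A fun y => isSet (x ≐ y))

def hedbergPath : Src := entry 33

/-- A path p is recovered from the transport of r along it, by path induction. If R takes values in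
propositions, that transport carries no information, so all parallel paths agree; this is `hedberg`.
-/
def hedbergPathDecl : Decl := given (U 0) fun A => all A fun x => all (A ⇒ U 0) fun R => all (R x) fun r =>
  all (Pi A fun y => R y ⇒ x ≐ y) fun d => given A fun y => all (x ≐ y) fun p =>
  thm (p ≐ sym (d x r) ⬝ d y (transport R p r))
    (J (fn2 fun y p => p ≐ sym (d x r) ⬝ d y (transport R p r)) (sym (symTrans (d x r))) p)

def hedbergCong : Src := entry 34

def hedbergCongDecl : Decl := given (U 0) fun A => all A fun x => all (A ⇒ U 0) fun R => all (R x) fun r =>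
  all (Pi A fun y => R y ⇒ x ≐ y) fun d => all A fun y => given (R y) fun u => given (R y) fun v =>
  all (u ≐ v) fun e =>
  thm (sym (d x r) ⬝ d y u ≐ sym (d x r) ⬝ d y v) (ap (fn fun u => sym (d x r) ⬝ d y u) e)

/-- The identity types at `x` are propositions if they are implied by a reflexive family of
propositions. -/
def hedberg : Src := entry 35

def hedbergDecl : Decl := given (U 0) fun A => all A fun x => all (A ⇒ U 0) fun R =>
  all (Pi A fun y => isProp (R y)) fun hR => all (R x) fun r => all (Pi A fun y => R y ⇒ x ≐ y) fun d =>
  thm (Pi A fun y => isProp (x ≐ y))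
    (fn3 fun y p q => hedbergPath x R r d p ⬝
      hedbergCong x R r d y (hR y (transport R p r) (transport R q r)) ⬝ sym (hedbergPath x R r d q))

def propSet : Src := entry 36

def propSetDecl : Decl := given (U 0) fun A => all (isProp A) fun h =>
  thm (isSet A) (fn fun x => hedberg x (fn fun _ => A) (fn fun _ => h) x (fn2 fun y _ => h x y))

def setGpd : Src := entry 37

def setGpdDecl : Decl := given (U 0) fun A => all (isSet A) fun h =>
  thm (isGpd A) (fn2 fun x y => propSet (h x y))

def funextFn : Src := entry 38

def funextFnDecl : Decl := given (U 0) fun A => given (A ⇒ U 0) fun B => given (Pi A fun x => B x) fun f =>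
  given (Pi A fun x => B x) fun g => all (Pi A fun x => f x ≐ g x) fun h =>
  thm (f ≐ g) (fst (full (.funext 0) A B f g) h)

def isPropPi : Src := entry 39

def isPropPiDecl : Decl := given (U 0) fun A => given (A ⇒ U 0) fun B => all (Pi A fun x => isProp (B x)) fun h =>
  thm (isProp (Pi A fun x => B x)) (fn2 fun f g => funextFn (fn fun x => h x (f x) (g x)))

def isSetPi : Src := entry 40

def isSetPiDecl : Decl := given (U 0) fun A => given (A ⇒ U 0) fun B => all (Pi A fun x => isSet (B x)) fun h =>
  thm (isSet (Pi A fun x => B x))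
    (fn fun f => hedberg f (fn fun g => Pi A fun x => f x ≐ g x)
      (fn fun g => isPropPi (fn fun x => h x (f x) (g x))) (fn fun x => refl (f x))
      (fn2 fun _ e => funextFn e))

def isPropIsProp : Src := entry 41

def isPropIsPropDecl : Decl := all (U 0) fun A =>
  thm (isProp (isProp A))
    (fn2 fun h k => funextFn (fn fun x => funextFn (fn fun y => propSet h x y (h x y) (k x y))))

def pairPath : Src := entry 42

def pairPathDecl : Decl := given (U 0) fun A => given (A ⇒ U 0) fun B => all (Pi A fun x => isProp (B x)) fun h =>
  given A fun x => given A fun y => all (x ≐ y) fun p => all (B x) fun b => all (B y) fun b' =>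
  thm (full (.pair 0) A B x b ≐ full (.pair 0) A B y b')
    (J (fn2 fun y _ => Pi (B y) fun b' => full (.pair 0) A B x b ≐ full (.pair 0) A B y b')
      (fn fun b' => ap (fn fun b => full (.pair 0) A B x b) (h x b b')) p b')

def subtypePath : Src := entry 43

def subtypePathDecl : Decl := given (U 0) fun A => given (A ⇒ U 0) fun B => all (Pi A fun x => isProp (B x)) fun h =>
  all (c (.sig 0) A B) fun u => all (c (.sig 0) A B) fun v => all (fst u ≐ fst v) fun p =>
  thm (u ≐ v)
    (c (.sigElim 0 0) (fn fun u => Pi (c (.sig 0) A B) fun v => fst u ≐ fst v ⇒ u ≐ v)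
      (fn3 fun x b v => c (.sigElim 0 0)
        (fn fun v => x ≐ fst v ⇒ full (.pair 0) A B x b ≐ v)
        (fn3 fun _ b' p => pairPath h p b b') v) u v p)

def isPropSig : Src := entry 44

def isPropSigDecl : Decl := given (U 0) fun A => given (A ⇒ U 0) fun B => all (Pi A fun x => isProp (B x)) fun h =>
  all (Pi (c (.sig 0) A B) fun u => Pi (c (.sig 0) A B) fun v => fst u ≐ fst v) fun k =>
  thm (isProp (c (.sig 0) A B)) (fn2 fun u v => subtypePath h u v (k u v))

def isSetSig : Src := entry 45

def isSetSigDecl : Decl := given (U 0) fun A => given (A ⇒ U 0) fun B => all (isSet A) fun hA =>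
  all (Pi A fun x => isProp (B x)) fun h =>
  thm (isSet (c (.sig 0) A B))
    (fn fun u => hedberg u (fn fun v => fst u ≐ fst v) (fn fun v => hA (fst u) (fst v))
      (refl (fst u)) (fn2 fun v p => subtypePath h u v p))

/-- A map from a propositional truncation to a proposition. -/
def trRec : Src := entry 46

def trRecDecl : Decl := given (U 0) fun A => given (U 0) fun B => all (isProp B) fun h => all (A ⇒ B) fun f =>
  all (c (.tr 0 0) A) fun x =>
  thm B (c (.trElim 0 0 0) (fn fun _ => B) (fn fun _ => h) f x)

def constFam : Src := entry 47

/-- Recursion into a fixed type goes through the dependent eliminator, whose path clause transports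
in this family; `transConst` removes that transport. -/
def constFamDecl : Decl := all (U 0) fun A => all (U 0) fun B => defn (A ⇒ U 0) (fn fun _ => B)

def transConst : Src := entry 48

def transConstDecl : Decl := given (U 0) fun A => all (U 0) fun B => given A fun x => given A fun y =>
  all (x ≐ y) fun p => all B fun u =>
  thm (transport (constFam A B) p u ≐ u)
    (J (fn2 fun _ p => transport (constFam A B) p u ≐ u) (refl u) p)

def absurd (P x : Src) : Src := c (.emptyElim 0) P x

def isPropEmpty : Src := entry 49

def isPropEmptyDecl : Decl := thm (isProp (c .empty)) (fn2 fun x y => absurd (fn fun x => x ≐ y) x)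

/-! ### Signed letters -/

def Signed (A : Src) : Src := c (.sum 0) A A

def inl (A a : Src) : Src := full (.inl 0) A A a

def inr (A a : Src) : Src := full (.inr 0) A A a

def sumCase (P d e s : Src) : Src := c (.sumElim 0 0) P d e s

def sumFam (d e s : Src) : Src := c (.sumElim 0 1) (fn fun _ => U 0) d e s

def sameSign : Src := entry 50

/-- Observational equality on A + A: equal signs with equal letters. It is the reflexive family of
propositions to which `hedberg` is applied in `isSetSigned`. -/
def sameSignDecl : Decl := given (U 0) fun A => all (Signed A) fun s => all (Signed A) fun t =>
  defn (U 0) (sumFam (fn fun a => sumFam (fn fun b => a ≐ b) (fn fun _ => c .empty) t)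
    (fn fun a => sumFam (fn fun _ => c .empty) (fn fun b => a ≐ b) t) s)

def isSetSigned : Src := entry 51

def isSetSignedDecl : Decl := given (U 0) fun A => all (isSet A) fun h =>
  thm (isSet (Signed A))
    (fn fun s => sumCase (fn fun s => Pi (Signed A) fun t => isProp (s ≐ t))
      (fn fun a => hedberg (inl A a) (fn fun t => sameSign (inl A a) t)
        (fn fun t => sumCase (fn fun t => isProp (sameSign (inl A a) t))
          (fn fun b => h a b) (fn fun _ => isPropEmpty) t)
        (refl a)
        (fn fun t => sumCase (fn fun t => sameSign (inl A a) t ⇒ inl A a ≐ t)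
          (fn2 fun _ p => ap (fn fun a => inl A a) p)
          (fn2 fun b p => absurd (fn fun _ => inl A a ≐ inr A b) p) t))
      (fn fun a => hedberg (inr A a) (fn fun t => sameSign (inr A a) t)
        (fn fun t => sumCase (fn fun t => isProp (sameSign (inr A a) t))
          (fn fun _ => isPropEmpty) (fn fun b => h a b) t)
        (refl a)
        (fn fun t => sumCase (fn fun t => sameSign (inr A a) t ⇒ inr A a ≐ t)
          (fn2 fun b p => absurd (fn fun _ => inr A a ≐ inl A b) p)
          (fn2 fun _ p => ap (fn fun a => inr A a) p) t)) s)

def setDecls : List Decl :=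
  [isPropDecl, isSetDecl, isGpdDecl, hedbergPathDecl, hedbergCongDecl, hedbergDecl, propSetDecl,
    setGpdDecl, funextFnDecl, isPropPiDecl, isSetPiDecl, isPropIsPropDecl, pairPathDecl,
    subtypePathDecl, isPropSigDecl, isSetSigDecl, trRecDecl, constFamDecl, transConstDecl,
    isPropEmptyDecl, sameSignDecl, isSetSignedDecl]

def setTable : Table := extend pathTable setDecls

end

end Internal
end HoTT

/-! ### Internal proofs: words in an algebra and local confluence -/

namespace HoTT

namespace Internal

open Src

noncomputable section

/-! ### Algebras -/

def Sig1 (A : Src) (B : Src → Src) : Src := c (.sig 1) A (fn B)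

def fst1 : Src := entry 52

def fst1Decl : Decl := given (U 1) fun A => given (A ⇒ U 1) fun B => all (c (.sig 1) A B) fun p =>
  defn A (c (.sigElim 1 1) (fn fun _ => A) (fn2 fun a _ => a) p)

def snd1 : Src := entry 53

def snd1Decl : Decl := given (U 1) fun A => given (A ⇒ U 1) fun B => all (c (.sig 1) A B) fun p =>
  defn (B (fst1 p)) (c (.sigElim 1 1) (fn fun p => B (fst1 p)) (fn2 fun _ b => b) p)

def ActData : Src := entry 54

def ActDataDecl : Decl := all (U 0) fun A => all (U 0) fun X =>
  defn (U 1) (Sig1 (A ⇒ X ⇒ X) fun f => Pi A fun a => isEquiv X X (f a))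

def PointData : Src := entry 55

def PointDataDecl : Decl := all (U 0) fun A => all (U 0) fun X => defn (U 1) (Sig1 X fun _ => ActData A X)

def CarData : Src := entry 56

def CarDataDecl : Decl := all (U 0) fun A => defn (U 1) (Sig1 (U 0) fun X => PointData A X)

def GenData : Src := entry 57

def GenDataDecl : Decl := all (U 0) fun A => defn (U 1) (Sig1 (isSet A) fun _ => CarData A)

/-- Types with a point and a family of equivalences that is indexed by a set. -/
def Alg : Src := entry 58

def AlgDecl : Decl := defn (U 1) (Sig1 (U 0) fun A => GenData A)

def gen : Src := entry 59

def genDecl : Decl := all Alg fun X => defn (U 0) (fst1 X)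

def genData : Src := entry 60

def genDataDecl : Decl := all Alg fun X => defn (GenData (gen X)) (snd1 X)

def isSetGen : Src := entry 61

def isSetGenDecl : Decl := all Alg fun X => defn (isSet (gen X)) (fst1 (genData X))

def carData : Src := entry 62

def carDataDecl : Decl := all Alg fun X => defn (CarData (gen X)) (snd1 (genData X))

def car : Src := entry 63

def carDecl : Decl := all Alg fun X => defn (U 0) (fst1 (carData X))

def pointData : Src := entry 64

def pointDataDecl : Decl := all Alg fun X => defn (PointData (gen X) (car X)) (snd1 (carData X))

def unit : Src := entry 65

def unitDecl : Decl := all Alg fun X => defn (car X) (fst1 (pointData X))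

def actData : Src := entry 66

def actDataDecl : Decl := all Alg fun X => defn (ActData (gen X) (car X)) (snd1 (pointData X))

def gact : Src := entry 67

def gactDecl : Decl := all Alg fun X => defn (gen X ⇒ car X ⇒ car X) (fst1 (actData X))

def gequ : Src := entry 68

def gequDecl : Decl := all Alg fun X => defn (Pi (gen X) fun a => isEquiv (car X) (car X) (gact X a))
  (snd1 (actData X))

def ginv : Src := entry 69

def ginvDecl : Decl := all Alg fun X => all (gen X) fun a => defn (car X ⇒ car X) (equivInv (gequ X a))

def geta : Src := entry 70

def getaDecl : Decl := all Alg fun X => all (gen X) fun a =>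
  defn (Pi (car X) fun x => ginv X a (gact X a x) ≐ x) (equivEta (gequ X a))

def geps : Src := entry 71

def gepsDecl : Decl := all Alg fun X => all (gen X) fun a =>
  defn (Pi (car X) fun x => gact X a (ginv X a x) ≐ x) (equivEps (gequ X a))

def gtau : Src := entry 72

def gtauDecl : Decl := all Alg fun X => all (gen X) fun a =>
  defn (Pi (car X) fun x => ap (gact X a) (geta X a x) ≐ geps X a (gact X a x)) (equivCoh (gequ X a))

/-! ### Words -/

def Word (A : Src) : Src := c (.list 0) (Signed A)

def nil (A : Src) : Src := full (.nil 0) (Signed A)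

def cons (s w : Src) : Src := c (.cons 0) s w

def listCase (P d e w : Src) : Src := c (.listElim 0 0) P d e w

def listFam (d e w : Src) : Src := c (.listElim 0 1) (fn fun _ => U 0) d e w

def inv : Src := entry 73

def invDecl : Decl := given (U 0) fun A => all (Signed A) fun s =>
  defn (Signed A) (sumCase (fn fun _ => Signed A) (fn fun a => inr A a) (fn fun a => inl A a) s)

def act : Src := entry 74

def actDecl : Decl := all Alg fun X => all (Signed (gen X)) fun s => all (car X) fun x => defn (car X)
  (sumCase (fn fun _ => car X ⇒ car X) (fn fun a => gact X a) (fn fun a => ginv X a) s x)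

def rho : Src := entry 75

/-- For a positive letter this is ε of the equivalence, for a negative one η; `rhoInv` exchanges the
two. -/
def rhoDecl : Decl := all Alg fun X => all (Signed (gen X)) fun s => all (car X) fun x =>
  defn (act X s (act X (inv s) x) ≐ x)
    (sumCase (fn fun s => Pi (car X) fun x => act X s (act X (inv s) x) ≐ x)
      (fn2 fun a x => geps X a x) (fn2 fun a x => geta X a x) s x)

def rhoInv : Src := entry 76

def rhoInvDecl : Decl := all Alg fun X => all (Signed (gen X)) fun s => all (car X) fun x =>
  defn (act X (inv s) (act X s x) ≐ x)
    (sumCase (fn fun s => Pi (car X) fun x => act X (inv s) (act X s x) ≐ x)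
      (fn2 fun a x => geta X a x) (fn2 fun a x => geps X a x) s x)

def rhoCoh : Src := entry 77

/-- One triangle law for both signs: positive letters use τ itself, negative letters its dual
`dualCoh`. -/
def rhoCohDecl : Decl := all Alg fun X => all (Signed (gen X)) fun s => all (car X) fun x =>
  thm (ap (act X s) (rhoInv X s x) ≐ rho X s (act X s x))
    (sumCase (fn fun s => Pi (car X) fun x => ap (act X s) (rhoInv X s x) ≐ rho X s (act X s x))
      (fn2 fun a x => gtau X a x)
      (fn2 fun a x => dualCoh (gact X a) (ginv X a) (geta X a) (geps X a) (gtau X a) x) s x)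

def val : Src := entry 78

def valDecl : Decl := all Alg fun X => all (Word (gen X)) fun w =>
  defn (car X) (listCase (fn fun _ => car X) (unit X) (fn3 fun s _ x => act X s x) w)

/-! ### Reduction of words -/

/-- The word `w` starts with the inverse of `s`. -/
def starts : Src := entry 79

def startsDecl : Decl := given (U 0) fun A => all (Signed A) fun s => all (Word A) fun w =>
  defn (U 0) (listFam (c .empty) (fn3 fun t _ _ => inv s ≐ t) w)

/-- The redexes of a word. -/
def Redex : Src := entry 80

def RedexDecl : Decl := given (U 0) fun A => all (Word A) fun w =>
  defn (U 0) (listFam (c .empty) (fn3 fun s w R => c (.sum 0) (starts s w) R) w)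

def tail : Src := entry 81

def tailDecl : Decl := given (U 0) fun A => all (Word A) fun w =>
  defn (Word A) (listCase (fn fun _ => Word A) (nil A) (fn3 fun _ w _ => w) w)

def delCons : Src := entry 82

def delConsDecl : Decl := given (U 0) fun A => all (Signed A) fun s => all (Word A) fun w =>
  all (Redex w ⇒ Word A) fun d => all (c (.sum 0) (starts s w) (Redex w)) fun r =>
  defn (Word A) (sumCase (fn fun _ => Word A) (fn fun _ => tail w) (fn fun r => cons s (d r)) r)

/-- The word without a given redex. -/
def del : Src := entry 83

def delDecl : Decl := given (U 0) fun A => all (Word A) fun w => defn (Redex w ⇒ Word A)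
  (listCase (fn fun w => Redex w ⇒ Word A) (fn fun r => absurd (fn fun _ => Word A) r)
    (fn3 fun s w d => delCons s w d) w)

def headRedex : Src := entry 84

def headRedexDecl : Decl := given (U 0) fun A => all (Signed A) fun s => all (Word A) fun w => all (starts s w) fun h =>
  defn (Redex (cons s w)) (c (.inl 0) h)

def tailRedex : Src := entry 85

def tailRedexDecl : Decl := given (U 0) fun A => all (Signed A) fun s => all (Word A) fun w => all (Redex w) fun r =>
  defn (Redex (cons s w)) (c (.inr 0) r)

def stepHead : Src := entry 86

/-- Path induction makes the second letter literally s⁻¹; the path is then the cancellation `rho`.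
-/
def stepHeadDecl : Decl := all Alg fun X => all (Signed (gen X)) fun s => all (Word (gen X)) fun w =>
  defn (starts s w ⇒ act X s (val X w) ≐ val X (tail w))
    (listCase (fn fun w => starts s w ⇒ act X s (val X w) ≐ val X (tail w))
      (fn fun h => absurd (fn fun _ => act X s (val X (nil (gen X))) ≐ val X (nil (gen X))) h)
      (fn4 fun _ w _ h =>
        J (fn2 fun t _ => act X s (act X t (val X w)) ≐ val X w) (rho X s (val X w)) h) w)

def stepCons : Src := entry 87

def stepConsDecl : Decl := all Alg fun X => all (Signed (gen X)) fun s => all (Word (gen X)) fun w =>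
  all (Pi (Redex w) fun r => val X w ≐ val X (del w r)) fun d => all (Redex (cons s w)) fun r =>
  defn (val X (cons s w) ≐ val X (del (cons s w) r))
    (sumCase (fn fun r => val X (cons s w) ≐ val X (del (cons s w) r))
      (fn fun h => stepHead X s w h) (fn fun r => ap (act X s) (d r)) r)

/-- The effect of removing a redex on the value of a word. -/
def stepPath : Src := entry 88

def stepPathDecl : Decl := all Alg fun X => all (Word (gen X)) fun w =>
  defn (Pi (Redex w) fun r => val X w ≐ val X (del w r))
    (listCase (fn fun w => Pi (Redex w) fun r => val X w ≐ val X (del w r))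
      (fn fun r => absurd (fn fun r => val X (nil (gen X)) ≐ val X (del (nil (gen X)) r)) r)
      (fn3 fun s w d => stepCons X s w d) w)

/-- Words with a path from the value of `w`. -/
def Target : Src := entry 89

/-- Equality of two such pairs says at once that two reductions end in the same word and that their
paths correspond, without transports being written out. -/
def TargetDecl : Decl := all Alg fun X => all (Word (gen X)) fun w =>
  defn (U 0) (Sig (Word (gen X)) fun z => val X w ≐ val X z)

def target : Src := entry 90

def targetDecl : Decl := all Alg fun X => all (Word (gen X)) fun w => all (Word (gen X)) fun z =>
  all (val X w ≐ val X z) fun p => defn (Target X w) (pair z p)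

def targetPath : Src := entry 91

def targetPathDecl : Decl := all Alg fun X => all (Word (gen X)) fun w => all (Word (gen X)) fun z =>
  given (val X w ≐ val X z) fun p => given (val X w ≐ val X z) fun q => all (p ≐ q) fun e =>
  thm (target X w z p ≐ target X w z q) (ap (target X w z) e)

def step : Src := entry 92

def stepDecl : Decl := all Alg fun X => all (Word (gen X)) fun w => all (Redex w) fun r =>
  defn (Target X w) (target X w (del w r) (stepPath X w r))

def comp : Src := entry 93

def compDecl : Decl := all Alg fun X => all (Word (gen X)) fun w => all (Target X w) fun z =>
  all (Redex (fst z)) fun r =>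
  defn (Target X w) (target X w (del (fst z) r) (snd z ⬝ stepPath X (fst z) r))

def consTarget : Src := entry 94

def consTargetDecl : Decl := all Alg fun X => all (Signed (gen X)) fun s => all (Word (gen X)) fun w =>
  all (Target X w) fun z =>
  defn (Target X (cons s w)) (target X (cons s w) (cons s (fst z)) (ap (act X s) (snd z)))

def Agree : Src := entry 95

def AgreeDecl : Decl := all Alg fun X => all (Word (gen X)) fun w => all (Redex w) fun r => all (Redex w) fun r' =>
  defn (U 0) (step X w r ≐ step X w r')

def Joined : Src := entry 96

def JoinedDecl : Decl := all Alg fun X => all (Word (gen X)) fun w => all (Redex w) fun r => all (Redex w) fun r' =>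
  all (Redex (del w r)) fun q => all (Redex (del w r')) fun q' =>
  defn (U 0) (comp X w (step X w r) q ≐ comp X w (step X w r') q')

def JoinFst : Src := entry 97

def JoinFstDecl : Decl := all Alg fun X => all (Word (gen X)) fun w => all (Redex w) fun r => all (Redex w) fun r' =>
  all (Redex (del w r)) fun q => defn (U 0) (Sig (Redex (del w r')) fun q' => Joined X w r r' q q')

def Join : Src := entry 98

def JoinDecl : Decl := all Alg fun X => all (Word (gen X)) fun w => all (Redex w) fun r => all (Redex w) fun r' =>
  defn (U 0) (Sig (Redex (del w r)) fun q => JoinFst X w r r' q)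

/-- Two redexes can be removed with a common result. -/
def Diamond : Src := entry 99

/-- One further step on each side is enough, since removing one of two disjoint redexes leaves the
other in place; overlapping redexes already agree. -/
def DiamondDecl : Decl := all Alg fun X => all (Word (gen X)) fun w => all (Redex w) fun r => all (Redex w) fun r' =>
  defn (U 0) (c (.sum 0) (Agree X w r r') (Join X w r r'))

def agree : Src := entry 100

def agreeDecl : Decl := all Alg fun X => all (Word (gen X)) fun w => given (Redex w) fun r => given (Redex w) fun r' =>
  all (step X w r ≐ step X w r') fun e => defn (Diamond X w r r') (c (.inl 0) e)

def join : Src := entry 101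

def joinDecl : Decl := all Alg fun X => all (Word (gen X)) fun w => given (Redex w) fun r => given (Redex w) fun r' =>
  all (Redex (del w r)) fun q => all (Redex (del w r')) fun q' => all (Joined X w r r' q q') fun e =>
  defn (Diamond X w r r') (c (.inr 0) (pair q (pair q' e)))

def diamondCase : Src := entry 102

def diamondCaseDecl : Decl := all Alg fun X => all (Word (gen X)) fun w => all (Redex w) fun r =>
  all (Redex w) fun r' => all (U 0) fun C => all (step X w r ≐ step X w r' ⇒ C) fun f =>
  all (Pi (Redex (del w r)) fun q => Pi (Redex (del w r')) fun q' => Joined X w r r' q q' ⇒ C) fun g =>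
  all (Diamond X w r r') fun d =>
  thm C (sumCase (fn fun _ => C) f (fn fun j => g (fst j) (fst (snd j)) (snd (snd j))) d)

def diamondSymm : Src := entry 103

def diamondSymmDecl : Decl := all Alg fun X => all (Word (gen X)) fun w => all (Redex w) fun r =>
  all (Redex w) fun r' => all (Diamond X w r r') fun d =>
  thm (Diamond X w r' r)
    (diamondCase X w r r' (Diamond X w r' r) (fn fun e => agree X w (sym e))
      (fn3 fun q q' e => join X w q' q (sym e)) d)

def consComp : Src := entry 104

def consCompDecl : Decl := all Alg fun X => all (Signed (gen X)) fun s => all (Word (gen X)) fun w =>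
  all (Target X w) fun z => all (Redex (fst z)) fun r =>
  thm (comp X (cons s w) (consTarget X s w z) (tailRedex s (fst z) r) ≐ consTarget X s w (comp X w z r))
    (targetPath X (cons s w) (cons s (del (fst z) r))
      (sym (apTrans (act X s) (snd z) (stepPath X (fst z) r))))

def consJoined : Src := entry 105

def consJoinedDecl : Decl := all Alg fun X => all (Signed (gen X)) fun s => all (Word (gen X)) fun w =>
  all (Redex w) fun r => all (Redex w) fun r' =>
  all (Redex (del w r)) fun q => all (Redex (del w r')) fun q' => all (Joined X w r r' q q') fun e =>
  thm (Joined X (cons s w) (tailRedex s w r) (tailRedex s w r') (tailRedex s (del w r) q)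
      (tailRedex s (del w r') q'))
    (consComp X s w (step X w r) q ⬝ ap (consTarget X s w) e ⬝ sym (consComp X s w (step X w r') q'))

def diamondCons : Src := entry 106

/-- Prepending a letter acts on targets through `ap`, which respects composition, so both
alternatives persist. -/
def diamondConsDecl : Decl := all Alg fun X => all (Signed (gen X)) fun s => all (Word (gen X)) fun w =>
  all (Redex w) fun r => all (Redex w) fun r' => all (Diamond X w r r') fun d =>
  thm (Diamond X (cons s w) (tailRedex s w r) (tailRedex s w r'))
    (diamondCase X w r r' (Diamond X (cons s w) (tailRedex s w r) (tailRedex s w r'))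
      (fn fun e => agree X (cons s w) (ap (consTarget X s w) e))
      (fn3 fun q q' e => join X (cons s w) (tailRedex s (del w r) q) (tailRedex s (del w r') q')
        (consJoined X s w r r' q q' e)) d)

def isPropStarts : Src := entry 107

def isPropStartsDecl : Decl := all Alg fun X => all (Signed (gen X)) fun s => all (Word (gen X)) fun w =>
  thm (isProp (starts s w))
    (listCase (fn fun w => isProp (starts s w)) isPropEmpty
      (fn3 fun t _ _ => isSetSigned (isSetGen X) (inv s) t) w)

def diamondHead : Src := entry 108

/-- Two redexes at the head differ only in a proof of an equality of letters. Here it is essential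
that A is a set. -/
def diamondHeadDecl : Decl := all Alg fun X => all (Signed (gen X)) fun s => all (Word (gen X)) fun w =>
  all (starts s w) fun h => all (starts s w) fun h' =>
  thm (Diamond X (cons s w) (headRedex s w h) (headRedex s w h'))
    (agree X (cons s w) (ap (fn fun h => step X (cons s w) (headRedex s w h)) (isPropStarts X s w h h')))

/-- The word `s s⁻¹ s w`. -/
def diamondOverlap : Src := entry 109

/-- Cancelling the first pair or the second pair leaves the same word, and the two paths agree by
the triangle law `rhoCoh`. The sign is split because s⁻¹⁻¹ computes to s only for a letter of known
sign. -/
def diamondOverlapDecl : Decl := all Alg fun X => all (Signed (gen X)) fun s => all (Word (gen X)) fun w =>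
  thm (Diamond X (cons s (cons (inv s) (cons (inv (inv s)) w)))
      (headRedex s (cons (inv s) (cons (inv (inv s)) w)) (refl (inv s)))
      (tailRedex s (cons (inv s) (cons (inv (inv s)) w))
        (headRedex (inv s) (cons (inv (inv s)) w) (refl (inv (inv s))))))
    (sumCase (fn fun s => Diamond X (cons s (cons (inv s) (cons (inv (inv s)) w)))
        (headRedex s (cons (inv s) (cons (inv (inv s)) w)) (refl (inv s)))
        (tailRedex s (cons (inv s) (cons (inv (inv s)) w))
          (headRedex (inv s) (cons (inv (inv s)) w) (refl (inv (inv s))))))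
      (fn fun a => agree X (cons (inl (gen X) a) (cons (inr (gen X) a) (cons (inl (gen X) a) w)))
        (targetPath X (cons (inl (gen X) a) (cons (inr (gen X) a) (cons (inl (gen X) a) w)))
          (cons (inl (gen X) a) w) (sym (rhoCoh X (inl (gen X) a) (val X w)))))
      (fn fun a => agree X (cons (inr (gen X) a) (cons (inl (gen X) a) (cons (inr (gen X) a) w)))
        (targetPath X (cons (inr (gen X) a) (cons (inl (gen X) a) (cons (inr (gen X) a) w)))
          (cons (inr (gen X) a) w) (sym (rhoCoh X (inr (gen X) a) (val X w))))) s)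

/-- The word `s s⁻¹ w` with a redex of `w`. -/
def diamondDisjoint : Src := entry 110

/-- The square formed by cancelling s s⁻¹ and by reducing inside w commutes by naturality of `rho`.
-/
def diamondDisjointDecl : Decl := all Alg fun X => all (Signed (gen X)) fun s => all (Word (gen X)) fun w =>
  all (Redex w) fun r =>
  thm (Diamond X (cons s (cons (inv s) w)) (headRedex s (cons (inv s) w) (refl (inv s)))
      (tailRedex s (cons (inv s) w) (tailRedex (inv s) w r)))
    (join X (cons s (cons (inv s) w)) r (headRedex s (cons (inv s) (del w r)) (refl (inv s)))
      (targetPath X (cons s (cons (inv s) w)) (del w r)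
        (sym (naturality (act X (inv s)) (act X s) (rho X s) (stepPath X w r)))))

def diamondInv : Src := entry 111

def diamondInvDecl : Decl := all Alg fun X => all (Signed (gen X)) fun s => all (Word (gen X)) fun w =>
  all (Redex (cons (inv s) w)) fun r =>
  thm (Diamond X (cons s (cons (inv s) w)) (headRedex s (cons (inv s) w) (refl (inv s)))
      (tailRedex s (cons (inv s) w) r))
    (sumCase (fn fun r => Diamond X (cons s (cons (inv s) w))
        (headRedex s (cons (inv s) w) (refl (inv s))) (tailRedex s (cons (inv s) w) r))
      (listCase (fn fun w => Pi (starts (inv s) w) fun h => Diamond X (cons s (cons (inv s) w))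
          (headRedex s (cons (inv s) w) (refl (inv s)))
          (tailRedex s (cons (inv s) w) (headRedex (inv s) w h)))
        (fn fun h => absurd (fn fun h => Diamond X (cons s (cons (inv s) (nil (gen X))))
          (headRedex s (cons (inv s) (nil (gen X))) (refl (inv s)))
          (tailRedex s (cons (inv s) (nil (gen X))) (headRedex (inv s) (nil (gen X)) h))) h)
        (fn4 fun _ w _ h => J (fn2 fun t h => Diamond X (cons s (cons (inv s) (cons t w)))
            (headRedex s (cons (inv s) (cons t w)) (refl (inv s)))
            (tailRedex s (cons (inv s) (cons t w)) (headRedex (inv s) (cons t w) h)))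
          (diamondOverlap X s w) h) w)
      (fn fun r => diamondDisjoint X s w r) r)

def diamondHeadTail : Src := entry 112

/-- Path induction on the head redex makes the second letter s⁻¹, after which a redex of the tail
either uses that letter or lies beyond it. -/
def diamondHeadTailDecl : Decl := all Alg fun X => all (Signed (gen X)) fun s => all (Word (gen X)) fun w =>
  thm (Pi (starts s w) fun h => Pi (Redex w) fun r =>
      Diamond X (cons s w) (headRedex s w h) (tailRedex s w r))
    (listCase (fn fun w => Pi (starts s w) fun h => Pi (Redex w) fun r =>
        Diamond X (cons s w) (headRedex s w h) (tailRedex s w r))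
      (fn2 fun h r => absurd (fn fun h => Diamond X (cons s (nil (gen X)))
        (headRedex s (nil (gen X)) h) (tailRedex s (nil (gen X)) r)) h)
      (fn4 fun _ w _ h => J (fn2 fun t h => Pi (Redex (cons t w)) fun r => Diamond X (cons s (cons t w))
          (headRedex s (cons t w) h) (tailRedex s (cons t w) r))
        (fn fun r => diamondInv X s w r) h) w)

def diamond : Src := entry 113

/-- Induction on the word, with each redex at the head or in the tail; the case of tail and head is
the symmetric one, and two tail redexes use the induction hypothesis. -/
def diamondDecl : Decl := all Alg fun X => all (Word (gen X)) fun w =>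
  thm (Pi (Redex w) fun r => Pi (Redex w) fun r' => Diamond X w r r')
    (listCase (fn fun w => Pi (Redex w) fun r => Pi (Redex w) fun r' => Diamond X w r r')
      (fn2 fun r r' => absurd (fn fun r => Diamond X (nil (gen X)) r r') r)
      (fn4 fun s w d r => sumCase (fn fun r => Pi (Redex (cons s w)) fun r' => Diamond X (cons s w) r r')
        (fn2 fun h r' => sumCase (fn fun r' => Diamond X (cons s w) (headRedex s w h) r')
          (fn fun h' => diamondHead X s w h h') (fn fun r' => diamondHeadTail X s w h r') r')
        (fn2 fun q r' => sumCase (fn fun r' => Diamond X (cons s w) (tailRedex s w q) r')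
          (fn fun h => diamondSymm X (cons s w) (headRedex s w h) (tailRedex s w q)
            (diamondHeadTail X s w h q))
          (fn fun q' => diamondCons X s w q q' (d q q')) r') r) w)

def diamondDecls : List Decl :=
  [fst1Decl, snd1Decl, ActDataDecl, PointDataDecl, CarDataDecl, GenDataDecl, AlgDecl, genDecl,
    genDataDecl, isSetGenDecl, carDataDecl, carDecl, pointDataDecl, unitDecl, actDataDecl,
    gactDecl, gequDecl, ginvDecl, getaDecl, gepsDecl, gtauDecl, invDecl, actDecl, rhoDecl,
    rhoInvDecl, rhoCohDecl, valDecl, startsDecl, RedexDecl, tailDecl, delConsDecl, delDecl,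
    headRedexDecl, tailRedexDecl, stepHeadDecl, stepConsDecl, stepPathDecl, TargetDecl, targetDecl,
    targetPathDecl, stepDecl, compDecl, consTargetDecl, AgreeDecl, JoinedDecl, JoinFstDecl,
    JoinDecl, DiamondDecl, agreeDecl, joinDecl, diamondCaseDecl, diamondSymmDecl, consCompDecl,
    consJoinedDecl, diamondConsDecl, isPropStartsDecl, diamondHeadDecl, diamondOverlapDecl,
    diamondDisjointDecl, diamondInvDecl, diamondHeadTailDecl, diamondDecl]

def diamondTable : Table := extend setTable diamondDecls

end

end Internal
end HoTT

/-! ### Internal proofs: uniqueness of the path of a reduction to the empty word -/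

namespace HoTT

namespace Internal

open Src

noncomputable section

/-! ### Words that reduce to the empty word -/

def natCase (P d e n : Src) : Src := c (.natElim 0) P d e n

def nat : Src := c .nat

def zero : Src := c .zero

def succ (n : Src) : Src := c .succ n

def isNil : Src := entry 114

def isNilDecl : Decl := given (U 0) fun A => all (Word A) fun w =>
  defn (U 0) (listFam (c .one) (fn3 fun _ _ _ => c .empty) w)

/-- The word `w` can be reduced to the empty word in `n` steps. -/
def Reduces : Src := entry 115

/-- The recursion on n produces a family over all words, as the word changes with each step. -/
def ReducesDecl : Decl := all (U 0) fun A => all nat fun n => all (Word A) fun w => defn (U 0)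
  (c (.natElim 1) (fn fun _ => Word A ⇒ U 0) (fn fun w => isNil w)
    (fn3 fun _ N w => Sig (Redex w) fun r => N (del w r)) n w)

def Trivial : Src := entry 116

def TrivialDecl : Decl := given (U 0) fun A => all (Word A) fun w =>
  defn (U 0) (Sig nat fun n => Reduces A n w)

def trivialNil : Src := entry 117

def trivialNilDecl : Decl := all (U 0) fun A => defn (Trivial (nil A)) (pair zero (c .star))

def trivialCons : Src := entry 118

def trivialConsDecl : Decl := given (U 0) fun A => all (Word A) fun w => all (Redex w) fun r =>
  all (Trivial (del w r)) fun k => defn (Trivial w) (pair (succ (fst k)) (pair r (snd k)))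

def nilPath : Src := entry 119

def nilPathDecl : Decl := all Alg fun X => all (Word (gen X)) fun w =>
  defn (isNil w ⇒ val X w ≐ unit X)
    (listCase (fn fun w => isNil w ⇒ val X w ≐ unit X) (fn fun _ => refl (unit X))
      (fn4 fun s w _ k => absurd (fn fun _ => val X (cons s w) ≐ unit X) k) w)

def reducesPath : Src := entry 120

def reducesPathDecl : Decl := all Alg fun X => all nat fun n =>
  defn (Pi (Word (gen X)) fun w => Reduces (gen X) n w ⇒ val X w ≐ unit X)
    (natCase (fn fun n => Pi (Word (gen X)) fun w => Reduces (gen X) n w ⇒ val X w ≐ unit X)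
      (fn fun w => nilPath X w)
      (fn4 fun _ p w k => stepPath X w (fst k) ⬝ p (del w (fst k)) (snd k)) n)

def trivialPath : Src := entry 121

def trivialPathDecl : Decl := all Alg fun X => all (Word (gen X)) fun w => all (Trivial w) fun k =>
  defn (val X w ≐ unit X) (reducesPath X (fst k) w (snd k))

/-- Reductions of the target of a path that are compatible with a given path. -/
def Lift : Src := entry 122

/-- This says that the path p to the unit factors through the target z, by some reduction of the
word of z. The length of that reduction is left open. -/
def LiftDecl : Decl := all Alg fun X => all (Word (gen X)) fun w => all (val X w ≐ unit X) fun p =>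
  all (Target X w) fun z =>
  defn (U 0) (Sig (Trivial (fst z)) fun k => p ≐ snd z ⬝ trivialPath X (fst z) k)

def lifted : Src := entry 123

def liftedDecl : Decl := given Alg fun X => given (Word (gen X)) fun w => given (val X w ≐ unit X) fun p =>
  given (Target X w) fun z => all (Lift X w p z) fun l => defn (Trivial (fst z)) (fst l)

def liftedPath : Src := entry 124

def liftedPathDecl : Decl := given Alg fun X => given (Word (gen X)) fun w => given (val X w ≐ unit X) fun p =>
  given (Target X w) fun z => all (Lift X w p z) fun l =>
  defn (p ≐ snd z ⬝ trivialPath X (fst z) (lifted l)) (snd l)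

def lift : Src := entry 125

def liftDecl : Decl := all Alg fun X => all (Word (gen X)) fun w => given (val X w ≐ unit X) fun p =>
  all (Target X w) fun z => all (Trivial (fst z)) fun k =>
  all (p ≐ snd z ⬝ trivialPath X (fst z) k) fun e => defn (Lift X w p z) (pair k e)

def liftComp : Src := entry 126

def liftCompDecl : Decl := all Alg fun X => all (Word (gen X)) fun w => all (Redex w) fun r =>
  all (Redex (del w r)) fun q => all (val X (del w r) ≐ unit X) fun p =>
  all (Trivial (del (del w r) q)) fun k =>
  all (p ≐ stepPath X (del w r) q ⬝ trivialPath X (del (del w r) q) k) fun e =>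
  thm (Lift X w (stepPath X w r ⬝ p) (comp X w (step X w r) q))
    (lift X w (comp X w (step X w r) q) k (whiskerL (stepPath X w r) e ⬝
      sym (assoc (stepPath X w r) (stepPath X (del w r) q) (trivialPath X (del (del w r) q) k))))

def liftStep : Src := entry 127

def liftStepDecl : Decl := all Alg fun X => all (Word (gen X)) fun w => all (Redex w) fun r =>
  all (Redex (del w r)) fun q => all (val X w ≐ unit X) fun p =>
  all (Trivial (del (del w r) q)) fun k =>
  all (p ≐ stepPath X w r ⬝ stepPath X (del w r) q ⬝ trivialPath X (del (del w r) q) k) fun e =>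
  thm (Lift X w p (step X w r))
    (lift X w (step X w r) (trivialCons (del w r) q k) (e ⬝
      assoc (stepPath X w r) (stepPath X (del w r) q) (trivialPath X (del (del w r) q) k)))

def liftJoin : Src := entry 128

def liftJoinDecl : Decl := all Alg fun X => all (Word (gen X)) fun w => all (Redex w) fun r =>
  all (Redex w) fun r' => all (Redex (del w r)) fun q => all (Redex (del w r')) fun q' =>
  all (Joined X w r r' q q') fun e => all (val X (del w r) ≐ unit X) fun p =>
  all (Lift X (del w r) p (step X (del w r) q)) fun l =>
  defn (Lift X w (stepPath X w r ⬝ p) (comp X w (step X w r') q'))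
    (transport (Lift X w (stepPath X w r ⬝ p)) e (liftComp X w r q p (lifted l) (liftedPath l)))

def Strip : Src := entry 129

def StripDecl : Decl := all Alg fun X => all nat fun n => defn (U 0)
  (Pi (Word (gen X)) fun w => Pi (Reduces (gen X) n w) fun k => Pi (Redex w) fun r =>
    Lift X w (reducesPath X n w k) (step X w r))

def stripSucc : Src := entry 130

/-- The given reduction starts with r, and r' is another redex. If both removals agree, the rest of
the reduction is transported. Otherwise they are joined by q and q': the induction hypothesis lets
the rest start with q, its remainder is carried over to the common word, and the step q' is put in
front. -/
def stripSuccDecl : Decl := all Alg fun X => all nat fun n => all (Strip X n) fun ih =>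
  all (Word (gen X)) fun w => all (Redex w) fun r => all (Reduces (gen X) n (del w r)) fun k =>
  all (Redex w) fun r' =>
  thm (Lift X w (stepPath X w r ⬝ reducesPath X n (del w r) k) (step X w r'))
    (diamondCase X w r r'
      (Lift X w (stepPath X w r ⬝ reducesPath X n (del w r) k) (step X w r'))
      (fn fun e => transport (Lift X w (stepPath X w r ⬝ reducesPath X n (del w r) k)) e
        (lift X w (step X w r) (pair n k) (refl (stepPath X w r ⬝ reducesPath X n (del w r) k))))
      (fn3 fun q q' e => liftStep X w r' q' (stepPath X w r ⬝ reducesPath X n (del w r) k)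
        (lifted (liftJoin X w r r' q q' e (reducesPath X n (del w r) k) (ih (del w r) k q)))
        (liftedPath (liftJoin X w r r' q q' e (reducesPath X n (del w r) k) (ih (del w r) k q))))
      (diamond X w r r'))

def strip : Src := entry 131

def stripDecl : Decl := all Alg fun X => all nat fun n =>
  thm (Strip X n)
    (natCase (fn fun n => Strip X n)
      (fn fun w => listCase (fn fun w => Pi (isNil w) fun k => Pi (Redex w) fun r =>
          Lift X w (nilPath X w k) (step X w r))
        (fn2 fun k r => absurd (fn fun r => Lift X (nil (gen X)) (nilPath X (nil (gen X)) k)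
          (step X (nil (gen X)) r)) r)
        (fn fun s => fn4 fun w _ k r => absurd (fn fun k => Lift X (cons s w) (nilPath X (cons s w) k)
          (step X (cons s w) r)) k) w)
      (fn2 fun n ih => fn3 fun w k r => stripSucc X n ih w (fst k) (snd k) r) n)

def stripTrivial : Src := entry 132

def stripTrivialDecl : Decl := all Alg fun X => all (Word (gen X)) fun w => all (Trivial w) fun k =>
  all (Redex w) fun r =>
  thm (Lift X w (trivialPath X w k) (step X w r)) (strip X (fst k) w (snd k) r)

def nilUnique : Src := entry 133

/-- The empty word has no redex, so a reduction of it has length zero and gives the constant path.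
-/
def nilUniqueDecl : Decl := all Alg fun X => all nat fun n =>
  thm (Pi (Reduces (gen X) n (nil (gen X))) fun k => refl (unit X) ≐ reducesPath X n (nil (gen X)) k)
    (natCase (fn fun n => Pi (Reduces (gen X) n (nil (gen X))) fun k =>
        refl (unit X) ≐ reducesPath X n (nil (gen X)) k)
      (fn fun _ => refl (refl (unit X)))
      (fn3 fun n _ k => absurd (fn fun _ => refl (unit X) ≐ reducesPath X (succ n) (nil (gen X)) k)
        (fst k)) n)

def Unique : Src := entry 134

def UniqueDecl : Decl := all Alg fun X => all nat fun n => defn (U 0)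
  (Pi (Word (gen X)) fun w => Pi (Reduces (gen X) n w) fun k => Pi (Trivial w) fun k' =>
    reducesPath X n w k ≐ trivialPath X w k')

def uniqueSucc : Src := entry 135

/-- By the strip lemma, the second reduction may be replaced by one that also starts with r and
gives the same path; the induction hypothesis compares the remainders. -/
def uniqueSuccDecl : Decl := all Alg fun X => all nat fun n => all (Unique X n) fun ih =>
  all (Word (gen X)) fun w => all (Redex w) fun r => all (Reduces (gen X) n (del w r)) fun k =>
  all (Trivial w) fun k' => all (Lift X w (trivialPath X w k') (step X w r)) fun l =>
  thm (stepPath X w r ⬝ reducesPath X n (del w r) k ≐ trivialPath X w k')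
    (whiskerL (stepPath X w r) (ih (del w r) k (lifted l)) ⬝ sym (liftedPath l))

def unique : Src := entry 136

def uniqueDecl : Decl := all Alg fun X => all nat fun n =>
  thm (Unique X n)
    (natCase (fn fun n => Unique X n)
      (fn fun w => listCase (fn fun w => Pi (isNil w) fun k => Pi (Trivial w) fun k' =>
          nilPath X w k ≐ trivialPath X w k')
        (fn2 fun _ k' => nilUnique X (fst k') (snd k'))
        (fn fun s => fn4 fun w _ k k' => absurd (fn fun k =>
          nilPath X (cons s w) k ≐ trivialPath X (cons s w) k') k) w)
      (fn2 fun n ih => fn3 fun w k k' => uniqueSucc X n ih w (fst k) (snd k) k'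
        (stripTrivial X w k' (fst k))) n)

/-- All reductions of a word to the empty word give the same path. -/
def trivialUnique : Src := entry 137

def trivialUniqueDecl : Decl := all Alg fun X => all (Word (gen X)) fun w => all (Trivial w) fun k =>
  all (Trivial w) fun k' =>
  thm (trivialPath X w k ≐ trivialPath X w k') (unique X (fst k) w (snd k) k')

def trivialDecls : List Decl :=
  [isNilDecl, ReducesDecl, TrivialDecl, trivialNilDecl, trivialConsDecl, nilPathDecl,
    reducesPathDecl, trivialPathDecl, LiftDecl, liftedDecl, liftedPathDecl, liftDecl, liftCompDecl,
    liftStepDecl, liftJoinDecl, StripDecl, stripSuccDecl, stripDecl, stripTrivialDecl,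
    nilUniqueDecl, UniqueDecl, uniqueSuccDecl, uniqueDecl, trivialUniqueDecl]

def trivialTable : Table := extend diamondTable trivialDecls

end

end Internal
end HoTT

/-! ### Internal proofs: codes for the set-based free group and decoding at the unit -/

namespace HoTT

namespace Internal

open Src

noncomputable section

/-! ### The set-based free group -/

def append : Src := entry 138

def appendDecl : Decl := given (U 0) fun A => all (Word A) fun v => all (Word A) fun w =>
  defn (Word A) (listCase (fn fun _ => Word A) w (fn3 fun s _ r => cons s r) v)

def SplitAt : Src := entry 139

def SplitAtDecl : Decl := given (U 0) fun A => all (Word A) fun v => all (Word A) fun w =>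
  all (Word A) fun x => all (Signed A) fun s => all (Word A) fun y => defn (U 0)
  (Sig (v ≐ append x (cons s (cons (inv s) y))) fun _ => w ≐ append x y)

def Split : Src := entry 140

def SplitDecl : Decl := given (U 0) fun A => all (Word A) fun v => all (Word A) fun w => defn (U 0)
  (Sig (Word A) fun x => Sig (Signed A) fun s => Sig (Word A) fun y => SplitAt v w x s y)

def redexRel : Src := entry 141

def redexRelDecl : Decl := all (U 0) fun A => all (Word A) fun v => all (Word A) fun w =>
  defn (U 0) (c (.tr 0 0) (Split v w))

def SetGroup : Src := entry 142

def SetGroupDecl : Decl := all (U 0) fun A => defn (U 0) (c (.quo 0) (Word A) (redexRel A))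

def cls : Src := entry 143

def clsDecl : Decl := given (U 0) fun A => all (Word A) fun w =>
  defn (SetGroup A) (full (.quoIn 0) (Word A) (redexRel A) w)

def clsRel : Src := entry 144

def clsRelDecl : Decl := given (U 0) fun A => all (Word A) fun v => all (Word A) fun w => all (Split v w) fun q =>
  thm (cls v ≐ cls w) (full (.quoEq 0) (Word A) (redexRel A) v w (c (.trIn 0 0) q))

def isSetGroup : Src := entry 145

def isSetGroupDecl : Decl := all (U 0) fun A =>
  thm (isSet (SetGroup A)) (full (.quoSet 0) (Word A) (redexRel A))

/-- Induction for propositions. -/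
def groupInd : Src := entry 146

def groupIndDecl : Decl := all (U 0) fun A => all (SetGroup A ⇒ U 0) fun P =>
  all (Pi (SetGroup A) fun g => isProp (P g)) fun h => all (Pi (Word A) fun w => P (cls w)) fun f =>
  thm (Pi (SetGroup A) fun g => P g)
    (fn fun g => full (.quoElim 0 0) (Word A) (redexRel A) P (fn fun g => propSet (h g)) f
      (fn3 fun v w r => h (cls w) (transport P (full (.quoEq 0) (Word A) (redexRel A) v w r) (f v))
        (f w)) g)

/-- Maps to sets. -/
def groupRec : Src := entry 147

/-- Compatibility is required only for explicit splittings; since B is a set, it extends to the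
propositionally truncated relation. -/
def groupRecDecl : Decl := all (U 0) fun A => all (U 0) fun B => all (isSet B) fun h => all (Word A ⇒ B) fun f =>
  all (Pi (Word A) fun v => Pi (Word A) fun w => Split v w ⇒ f v ≐ f w) fun e =>
  defn (SetGroup A ⇒ B)
    (fn fun g => full (.quoElim 0 0) (Word A) (redexRel A) (constFam (SetGroup A) B) (fn fun _ => h) f
      (fn3 fun v w r =>
        transConst B (full (.quoEq 0) (Word A) (redexRel A) v w r) (f v) ⬝
          trRec (h (f v) (f w)) (e v w) r) g)

/-! ### Redexes and the relation -/

def RedexTo : Src := entry 148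

/-- Redexes are defined by recursion, the relation of the quotient by concatenation; `redexSplit`
and `splits` translate between the two. -/
def RedexToDecl : Decl := given (U 0) fun A => all (Word A) fun v => all (Word A) fun w =>
  defn (U 0) (Sig (Redex v) fun r => del v r ≐ w)

def redexTo : Src := entry 149

def redexToDecl : Decl := given (U 0) fun A => all (Word A) fun v => all (Word A) fun w => all (Redex v) fun r =>
  all (del v r ≐ w) fun e => defn (RedexTo v w) (pair r e)

def redexAppend : Src := entry 150

def redexAppendDecl : Decl := given (U 0) fun A => all (Word A) fun x => all (Signed A) fun s => all (Word A) fun y =>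
  thm (RedexTo (append x (cons s (cons (inv s) y))) (append x y))
    (listCase (fn fun x => RedexTo (append x (cons s (cons (inv s) y))) (append x y))
      (redexTo (cons s (cons (inv s) y)) y (headRedex s (cons (inv s) y) (refl (inv s))) (refl y))
      (fn3 fun t x ih => pair (tailRedex t (append x (cons s (cons (inv s) y))) (fst ih))
        (ap (fn fun w => cons t w) (snd ih))) x)

def redexSplitAt : Src := entry 151

def redexSplitAtDecl : Decl := given (U 0) fun A => all (Word A) fun v => all (Word A) fun w =>
  all (Word A) fun x => all (Signed A) fun s => all (Word A) fun y => all (SplitAt v w x s y) fun q =>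
  thm (RedexTo v w)
    (transport (fn fun v => RedexTo v w) (sym (fst q))
      (transport (RedexTo (append x (cons s (cons (inv s) y)))) (sym (snd q)) (redexAppend x s y)))

def redexSplit : Src := entry 152

def redexSplitDecl : Decl := given (U 0) fun A => all (Word A) fun v => all (Word A) fun w => all (Split v w) fun q =>
  thm (RedexTo v w)
    (redexSplitAt v w (fst q) (fst (snd q)) (fst (snd (snd q))) (snd (snd (snd q))))

def Splits : Src := entry 153

def SplitsDecl : Decl := given (U 0) fun A => all (Word A) fun w => all (Redex w) fun r =>
  defn (U 0) (Split w (del w r))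

def splitPair : Src := entry 154

def splitPairDecl : Decl := given (U 0) fun A => all (Word A) fun v => all (Word A) fun w =>
  all (Word A) fun x => all (Signed A) fun s => all (Word A) fun y =>
  all (v ≐ append x (cons s (cons (inv s) y))) fun p => all (w ≐ append x y) fun q =>
  defn (Split v w) (pair x (pair s (pair y (pair p q))))

def splitHead : Src := entry 155

def splitHeadDecl : Decl := given (U 0) fun A => all (Signed A) fun s => all (Word A) fun w =>
  thm (Pi (starts s w) fun h => Splits (cons s w) (headRedex s w h))
    (listCase (fn fun w => Pi (starts s w) fun h => Splits (cons s w) (headRedex s w h))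
      (fn fun h => absurd (fn fun h => Splits (cons s (nil A)) (headRedex s (nil A) h)) h)
      (fn4 fun _ w _ h => J (fn2 fun t h => Splits (cons s (cons t w)) (headRedex s (cons t w) h))
        (splitPair (cons s (cons (inv s) w)) w (nil A) s w (refl (cons s (cons (inv s) w))) (refl w))
        h) w)

def splitCons : Src := entry 156

def splitConsDecl : Decl := given (U 0) fun A => all (Signed A) fun t => all (Word A) fun v => all (Word A) fun w =>
  all (Word A) fun x => all (Signed A) fun s => all (Word A) fun y => all (SplitAt v w x s y) fun q =>
  thm (Split (cons t v) (cons t w))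
    (splitPair (cons t v) (cons t w) (cons t x) s y (ap (fn fun w => cons t w) (fst q))
      (ap (fn fun w => cons t w) (snd q)))

def splitTail : Src := entry 157

def splitTailDecl : Decl := given (U 0) fun A => all (Signed A) fun t => all (Word A) fun v => all (Word A) fun w =>
  all (Split v w) fun q =>
  thm (Split (cons t v) (cons t w))
    (splitCons t v w (fst q) (fst (snd q)) (fst (snd (snd q))) (snd (snd (snd q))))

def splits : Src := entry 158

def splitsDecl : Decl := given (U 0) fun A => all (Word A) fun w =>
  thm (Pi (Redex w) fun r => Splits w r)
    (listCase (fn fun w => Pi (Redex w) fun r => Splits w r)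
      (fn fun r => absurd (fn fun r => Splits (nil A) r) r)
      (fn4 fun s w d r => sumCase (fn fun r => Splits (cons s w) r)
        (fn fun h => splitHead s w h) (fn fun r => splitTail s w (del w r) (d r)) r) w)

/-- Removing a redex does not change the class of a word. -/
def clsStep : Src := entry 159

def clsStepDecl : Decl := given (U 0) fun A => all (Word A) fun w => all (Redex w) fun r =>
  defn (cls w ≐ cls (del w r)) (clsRel w (del w r) (splits w r))

/-! ### Propositions -/

def eq1 (x y : Src) : Src := c (.eq 1) x y

infix:50 " ≐₁ " => eq1

def refl1 (x : Src) : Src := c (.refl 1) x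

def sym1 : Src := entry 160

/-- The path algebra is repeated one universe higher because the type of propositions lives there.
-/
def sym1Decl : Decl := given (U 1) fun A => given A fun x => given A fun y => all (x ≐₁ y) fun p =>
  defn (y ≐₁ x) (c (.eqElim 1 1) (fn2 fun y _ => y ≐₁ x) (refl1 x) p)

def trans1 : Src := entry 161

def trans1Decl : Decl := given (U 1) fun A => given A fun x => given A fun y => given A fun z =>
  all (x ≐₁ y) fun p => all (y ≐₁ z) fun q =>
  defn (x ≐₁ z) (c (.eqElim 1 1) (fn2 fun z _ => x ≐₁ z) p q)

def symTrans1 : Src := entry 162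

def symTrans1Decl : Decl := given (U 1) fun A => given A fun x => given A fun y => all (x ≐₁ y) fun p =>
  thm (trans1 (sym1 p) p ≐₁ refl1 y)
    (c (.eqElim 1 1) (fn2 fun y p => trans1 (sym1 p) p ≐₁ refl1 y) (refl1 (refl1 x)) p)

def transport1 : Src := entry 163

def transport1Decl : Decl := given (U 1) fun A => all (A ⇒ U 0) fun P => given A fun x => given A fun y =>
  all (x ≐₁ y) fun p => all (P x) fun u => defn (P y) (c (.eqElim 1 0) (fn2 fun y _ => P y) u p)

def hedbergPath1 : Src := entry 164

def hedbergPath1Decl : Decl := given (U 1) fun A => all A fun x => all (A ⇒ U 0) fun R => all (R x) fun r =>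
  all (Pi A fun y => R y ⇒ x ≐₁ y) fun d => given A fun y => all (x ≐₁ y) fun p =>
  thm (p ≐₁ trans1 (sym1 (d x r)) (d y (transport1 R p r)))
    (c (.eqElim 1 1) (fn2 fun y p => p ≐₁ trans1 (sym1 (d x r)) (d y (transport1 R p r)))
      (sym1 (symTrans1 (d x r))) p)

def hedbergCong1 : Src := entry 165

def hedbergCong1Decl : Decl := given (U 1) fun A => all A fun x => all (A ⇒ U 0) fun R => all (R x) fun r =>
  all (Pi A fun y => R y ⇒ x ≐₁ y) fun d => all A fun y => given (R y) fun u => given (R y) fun v =>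
  all (u ≐ v) fun e =>
  thm (trans1 (sym1 (d x r)) (d y u) ≐₁ trans1 (sym1 (d x r)) (d y v))
    (c (.eqElim 0 1)
      (fn2 fun v _ => trans1 (sym1 (d x r)) (d y u) ≐₁ trans1 (sym1 (d x r)) (d y v))
      (refl1 (trans1 (sym1 (d x r)) (d y u))) e)

def hedberg1 : Src := entry 166

def hedberg1Decl : Decl := given (U 1) fun A => all A fun x => all (A ⇒ U 0) fun R =>
  all (Pi A fun y => isProp (R y)) fun hR => all (R x) fun r =>
  all (Pi A fun y => R y ⇒ x ≐₁ y) fun d =>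
  thm (Pi A fun y => Pi (x ≐₁ y) fun p => Pi (x ≐₁ y) fun q => p ≐₁ q)
    (fn3 fun y p q => trans1 (hedbergPath1 x R r d p)
      (trans1 (hedbergCong1 x R r d y (hR y (transport1 R p r) (transport1 R q r)))
        (sym1 (hedbergPath1 x R r d q))))

def HProp : Src := entry 167

def HPropDecl : Decl := defn (U 1) (Sig1 (U 0) fun P => isProp P)

def hProp : Src := entry 168

def hPropDecl : Decl := all (U 0) fun P => all (isProp P) fun h => defn HProp (c (.pair 1) P h)

def holds : Src := entry 169

def holdsDecl : Decl := all HProp fun P => defn (U 0) (fst1 P)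

def isPropHolds : Src := entry 170

def isPropHoldsDecl : Decl := all HProp fun P => defn (isProp (holds P)) (snd1 P)

def propExt : Src := entry 171

def propExtDecl : Decl := all (U 0) fun P => all (U 0) fun Q => all (isProp P) fun h => all (isProp Q) fun k =>
  all (P ⇒ Q) fun f => all (Q ⇒ P) fun g =>
  thm (P ≐₁ Q)
    (fst1 (full (.ua 0) P Q) (pair f (adjointify f g (fn fun x => h (g (f x)) x)
      (fn fun y => k (f (g y)) y))))

def hPropCong : Src := entry 172

def hPropCongDecl : Decl := all (U 0) fun P => all (isProp P) fun h => all (isProp P) fun k =>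
  thm (hProp P h ≐₁ hProp P k)
    (c (.eqElim 0 1) (fn2 fun k _ => hProp P h ≐₁ hProp P k) (refl1 (hProp P h))
      (isPropIsProp P h k))

def hPropEq : Src := entry 173

def hPropEqDecl : Decl := all (U 0) fun P => all (U 0) fun Q => all (P ≐₁ Q) fun e =>
  thm (Pi (isProp P) fun h => Pi (isProp Q) fun k => hProp P h ≐₁ hProp Q k)
    (fn fun h => c (.eqElim 1 1) (fn2 fun Q _ => Pi (isProp Q) fun k => hProp P h ≐₁ hProp Q k)
      (fn fun k => hPropCong P h k) e)

def HIff : Src := entry 174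

def HIffDecl : Decl := all HProp fun P => all HProp fun Q =>
  defn (U 0) (Sig (holds P ⇒ holds Q) fun _ => holds Q ⇒ holds P)

def hPropPath : Src := entry 175

def hPropPathDecl : Decl := all HProp fun P => all HProp fun Q => all (HIff P Q) fun e =>
  thm (P ≐₁ Q)
    (c (.sigElim 1 1) (fn fun P => HIff P Q ⇒ P ≐₁ Q)
      (fn2 fun A h => c (.sigElim 1 1) (fn fun Q => HIff (hProp A h) Q ⇒ hProp A h ≐₁ Q)
        (fn3 fun B k e => hPropEq A B (propExt A B h k (fst e) (snd e)) h k) Q) P e)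

def isPropArr : Src := entry 176

def isPropArrDecl : Decl := all (U 0) fun A => all (U 0) fun B => all (isProp B) fun h =>
  thm (isProp (A ⇒ B)) (isPropPi (fn fun _ => h))

def isPropHIff : Src := entry 177

def isPropHIffDecl : Decl := all HProp fun P => all HProp fun Q =>
  thm (isProp (HIff P Q))
    (isPropSig (fn fun _ => isPropArr (holds Q) (holds P) (isPropHolds P))
      (fn2 fun u v => isPropArr (holds P) (holds Q) (isPropHolds Q) (fst u) (fst v)))

def isSetHProp : Src := entry 178

/-- Logical equivalence is a reflexive family of propositions that implies equality, by univalence;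
Hedberg's argument applies. -/
def isSetHPropDecl : Decl := thm (Pi HProp fun P => Pi HProp fun Q => Pi (P ≐₁ Q) fun p => Pi (P ≐₁ Q) fun q => p ≐₁ q)
  (fn fun P => hedberg1 P (HIff P) (isPropHIff P) (pair (fn fun x => x) (fn fun x => x)) (hPropPath P))

/-! ### Decoding of classes -/

def Merely : Src := entry 179

def MerelyDecl : Decl := all (U 0) fun A => defn (U 0) (c (.tr 0 0) A)

def mere : Src := entry 180

def mereDecl : Decl := given (U 0) fun A => all A fun a => defn (Merely A) (c (.trIn 0 0) a)

def isPropMerely : Src := entry 181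

def isPropMerelyDecl : Decl := all (U 0) fun A => defn (isProp (Merely A)) (c (.trLevel 0 0) A)

def mereMap : Src := entry 182

def mereMapDecl : Decl := given (U 0) fun A => given (U 0) fun B => all (A ⇒ B) fun f =>
  thm (Merely A ⇒ Merely B) (trRec (isPropMerely B) (fn fun a => mere (f a)))

def trivialFwd : Src := entry 183

def trivialFwdDecl : Decl := all Alg fun X => all (Word (gen X)) fun v => all (Word (gen X)) fun w =>
  all (RedexTo v w) fun q => all (Trivial v) fun k =>
  thm (Trivial w) (transport (fn fun w => Trivial w) (snd q) (lifted (stripTrivial X v k (fst q))))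

def trivialBwd : Src := entry 184

def trivialBwdDecl : Decl := given (U 0) fun A => all (Word A) fun v => all (Word A) fun w =>
  all (RedexTo v w) fun q => all (Trivial w) fun k =>
  thm (Trivial v) (trivialCons v (fst q) (transport (fn fun w => Trivial w) (sym (snd q)) k))

def codeWord : Src := entry 185

def codeWordDecl : Decl := given (U 0) fun A => all (Word A) fun w =>
  defn HProp (hProp (Merely (Trivial w)) (isPropMerely (Trivial w)))

def codePath : Src := entry 186

/-- Triviality passes forward along a redex removal by the strip lemma, and backward by putting the
step in front. -/
def codePathDecl : Decl := all Alg fun X => all (Word (gen X)) fun v => all (Word (gen X)) fun w =>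
  all (redexRel (gen X) v w) fun r =>
  thm (codeWord v ≐₁ codeWord w)
    (hPropPath (codeWord v) (codeWord w)
      (trRec (isPropHIff (codeWord v) (codeWord w))
        (fn fun q => pair (mereMap (trivialFwd X v w (redexSplit v w q)))
          (mereMap (trivialBwd v w (redexSplit v w q)))) r))

def transConst1 : Src := entry 187

def transConst1Decl : Decl := given (U 0) fun A => all (U 1) fun B => given A fun x => given A fun y =>
  all (x ≐ y) fun p => all B fun u =>
  thm (c (.eqElim 0 1) (fn2 fun _ _ => B) u p ≐₁ u)
    (c (.eqElim 0 1) (fn2 fun _ p => c (.eqElim 0 1) (fn2 fun _ _ => B) u p ≐₁ u) (refl1 u) p)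

def code : Src := entry 188

def codeDecl : Decl := all Alg fun X => all (SetGroup (gen X)) fun g =>
  defn HProp
    (full (.quoElim 0 1) (Word (gen X)) (redexRel (gen X)) (fn fun _ => HProp) (fn fun _ => isSetHProp)
      (fn fun w => codeWord w)
      (fn3 fun v w r => trans1
        (transConst1 HProp (full (.quoEq 0) (Word (gen X)) (redexRel (gen X)) v w r) (codeWord v))
        (codePath X v w r)) g)

def encode : Src := entry 189

/-- The empty word is trivial, and `code` transports this along an equality of classes. -/
def encodeDecl : Decl := all Alg fun X => all (Word (gen X)) fun w => all (cls (nil (gen X)) ≐ cls w) fun p =>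
  thm (Merely (Trivial w))
    (transport (fn fun g => holds (code X g)) p (mere (trivialNil (gen X))))

/-- Paths from the unit to the value of `w` that are compatible with all reductions of `w`. -/
def UnitPath : Src := entry 190

def UnitPathDecl : Decl := all Alg fun X => all (Word (gen X)) fun w =>
  defn (U 0) (Sig (unit X ≐ val X w) fun q => Pi (Trivial w) fun k => q ≐ sym (trivialPath X w k))

def isPropUnitPath : Src := entry 191

/-- If w is merely trivial, any reduction determines the path q; in a 1-type the equality of two
such q is a proposition, so mere existence suffices. -/
def isPropUnitPathDecl : Decl := all Alg fun X => all (isGpd (car X)) fun h => all (Word (gen X)) fun w =>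
  all (Merely (Trivial w)) fun t =>
  thm (isProp (UnitPath X w))
    (isPropSig (fn fun q => isPropPi (fn fun k => h (unit X) (val X w) q (sym (trivialPath X w k))))
      (fn2 fun u v => trRec (h (unit X) (val X w) (fst u) (fst v))
        (fn fun k => snd u k ⬝ sym (snd v k)) t))

def symCong : Src := entry 192

def symCongDecl : Decl := given (U 0) fun A => given A fun x => given A fun y => given (x ≐ y) fun p =>
  given (x ≐ y) fun q => all (p ≐ q) fun e => thm (sym p ≐ sym q) (ap (fn fun p => sym p) e)

def unitPath : Src := entry 193

/-- The truncation can be removed because the target is a proposition; `trivialUnique` shows that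
the path of one reduction is compatible with all of them. -/
def unitPathDecl : Decl := all Alg fun X => all (isGpd (car X)) fun h => all (Word (gen X)) fun w =>
  all (cls (nil (gen X)) ≐ cls w) fun p =>
  thm (UnitPath X w)
    (trRec (isPropUnitPath X h w (encode X w p))
      (fn fun k => pair (sym (trivialPath X w k))
        (fn fun k' => symCong (trivialUnique X w k k'))) (encode X w p))

def unitPathStep : Src := entry 194

/-- A reduction of w is rearranged by the strip lemma so as to start with r; then both canonical
paths are read off from it. -/
def unitPathStepDecl : Decl := all Alg fun X => all (isGpd (car X)) fun h => all (Word (gen X)) fun w =>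
  all (Redex w) fun r => all (UnitPath X w) fun u => all (UnitPath X (del w r)) fun v =>
  all (Merely (Trivial w)) fun t =>
  thm (fst u ⬝ stepPath X w r ≐ fst v)
    (trRec (h (unit X) (val X (del w r)) (fst u ⬝ stepPath X w r) (fst v))
      (fn fun k => whiskerR (snd u k) (stepPath X w r) ⬝
        symMove (liftedPath (stripTrivial X w k r)) ⬝
        sym (snd v (lifted (stripTrivial X w k r)))) t)

def decodeDecls : List Decl :=
  [appendDecl, SplitAtDecl, SplitDecl, redexRelDecl, SetGroupDecl, clsDecl, clsRelDecl,
    isSetGroupDecl, groupIndDecl, groupRecDecl, RedexToDecl, redexToDecl, redexAppendDecl,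
    redexSplitAtDecl, redexSplitDecl, SplitsDecl, splitPairDecl, splitHeadDecl, splitConsDecl,
    splitTailDecl, splitsDecl, clsStepDecl, sym1Decl, trans1Decl, symTrans1Decl, transport1Decl,
    hedbergPath1Decl, hedbergCong1Decl, hedberg1Decl, HPropDecl, hPropDecl, holdsDecl,
    isPropHoldsDecl, propExtDecl, hPropCongDecl, hPropEqDecl, HIffDecl, hPropPathDecl,
    isPropArrDecl, isPropHIffDecl, isSetHPropDecl, MerelyDecl, mereDecl, isPropMerelyDecl,
    mereMapDecl, trivialFwdDecl, trivialBwdDecl, codeWordDecl, codePathDecl, transConst1Decl,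
    codeDecl, encodeDecl, UnitPathDecl, isPropUnitPathDecl, symCongDecl, unitPathDecl,
    unitPathStepDecl]

def decodeTable : Table := extend trivialTable decodeDecls

end

end Internal
end HoTT

/-! ### Internal proofs: the algebra of labelled elements with decodings -/

namespace HoTT

namespace Internal

open Src

noncomputable section

/-! ### The action of letters on the set-based free group -/

def gAct : Src := entry 195

def gActDecl : Decl := given (U 0) fun A => all (Signed A) fun s =>
  defn (SetGroup A ⇒ SetGroup A)
    (groupRec A (SetGroup A) (isSetGroup A) (fn fun w => cls (cons s w))
      (fn3 fun v w q => clsRel (cons s v) (cons s w) (splitTail s v w q)))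

def gActInv : Src := entry 196

def gActInvDecl : Decl := given (U 0) fun A => all (Signed A) fun s =>
  thm (Pi (SetGroup A) fun g => gAct s (gAct (inv s) g) ≐ g)
    (groupInd A (fn fun g => gAct s (gAct (inv s) g) ≐ g)
      (fn fun g => isSetGroup A (gAct s (gAct (inv s) g)) g)
      (fn fun w => clsStep (cons s (cons (inv s) w))
        (headRedex s (cons (inv s) w) (refl (inv s)))))

def gInvAct : Src := entry 197

/-- Splitting the sign lets s⁻¹⁻¹ compute to s, which reduces the claim to the other cancellation
law. -/
def gInvActDecl : Decl := given (U 0) fun A => all (Signed A) fun s =>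
  thm (Pi (SetGroup A) fun g => gAct (inv s) (gAct s g) ≐ g)
    (sumCase (fn fun s => Pi (SetGroup A) fun g => gAct (inv s) (gAct s g) ≐ g)
      (fn fun a => gActInv (inr A a)) (fn fun a => gActInv (inl A a)) s)

/-! ### Elements with decoding functions -/

def Dec : Src := entry 198

def DecDecl : Decl := all Alg fun X => all (SetGroup (gen X)) fun g => all (car X) fun x =>
  defn (U 0) (Pi (Word (gen X)) fun w => g ≐ cls w ⇒ x ≐ val X w)

def DecStep : Src := entry 199

/-- Both proofs of equality of classes are quantified, so no particular proof that a removal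
preserves the class has to be tracked. -/
def DecStepDecl : Decl := all Alg fun X => all (SetGroup (gen X)) fun g => all (car X) fun x =>
  all (Dec X g x) fun d => defn (U 0)
  (Pi (Word (gen X)) fun w => Pi (g ≐ cls w) fun p => Pi (Redex w) fun r => Pi (g ≐ cls (del w r)) fun q =>
    d w p ⬝ stepPath X w r ≐ d (del w r) q)

def Decoding : Src := entry 200

def DecodingDecl : Decl := all Alg fun X => all (SetGroup (gen X)) fun g => all (car X) fun x =>
  defn (U 0) (Sig (Dec X g x) fun d => DecStep X g x d)

def decode : Src := entry 201

def decodeDecl : Decl := given Alg fun X => given (SetGroup (gen X)) fun g => given (car X) fun x =>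
  all (Decoding X g x) fun d => defn (Dec X g x) (fst d)

def decodeStep : Src := entry 202

def decodeStepDecl : Decl := given Alg fun X => given (SetGroup (gen X)) fun g => given (car X) fun x =>
  all (Decoding X g x) fun d => defn (DecStep X g x (decode d)) (snd d)

def isPropDecStep : Src := entry 203

def isPropDecStepDecl : Decl := all Alg fun X => all (isGpd (car X)) fun h => all (SetGroup (gen X)) fun g =>
  all (car X) fun x => all (Dec X g x) fun d =>
  thm (isProp (DecStep X g x d))
    (isPropPi (fn fun w => isPropPi (fn fun p => isPropPi (fn fun r => isPropPi (fn fun q =>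
      h x (val X (del w r)) (d w p ⬝ stepPath X w r) (d (del w r) q))))))

def isSetDec : Src := entry 204

def isSetDecDecl : Decl := all Alg fun X => all (isGpd (car X)) fun h => all (SetGroup (gen X)) fun g =>
  all (car X) fun x =>
  thm (isSet (Dec X g x)) (isSetPi (fn fun w => isSetPi (fn fun _ => h x (val X w))))

def isSetDecoding : Src := entry 205

def isSetDecodingDecl : Decl := all Alg fun X => all (isGpd (car X)) fun h => all (SetGroup (gen X)) fun g =>
  all (car X) fun x =>
  thm (isSet (Decoding X g x)) (isSetSig (isSetDec X h g x) (isPropDecStep X h g x))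

def decodingPath : Src := entry 206

def decodingPathDecl : Decl := all Alg fun X => all (isGpd (car X)) fun h => all (SetGroup (gen X)) fun g =>
  all (car X) fun x => all (Decoding X g x) fun d => all (Decoding X g x) fun d' =>
  all (Pi (Word (gen X)) fun w => Pi (g ≐ cls w) fun p => decode d w p ≐ decode d' w p) fun e =>
  thm (d ≐ d')
    (subtypePath (isPropDecStep X h g x) d d' (funextFn (fn fun w => funextFn (fn fun p => e w p))))

def Fibre : Src := entry 207

def FibreDecl : Decl := all Alg fun X => all (SetGroup (gen X)) fun g =>
  defn (U 0) (Sig (car X) fun x => Decoding X g x)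

def Total : Src := entry 208

def TotalDecl : Decl := all Alg fun X => defn (U 0) (Sig (SetGroup (gen X)) fun g => Fibre X g)

def total : Src := entry 209

def totalDecl : Decl := all Alg fun X => all (SetGroup (gen X)) fun g => all (car X) fun x =>
  all (Decoding X g x) fun d => defn (Total X) (pair g (pair x d))

def label : Src := entry 210

def labelDecl : Decl := given Alg fun X => all (Total X) fun z => defn (SetGroup (gen X)) (fst z)

def point : Src := entry 211

def pointDecl : Decl := given Alg fun X => all (Total X) fun z => defn (car X) (fst (snd z))

def decoding : Src := entry 212

def decodingDecl : Decl := given Alg fun X => all (Total X) fun z =>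
  defn (Decoding X (label z) (point z)) (snd (snd z))

def SameDec : Src := entry 213

/-- What remains to be compared in a path between triples, over a path of labels and the path β of
points. The compatibility with steps is a proposition and drops out. -/
def SameDecDecl : Decl := all Alg fun X => all (SetGroup (gen X)) fun g => all (car X) fun x =>
  all (Decoding X g x) fun d => all (SetGroup (gen X)) fun g' => all (car X) fun x' =>
  all (Decoding X g' x') fun d' => all (x ≐ x') fun β => defn (U 0)
  (Pi (Word (gen X)) fun w => Pi (g ≐ cls w) fun p => Pi (g' ≐ cls w) fun p' =>
    decode d w p ≐ β ⬝ decode d' w p')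

def totalPathBase : Src := entry 214

def totalPathBaseDecl : Decl := all Alg fun X => all (isGpd (car X)) fun h => all (SetGroup (gen X)) fun g =>
  all (car X) fun x => all (Decoding X g x) fun d => all (Decoding X g x) fun d' =>
  all (SameDec X g x d g x d' (refl x)) fun e =>
  thm (total X g x d ≐ total X g x d')
    (ap (total X g x) (decodingPath X h g x d d'
      (fn2 fun w p => e w p p ⬝ reflTrans (decode d' w p))))

def totalPathPoint : Src := entry 215

def totalPathPointDecl : Decl := all Alg fun X => all (isGpd (car X)) fun h => all (SetGroup (gen X)) fun g =>
  all (car X) fun x => all (Decoding X g x) fun d => all (car X) fun x' => all (x ≐ x') fun β =>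
  thm (Pi (Decoding X g x') fun d' => SameDec X g x d g x' d' β ⇒ total X g x d ≐ total X g x' d')
    (J (fn2 fun x' β => Pi (Decoding X g x') fun d' =>
      SameDec X g x d g x' d' β ⇒ total X g x d ≐ total X g x' d')
      (totalPathBase X h g x d) β)

def totalPath : Src := entry 216

def totalPathDecl : Decl := all Alg fun X => all (isGpd (car X)) fun h => all (SetGroup (gen X)) fun g =>
  all (car X) fun x => all (Decoding X g x) fun d => all (SetGroup (gen X)) fun g' => all (car X) fun x' =>
  all (g ≐ g') fun α => all (x ≐ x') fun β =>
  thm (Pi (Decoding X g' x') fun d' => SameDec X g x d g' x' d' β ⇒ total X g x d ≐ total X g' x' d')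
    (J (fn2 fun g' _ => Pi (Decoding X g' x') fun d' =>
      SameDec X g x d g' x' d' β ⇒ total X g x d ≐ total X g' x' d')
      (totalPathPoint X h g x d x' β) α)

def totalUnit : Src := entry 217

def totalUnitDecl : Decl := all Alg fun X => all (isGpd (car X)) fun h =>
  defn (Total X) (total X (cls (nil (gen X))) (unit X)
    (pair (fn2 fun w p => fst (unitPath X h w p))
      (fn4 fun w p r q => unitPathStep X h w r (unitPath X h w p) (unitPath X h (del w r) q)
        (encode X w p))))

/-! ### The action of letters -/

def back : Src := entry 218

def backDecl : Decl := given (U 0) fun A => all (Signed A) fun s => all (SetGroup A) fun g => all (Word A) fun w =>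
  all (gAct s g ≐ cls w) fun p =>
  thm (g ≐ cls (cons (inv s) w)) (sym (gInvAct s g) ⬝ ap (gAct (inv s)) p)

def shiftDec : Src := entry 219

/-- If s g is the class of w, then g is the class of s⁻¹ w; decode there, apply s, and cancel s s⁻¹.
-/
def shiftDecDecl : Decl := all Alg fun X => all (Signed (gen X)) fun s => all (SetGroup (gen X)) fun g =>
  all (car X) fun x => all (Decoding X g x) fun d =>
  defn (Dec X (gAct s g) (act X s x))
    (fn2 fun w p => ap (act X s) (decode d (cons (inv s) w) (back s g w p)) ⬝ rho X s (val X w))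

def shiftLemma : Src := entry 220

def shiftLemmaDecl : Decl := given (U 0) fun A => given (U 0) fun B => all (A ⇒ B) fun f =>
  given A fun x => given A fun y => given A fun y' => given B fun z => given B fun z' =>
  all (x ≐ y) fun a => all (y ≐ y') fun k => all (x ≐ y') fun a' => all (a ⬝ k ≐ a') fun e =>
  all (f y ≐ z) fun b => all (z ≐ z') fun t => all (f y' ≐ z') fun b' =>
  all (ap f k ⬝ b' ≐ b ⬝ t) fun n =>
  thm (ap f a ⬝ b ⬝ t ≐ ap f a' ⬝ b')
    (assoc (ap f a) b t ⬝ whiskerL (ap f a) (sym n) ⬝ sym (assoc (ap f a) (ap f k) b') ⬝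
      whiskerR (sym (apTrans f a k) ⬝ apCong f e) b')

def shiftStep : Src := entry 221

/-- A redex of w is one of s⁻¹ w, so the old compatibility applies; naturality of `rho` moves the
step past the cancellation, and `shiftLemma` is the path algebra. -/
def shiftStepDecl : Decl := all Alg fun X => all (Signed (gen X)) fun s => all (SetGroup (gen X)) fun g =>
  all (car X) fun x => all (Decoding X g x) fun d =>
  thm (DecStep X (gAct s g) (act X s x) (shiftDec X s g x d))
    (fn4 fun w p r q => shiftLemma (act X s) (decode d (cons (inv s) w) (back s g w p))
      (ap (act X (inv s)) (stepPath X w r))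
      (decode d (cons (inv s) (del w r)) (back s g (del w r) q))
      (decodeStep d (cons (inv s) w) (back s g w p) (tailRedex (inv s) w r) (back s g (del w r) q))
      (rho X s (val X w)) (stepPath X w r) (rho X s (val X (del w r)))
      (naturality (act X (inv s)) (act X s) (rho X s) (stepPath X w r)))

def shift : Src := entry 222

def shiftDecl : Decl := all Alg fun X => all (Signed (gen X)) fun s => all (SetGroup (gen X)) fun g =>
  all (car X) fun x => all (Decoding X g x) fun d =>
  defn (Decoding X (gAct s g) (act X s x)) (pair (shiftDec X s g x d) (shiftStep X s g x d))

def totalAct : Src := entry 223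

def totalActDecl : Decl := all Alg fun X => all (Signed (gen X)) fun s => all (Total X) fun z =>
  defn (Total X) (total X (gAct s (label z)) (act X s (point z))
    (shift X s (label z) (point z) (decoding z)))

def rhoCohInv : Src := entry 224

def rhoCohInvDecl : Decl := all Alg fun X => all (Signed (gen X)) fun s => all (car X) fun x =>
  thm (ap (act X (inv s)) (rho X s x) ≐ rhoInv X s (act X (inv s) x))
    (sumCase (fn fun s => ap (act X (inv s)) (rho X s x) ≐ rhoInv X s (act X (inv s) x))
      (fn fun a => rhoCoh X (inr (gen X) a) x) (fn fun a => rhoCoh X (inl (gen X) a) x) s)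

def roundLemma : Src := entry 225

def roundLemmaDecl : Decl := given (U 0) fun A => given (U 0) fun B => all (A ⇒ B) fun f => all (B ⇒ A) fun g =>
  all (Pi A fun x => g (f x) ≐ x) fun h => given A fun x => given A fun z =>
  given B fun y' => all (x ≐ g y') fun a => all (f (g y') ≐ y') fun b => all (g y' ≐ z) fun k =>
  all (x ≐ z) fun a' => all (a ⬝ k ≐ a') fun e => all (ap g b ≐ h (g y')) fun n =>
  thm (ap g (ap f a ⬝ b) ⬝ k ≐ h x ⬝ a')
    (whiskerR (apTrans g (ap f a) b ⬝ whiskerL (ap g (ap f a)) n ⬝ naturality f g h a) k ⬝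
      assoc (h x) a k ⬝ whiskerL (h x) e)

def roundDec : Src := entry 226

/-- Acting by s and then s⁻¹ decodes at s⁻¹ s⁻¹⁻¹ w instead of w. Compatibility with the redex at
its head compares the two decodings, and the triangle law `rhoCohInv` identifies the remaining
cancellations. -/
def roundDecDecl : Decl := all Alg fun X => all (Signed (gen X)) fun s => all (SetGroup (gen X)) fun g =>
  all (car X) fun x => all (Decoding X g x) fun d =>
  thm (SameDec X (gAct (inv s) (gAct s g)) (act X (inv s) (act X s x))
      (shift X (inv s) (gAct s g) (act X s x) (shift X s g x d)) g x d (rhoInv X s x))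
    (fn3 fun w p p' => roundLemma (act X s) (act X (inv s)) (rhoInv X s)
      (decode d (cons (inv s) (cons (inv (inv s)) w))
        (back s g (cons (inv (inv s)) w) (back (inv s) (gAct s g) w p)))
      (rho X s (val X (cons (inv (inv s)) w))) (rho X (inv s) (val X w)) (decode d w p')
      (decodeStep d (cons (inv s) (cons (inv (inv s)) w))
        (back s g (cons (inv (inv s)) w) (back (inv s) (gAct s g) w p))
        (headRedex (inv s) (cons (inv (inv s)) w) (refl (inv (inv s)))) p')
      (rhoCohInv X s (val X (cons (inv (inv s)) w))))

def roundTotal : Src := entry 227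

def roundTotalDecl : Decl := all Alg fun X => all (isGpd (car X)) fun h => all (Signed (gen X)) fun s =>
  all (SetGroup (gen X)) fun g => all (car X) fun x => all (Decoding X g x) fun d =>
  thm (totalAct X (inv s) (totalAct X s (total X g x d)) ≐ total X g x d)
    (totalPath X h (gAct (inv s) (gAct s g)) (act X (inv s) (act X s x))
      (shift X (inv s) (gAct s g) (act X s x) (shift X s g x d)) g x (gInvAct s g) (rhoInv X s x) d
      (roundDec X s g x d))

def totalInvAct : Src := entry 228

/-- Pairs have no η-rule by conversion, so the element is taken apart by the eliminator first. -/
def totalInvActDecl : Decl := all Alg fun X => all (isGpd (car X)) fun h => all (Signed (gen X)) fun s =>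
  all (Total X) fun z =>
  thm (totalAct X (inv s) (totalAct X s z) ≐ z)
    (c (.sigElim 0 0) (fn fun z => totalAct X (inv s) (totalAct X s z) ≐ z)
      (fn2 fun g y => c (.sigElim 0 0)
        (fn fun y => totalAct X (inv s) (totalAct X s (full (.pair 0) (SetGroup (gen X)) (Fibre X) g y)) ≐
          full (.pair 0) (SetGroup (gen X)) (Fibre X) g y)
        (fn2 fun x d => roundTotal X h s g x d) y) z)

def totalAlg : Src := entry 229

def totalAlgDecl : Decl := all Alg fun X => all (isGpd (car X)) fun h =>
  defn Alg (c (.pair 1) (gen X) (c (.pair 1) (isSetGen X) (c (.pair 1) (Total X)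
    (c (.pair 1) (totalUnit X h) (c (.pair 1) (fn2 fun a z => totalAct X (inl (gen X) a) z)
      (fn fun a => adjointify (totalAct X (inl (gen X) a)) (totalAct X (inr (gen X) a))
        (totalInvAct X h (inl (gen X) a)) (totalInvAct X h (inr (gen X) a))))))))

def fibreDecls : List Decl :=
  [gActDecl, gActInvDecl, gInvActDecl, DecDecl, DecStepDecl, DecodingDecl, decodeDecl,
    decodeStepDecl, isPropDecStepDecl, isSetDecDecl, isSetDecodingDecl, decodingPathDecl,
    FibreDecl, TotalDecl, totalDecl, labelDecl, pointDecl, decodingDecl, SameDecDecl,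
    totalPathBaseDecl, totalPathPointDecl, totalPathDecl, totalUnitDecl, backDecl, shiftDecDecl,
    shiftLemmaDecl, shiftStepDecl, shiftDecl, totalActDecl, rhoCohInvDecl, roundLemmaDecl,
    roundDecDecl, roundTotalDecl, totalInvActDecl, totalAlgDecl]

def fibreTable : Table := extend decodeTable fibreDecls

end

end Internal
end HoTT

/-! ### Internal proofs: the comparison with the free ∞-group -/

namespace HoTT

namespace Internal

open Src

noncomputable section

/-! ### The free group -/

def Free (A : Src) : Src := c (.free 0) A

def fUnit (A : Src) : Src := full (.fUnit 0) A

def fCons (A : Src) : Src := full (.fCons 0) A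

def eqAct (A X f g : Src) : Src := full (.eq 0) (A ⇒ Free A ⇒ X) f g

def isContr : Src := entry 230

def isContrDecl : Decl := all (U 0) fun A => defn (U 0) (Sig A fun x => Pi A fun y => x ≐ y)

def Hom : Src := entry 231

def HomDecl : Decl := all Alg fun X => defn (U 0)
  (Sig (Free (gen X) ⇒ car X) fun f => Sig (f (fUnit (gen X)) ≐ unit X) fun _ =>
    eqAct (gen X) (car X) (fn2 fun a x => f (fCons (gen X) a x)) (fn2 fun a x => gact X a (f x)))

def homFun : Src := entry 232

def homFunDecl : Decl := given Alg fun X => all (Hom X) fun k => defn (Free (gen X) ⇒ car X) (fst k)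

def homUnit : Src := entry 233

def homUnitDecl : Decl := given Alg fun X => all (Hom X) fun k =>
  thm (homFun k (fUnit (gen X)) ≐ unit X) (fst (snd k))

def homAct : Src := entry 234

def homActDecl : Decl := all Alg fun X => all (Hom X) fun k =>
  thm (eqAct (gen X) (car X) (fn2 fun a x => homFun k (fCons (gen X) a x))
    (fn2 fun a x => gact X a (homFun k x))) (snd (snd k))

def init : Src := entry 235

def initDecl : Decl := all Alg fun X => thm (isContr (Hom X))
  (full (.fInit 0 0) (gen X) (car X) (unit X) (gact X) (gequ X))

def homInit : Src := entry 236

def homInitDecl : Decl := all Alg fun X => defn (Hom X) (fst (init X))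

def homUnique : Src := entry 237

def homUniqueDecl : Decl := all Alg fun X => all (Hom X) fun k => all (Hom X) fun l => all (Free (gen X)) fun x =>
  thm (homFun k x ≐ homFun l x) (ap (fn fun k => homFun k x) (sym (snd (init X) k) ⬝ snd (init X) l))

/-! ### Elements of the free group have decoding functions -/

def initTotal : Src := entry 238

def initTotalDecl : Decl := all Alg fun X => all (isGpd (car X)) fun h => all (Free (gen X)) fun x =>
  defn (Total X) (homFun (homInit (totalAlg X h)) x)

def initUnit : Src := entry 239

def initUnitDecl : Decl := all Alg fun X => all (isGpd (car X)) fun h =>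
  thm (initTotal X h (fUnit (gen X)) ≐ totalUnit X h)
    (homUnit (homInit (totalAlg X h)))

def initAct : Src := entry 240

def initActDecl : Decl := all Alg fun X => all (isGpd (car X)) fun h =>
  thm (eqAct (gen (totalAlg X h)) (Total X) (fn2 fun a x => initTotal X h (fCons (gen X) a x))
      (fn2 fun a x => totalAct X (inl (gen X) a) (initTotal X h x)))
    (homAct (totalAlg X h) (homInit (totalAlg X h)))

def initLabel : Src := entry 241

def initLabelDecl : Decl := all Alg fun X => all (isGpd (car X)) fun h => all (Free (gen X)) fun x =>
  defn (SetGroup (gen X)) (label (initTotal X h x))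

def labelUnit : Src := entry 242

def labelUnitDecl : Decl := all Alg fun X => all (isGpd (car X)) fun h =>
  thm (initLabel X h (fUnit (gen X)) ≐ cls (nil (gen X)))
    (ap (fn fun z => label z) (initUnit X h))

def labelAct : Src := entry 243

def labelActDecl : Decl := all Alg fun X => all (isGpd (car X)) fun h => all (gen X) fun a =>
  all (Free (gen X)) fun x =>
  thm (initLabel X h (fCons (gen X) a x) ≐ gAct (inl (gen X) a) (initLabel X h x))
    (ap (fn fun k => label (k a x)) (initAct X h))

def pointHom : Src := entry 244

def pointHomDecl : Decl := all Alg fun X => all (isGpd (car X)) fun h =>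
  defn (Hom X) (pair (fn fun x => point (initTotal X h x))
    (pair (ap (fn fun z => point z) (initUnit X h))
      (ap (fn fun k => fn2 fun a x => point (k a x)) (initAct X h))))

def initDecoding : Src := entry 245

/-- Forgetting label and decoding turns the initial map to `totalAlg` into a morphism to X. It
agrees with the given k by uniqueness, and the decoding is transported along this agreement. -/
def initDecodingDecl : Decl := all Alg fun X => all (isGpd (car X)) fun h => all (Hom X) fun k =>
  all (Free (gen X)) fun x =>
  thm (Decoding X (initLabel X h x) (homFun k x))
    (transport (Decoding X (initLabel X h x)) (homUnique X (pointHom X h) k x)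
      (decoding (initTotal X h x)))

/-! ### Labelled algebras -/

def LabelUnit : Src := entry 246

def LabelUnitDecl : Decl := all Alg fun X => all (car X ⇒ SetGroup (gen X)) fun φ =>
  defn (U 0) (φ (unit X) ≐ cls (nil (gen X)))

def LabelAct : Src := entry 247

def LabelActDecl : Decl := all Alg fun X => all (car X ⇒ SetGroup (gen X)) fun φ => defn (U 0)
  (Pi (gen X) fun a => Pi (car X) fun x => φ (gact X a x) ≐ gAct (inl (gen X) a) (φ x))

def labelInv : Src := entry 248

/-- Compatibility with inverse letters is automatic: write the label as a⁻¹ a of itself and use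
compatibility with a. -/
def labelInvDecl : Decl := all Alg fun X => all (car X ⇒ SetGroup (gen X)) fun φ => all (LabelAct X φ) fun e =>
  all (gen X) fun a => all (car X) fun x =>
  thm (φ (ginv X a x) ≐ gAct (inr (gen X) a) (φ x))
    (sym (gInvAct (inl (gen X) a) (φ (ginv X a x))) ⬝
      ap (gAct (inr (gen X) a)) (sym (e a (ginv X a x)) ⬝ ap φ (geps X a x)))

def labelLetter : Src := entry 249

def labelLetterDecl : Decl := all Alg fun X => all (car X ⇒ SetGroup (gen X)) fun φ => all (LabelAct X φ) fun e =>
  all (Signed (gen X)) fun s =>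
  thm (Pi (car X) fun x => φ (act X s x) ≐ gAct s (φ x))
    (sumCase (fn fun s => Pi (car X) fun x => φ (act X s x) ≐ gAct s (φ x))
      (fn fun a => e a) (fn fun a => labelInv X φ e a) s)

def labelVal : Src := entry 250

def labelValDecl : Decl := all Alg fun X => all (car X ⇒ SetGroup (gen X)) fun φ => all (LabelUnit X φ) fun u =>
  all (LabelAct X φ) fun e => all (Word (gen X)) fun w =>
  thm (φ (val X w) ≐ cls w)
    (listCase (fn fun w => φ (val X w) ≐ cls w) u
      (fn3 fun s w ih => labelLetter X φ e s (val X w) ⬝ ap (gAct s) ih) w)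

def Decoder : Src := entry 251

def DecoderDecl : Decl := all Alg fun X => all (car X ⇒ SetGroup (gen X)) fun φ =>
  defn (U 0) (Pi (car X) fun x => Decoding X (φ x) x)

def labelInd : Src := entry 252

/-- Elements of X may be assumed to be values of words: in proving a proposition, the label may be
taken to be a class [w], and decoding there gives a path from x to the value of w. -/
def labelIndDecl : Decl := all Alg fun X => all (car X ⇒ SetGroup (gen X)) fun φ => all (Decoder X φ) fun m =>
  all (car X ⇒ U 0) fun Q => all (Pi (car X) fun x => isProp (Q x)) fun h =>
  all (Pi (Word (gen X)) fun w => Q (val X w)) fun f => all (car X) fun x =>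
  thm (Q x)
    (groupInd (gen X) (fn fun g => φ x ≐ g ⇒ Q x) (fn fun g => isPropArr (φ x ≐ g) (Q x) (h x))
      (fn2 fun w p => transport Q (sym (decode (m x) w p)) (f w)) (φ x) (refl (φ x)))

def labelSet : Src := entry 253

/-- For x the value of w, equality of [w] with the label of y is a proposition, holds for y = x, and
implies x = y by decoding. Hedberg's argument applies, and `labelInd` reaches every x. -/
def labelSetDecl : Decl := all Alg fun X => all (car X ⇒ SetGroup (gen X)) fun φ => all (LabelUnit X φ) fun u =>
  all (LabelAct X φ) fun e => all (Decoder X φ) fun m =>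
  thm (isSet (car X))
    (labelInd X φ m (fn fun x => Pi (car X) fun y => isProp (x ≐ y))
      (fn fun x => isPropPi (fn fun y => isPropIsProp (x ≐ y)))
      (fn fun w => hedberg (val X w) (fn fun y => cls w ≐ φ y) (fn fun y => isSetGroup (gen X) (cls w) (φ y))
        (sym (labelVal X φ u e w)) (fn2 fun y p => sym (decode (m y) w (sym p)))))

def valSplit : Src := entry 254

def valSplitDecl : Decl := all Alg fun X => all (Word (gen X)) fun v => all (Word (gen X)) fun w =>
  all (Split v w) fun q =>
  thm (val X v ≐ val X w)
    (stepPath X v (fst (redexSplit v w q)) ⬝ ap (val X) (snd (redexSplit v w q)))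

def groupVal : Src := entry 255

def groupValDecl : Decl := all Alg fun X => all (isSet (car X)) fun h =>
  defn (SetGroup (gen X) ⇒ car X) (groupRec (gen X) (car X) h (val X) (valSplit X))

def labelEquiv : Src := entry 256

/-- The inverse evaluates a class in X, which is possible because X is a set. Both round trips are
checked on words, where the label of a value is the class. -/
def labelEquivDecl : Decl := all Alg fun X => all (car X ⇒ SetGroup (gen X)) fun φ => all (LabelUnit X φ) fun u =>
  all (LabelAct X φ) fun e => all (Decoder X φ) fun m => all (isSet (car X)) fun h =>
  thm (isEquiv (car X) (SetGroup (gen X)) φ)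
    (adjointify φ (groupVal X h)
      (labelInd X φ m (fn fun x => groupVal X h (φ x) ≐ x) (fn fun x => h (groupVal X h (φ x)) x)
        (fn fun w => ap (groupVal X h) (labelVal X φ u e w)))
      (groupInd (gen X) (fn fun g => φ (groupVal X h g) ≐ g)
        (fn fun g => isSetGroup (gen X) (φ (groupVal X h g)) g) (labelVal X φ u e)))

/-! ### The two algebras -/

def freeAlg : Src := entry 257

def freeAlgDecl : Decl := all (U 0) fun A => all (isSet A) fun h =>
  defn Alg (c (.pair 1) A (c (.pair 1) h (c (.pair 1) (Free A)
    (c (.pair 1) (fUnit A) (c (.pair 1) (fCons A)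
      (fn fun a => pair (full (.fIcons 0) A a) (pair (full (.fMu1 0) A a)
        (pair (full (.fMu2 0) A a) (full (.fMu 0) A a)))))))))

def freeHom : Src := entry 258

def freeHomDecl : Decl := all (U 0) fun A => all (isSet A) fun h =>
  defn (Hom (freeAlg A h)) (pair (fn fun x => x) (pair (refl (fUnit A))
    (refl (fCons A))))

def Trunc : Src := entry 259

def TruncDecl : Decl := all (U 0) fun A => defn (U 0) (c (.tr 2 0) A)

def trunc : Src := entry 260

def truncDecl : Decl := given (U 0) fun A => all A fun a => defn (Trunc A) (c (.trIn 2 0) a)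

def isGpdTrunc : Src := entry 261

def isGpdTruncDecl : Decl := all (U 0) fun A => thm (isGpd (Trunc A)) (full (.trLevel 2 0) A)

def truncInd : Src := entry 262

def truncIndDecl : Decl := given (U 0) fun A => all (Trunc A ⇒ U 0) fun P =>
  all (Pi (Trunc A) fun x => isGpd (P x)) fun h => all (Pi A fun a => P (trunc a)) fun f =>
  all (Trunc A) fun x => defn (P x) (full (.trElim 2 0 0) A P h f x)

def truncMap : Src := entry 263

def truncMapDecl : Decl := given (U 0) fun A => given (U 0) fun B => all (A ⇒ B) fun f => all (Trunc A) fun x =>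
  defn (Trunc B) (truncInd (fn fun _ => Trunc B) (fn fun _ => isGpdTrunc B) (fn fun a => trunc (f a)) x)

def truncRound : Src := entry 264

def truncRoundDecl : Decl := given (U 0) fun A => given (U 0) fun B => all (A ⇒ B) fun f => all (B ⇒ A) fun g =>
  all (Pi A fun x => g (f x) ≐ x) fun η => all (Trunc A) fun x =>
  thm (truncMap g (truncMap f x) ≐ x)
    (truncInd (fn fun x => truncMap g (truncMap f x) ≐ x)
      (fn fun x => setGpd (isGpdTrunc A (truncMap g (truncMap f x)) x))
      (fn fun a => ap (fn fun a => trunc a) (η a)) x)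

def truncAlg : Src := entry 265

/-- Truncation carries over the two inverse laws of each generator; `adjointify` then supplies a
coherent equivalence. -/
def truncAlgDecl : Decl := all (U 0) fun A => all (isSet A) fun h =>
  defn Alg (c (.pair 1) A (c (.pair 1) h (c (.pair 1) (Trunc (Free A))
    (c (.pair 1) (trunc (fUnit A)) (c (.pair 1) (fn fun a => truncMap (fCons A a))
      (fn fun a => adjointify (truncMap (fCons A a)) (truncMap (full (.fIcons 0) A a))
        (truncRound (fCons A a) (full (.fIcons 0) A a) (full (.fMu1 0) A a))
        (truncRound (full (.fIcons 0) A a) (fCons A a) (full (.fMu2 0) A a))))))))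

def truncHom : Src := entry 266

def truncHomDecl : Decl := all (U 0) fun A => all (isSet A) fun h =>
  defn (Hom (truncAlg A h)) (pair (fn fun x => trunc x) (pair (refl (trunc (fUnit A)))
    (refl (fn2 fun a x => trunc (fCons A a x)))))

def truncLabel : Src := entry 267

def truncLabelDecl : Decl := all (U 0) fun A => all (isSet A) fun h => all (Free A) fun x =>
  defn (SetGroup A) (initLabel (truncAlg A h) (isGpdTrunc (Free A)) x)

def truncLabelUnit : Src := entry 268

def truncLabelUnitDecl : Decl := all (U 0) fun A => all (isSet A) fun h =>
  thm (truncLabel A h (fUnit A) ≐ cls (nil A)) (labelUnit (truncAlg A h) (isGpdTrunc (Free A)))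

def truncLabelAct : Src := entry 269

def truncLabelActDecl : Decl := all (U 0) fun A => all (isSet A) fun h => all A fun a => all (Free A) fun x =>
  thm (truncLabel A h (fCons A a x) ≐ gAct (inl A a) (truncLabel A h x))
    (labelAct (truncAlg A h) (isGpdTrunc (Free A)) a x)

def truncGroup : Src := entry 270

def truncGroupDecl : Decl := all (U 0) fun A => all (isSet A) fun h => all (Trunc (Free A)) fun x =>
  defn (SetGroup A)
    (truncInd (fn fun _ => SetGroup A) (fn fun _ => setGpd (isSetGroup A)) (truncLabel A h) x)

def truncGroupAct : Src := entry 271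

def truncGroupActDecl : Decl := all (U 0) fun A => all (isSet A) fun h => all A fun a => all (Trunc (Free A)) fun x =>
  thm (truncGroup A h (truncMap (fCons A a) x) ≐ gAct (inl A a) (truncGroup A h x))
    (truncInd (fn fun x => truncGroup A h (truncMap (fCons A a) x) ≐ gAct (inl A a) (truncGroup A h x))
      (fn fun x => setGpd (propSet (isSetGroup A (truncGroup A h (truncMap (fCons A a) x))
        (gAct (inl A a) (truncGroup A h x)))))
      (truncLabelAct A h a) x)

def truncDecoder : Src := entry 272

/-- Decodings in a 1-type form a set, so truncation induction reduces to elements of F A, where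
`initDecoding` is applied to the inclusion into the truncation. -/
def truncDecoderDecl : Decl := all (U 0) fun A => all (isSet A) fun h => all (Trunc (Free A)) fun x =>
  thm (Decoding (truncAlg A h) (truncGroup A h x) x)
    (truncInd (fn fun x => Decoding (truncAlg A h) (truncGroup A h x) x)
      (fn fun x => setGpd (isSetDecoding (truncAlg A h) (isGpdTrunc (Free A)) (truncGroup A h x) x))
      (fn fun x => initDecoding (truncAlg A h) (isGpdTrunc (Free A)) (truncHom A h) x) x)

def truncEquiv : Src := entry 273

def truncEquivDecl : Decl := all (U 0) fun A => all (isSet A) fun h =>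
  thm (isEquiv (Trunc (Free A)) (SetGroup A) (truncGroup A h))
    (labelEquiv (truncAlg A h) (truncGroup A h) (truncLabelUnit A h) (truncGroupAct A h)
      (truncDecoder A h)
      (labelSet (truncAlg A h) (truncGroup A h) (truncLabelUnit A h) (truncGroupAct A h)
        (truncDecoder A h)))

def Equiv : Src := entry 274

def EquivDecl : Decl := all (U 0) fun A => all (U 0) fun B =>
  defn (U 0) (Sig (A ⇒ B) fun f => isEquiv A B f)

/-- Equivalences between `X` and the set-based free group that take `k w` to the class of `w`. -/
def Compare : Src := entry 275

def CompareDecl : Decl := all (U 0) fun A => all (U 0) fun X => all (Word A ⇒ X) fun k => defn (U 0)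
  (Sig (Equiv X (SetGroup A)) fun e => Pi (Word A) fun w => fst e (k w) ≐ cls w)

def compare : Src := entry 276

def compareDecl : Decl := all (U 0) fun A => all (U 0) fun X => all (Word A ⇒ X) fun k =>
  all (X ⇒ SetGroup A) fun φ => all (isEquiv X (SetGroup A) φ) fun e =>
  all (Pi (Word A) fun w => φ (k w) ≐ cls w) fun v =>
  thm (Compare A X k) (pair (pair φ e) v)

def truncCompare : Src := entry 277

/-- On the image of F A the comparison map computes to `truncLabel`, so its value on words is found
in the algebra F A itself. -/
def truncCompareDecl : Decl := all (U 0) fun A => all (isSet A) fun h =>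
  thm (Compare A (Trunc (Free A)) (fn fun w => trunc (val (freeAlg A h) w)))
    (compare A (Trunc (Free A)) (fn fun w => trunc (val (freeAlg A h) w)) (truncGroup A h)
      (truncEquiv A h)
      (labelVal (freeAlg A h) (truncLabel A h) (truncLabelUnit A h) (truncLabelAct A h)))

def freeEquiv : Src := entry 278

def freeEquivDecl : Decl := all (U 0) fun A => all (isSet A) fun h => all (isSet (Free A)) fun k =>
  thm (isEquiv (Free A) (SetGroup A) (initLabel (freeAlg A h) (setGpd k)))
    (labelEquiv (freeAlg A h) (initLabel (freeAlg A h) (setGpd k)) (labelUnit (freeAlg A h) (setGpd k))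
      (labelAct (freeAlg A h) (setGpd k)) (initDecoding (freeAlg A h) (setGpd k) (freeHom A h)) k)

def freeCompare : Src := entry 279

def freeCompareDecl : Decl := all (U 0) fun A => all (isSet A) fun h => all (isSet (Free A)) fun k =>
  thm (Compare A (Free A) (val (freeAlg A h)))
    (compare A (Free A) (val (freeAlg A h)) (initLabel (freeAlg A h) (setGpd k)) (freeEquiv A h k)
      (labelVal (freeAlg A h) (initLabel (freeAlg A h) (setGpd k)) (labelUnit (freeAlg A h) (setGpd k))
        (labelAct (freeAlg A h) (setGpd k))))

def comparisonDecls : List Decl :=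
  [isContrDecl, HomDecl, homFunDecl, homUnitDecl, homActDecl, initDecl, homInitDecl, homUniqueDecl,
    initTotalDecl, initUnitDecl, initActDecl, initLabelDecl, labelUnitDecl, labelActDecl,
    pointHomDecl, initDecodingDecl, LabelUnitDecl, LabelActDecl, labelInvDecl, labelLetterDecl,
    labelValDecl, DecoderDecl, labelIndDecl, labelSetDecl, valSplitDecl, groupValDecl,
    labelEquivDecl, freeAlgDecl, freeHomDecl, TruncDecl, truncDecl, isGpdTruncDecl, truncIndDecl,
    truncMapDecl, truncRoundDecl, truncAlgDecl, truncHomDecl, truncLabelDecl, truncLabelUnitDecl,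
    truncLabelActDecl, truncGroupDecl, truncGroupActDecl, truncDecoderDecl, truncEquivDecl,
    EquivDecl, CompareDecl, compareDecl, truncCompareDecl, freeEquivDecl, freeCompareDecl]

def comparisonTable : Table := extend fibreTable comparisonDecls

end

end Internal
end HoTT

/-! ### Evaluation of the checker and the final statement -/

namespace HoTT

open Internal Exp

/-! ### The theorem -/

set_option maxRecDepth 100000

theorem constTable_meaningful : constTable.Meaningful := meaningful_constTable (by decide +kernel)

theorem Internal.pathTable_meaningful : pathTable.Meaningful :=
  constTable_meaningful.extend (by decide +kernel)

theorem Internal.setTable_meaningful : setTable.Meaningful :=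
  pathTable_meaningful.extend (by decide +kernel)

theorem Internal.diamondTable_meaningful : diamondTable.Meaningful :=
  setTable_meaningful.extend (by decide +kernel)

theorem Internal.trivialTable_meaningful : trivialTable.Meaningful :=
  diamondTable_meaningful.extend (by decide +kernel)

theorem Internal.decodeTable_meaningful : decodeTable.Meaningful :=
  trivialTable_meaningful.extend (by decide +kernel)

theorem Internal.fibreTable_meaningful : fibreTable.Meaningful :=
  decodeTable_meaningful.extend (by decide +kernel)

theorem Internal.comparisonTable_meaningful : comparisonTable.Meaningful :=
  fibreTable_meaningful.extend (by decide +kernel)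

/-- The two comparisons, for a type in the universe number `i`. -/
def truncStatement (i : ℕ) : Exp := Pi (U i) fun A => Exp.isSet i A ⇾ TruncComparison i A

def freeStatement (i : ℕ) : Exp :=
  Pi (U i) fun A => Exp.isSet i A ⇾ Exp.isSet i (Free i A) ⇾ Comparison i A

theorem provable_statements : Provable (truncStatement 0) ∧ Provable (freeStatement 0) := by
  -- This is where the internally defined notions are matched with those of the theorem, by
  -- conversion.
  have h : (checkElem comparisonTable truncCompare.index (truncStatement 0) &&
      checkElem comparisonTable freeCompare.index (freeStatement 0)) = true := by decide +kernel
  rw [Bool.and_eq_true] at h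
  exact ⟨comparisonTable_meaningful.provable h.1, comparisonTable_meaningful.provable h.2⟩

end HoTT

theorem mainTheorem3 (i : ℕ) :
    HoTT.Provable
      (HoTT.Exp.Pi (HoTT.Exp.U i) fun A => HoTT.Exp.arr (HoTT.Exp.isSet i A)
        (HoTT.TruncComparison i A)) ∧
    HoTT.Provable
      (HoTT.Exp.Pi (HoTT.Exp.U i) fun A => HoTT.Exp.arr (HoTT.Exp.isSet i A)
        (HoTT.Exp.arr (HoTT.Exp.isSet i (HoTT.Exp.Free i A)) (HoTT.Comparison i A))) :=
  -- Raising the levels of the statement for level j by i gives the statement for level j + i by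
  -- computation.
  ⟨HoTT.provable_of_zero i HoTT.truncStatement (fun _ => rfl) HoTT.provable_statements.1,
    HoTT.provable_of_zero i HoTT.freeStatement (fun _ => rfl) HoTT.provable_statements.2⟩
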